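/- **Lemma (Consistency).** Let $d\in\{2,3\}$, let $\hat\Omega=\prod_i(\zeta_{i,0},\zeta_{i,N_i})$ be a parametric box meshed by unique knot values $\zeta_{i,0}<\dots<\zeta_{i,N_i}$, and let $\alpha'\ge 0$, $k'\ge\alpha'+1$ be integers. Let $\mathcal F$ be injective and $C^1$ with invertible Jacobian on the closed box, and $C^{\alpha'+2}$ on each closed parametric element; put $\Omega=\mathcal F(\hat\Omega)$. Let $\mathbf H^1_{\boldsymbol n}(\Omega)$ be the space of $\boldsymbol v\in\mathbf H^1(\Omega)$ with $\boldsymbol v\cdot\boldsymbol n=0$ on $\partial\Omega$ in the sense of traces. Let $\mathcal V_h$ be the space of $\boldsymbol v\in\mathbf H^1_{\boldsymbol n}(\Omega)$ whose pullback $\det(D\mathcal F)(D\mathcal F)^{-1}(\boldsymbol v\circ\mathcal F)$ has as $l$-th component ($l=1,\dots,d$) a tensor-product B-spline over open knot vectors with interior multiplicities $k'-\alpha'$, of degree $k'+1$ in direction $l$ and $k'$ in the other directions. Let $\mathring{\mathcal V}_h=\{\boldsymbol v\in\mathcal V_h:\nabla\cdot\boldsymbol v=0\}$. Let $\nu>0$,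 $h>0$, $C_{\rm Nit}\in\mathbb R$, let $\boldsymbol f(t)\in \mathbf L^2(\Omega)$ for $t\in(0,T]$, and let $(\boldsymbol u,p)$ be a weak solution on $(0,T]$ of the incompressible Navier–Stokes equations with homogeneous Dirichlet data $\boldsymbol u_D=\boldsymbol 0$: for every $t\in(0,T]$, $\boldsymbol u(t)\in\mathbf H^1_0(\Omega)$, $p(t)\in L^2_0(\Omega)$ (mean-zero $L^2$ functions), $\partial_t\boldsymbol u(t)\in\mathbf L^2(\Omega)$ exists as the derivative of $\boldsymbol u$ in $\mathbf L^2(\Omega)$, and for all $\boldsymbol v\in\mathbf H^1_0(\Omega)$, $q\in L^2_0(\Omega)$, $$(\partial_t\boldsymbol u,\boldsymbol v)+A(\boldsymbol u,\boldsymbol v)+C(\boldsymbol u;\boldsymbol u,\boldsymbol v)+(\nabla\cdot\boldsymbol u,q)-(\nabla\cdot\boldsymbol v,p)=(\boldsymbol f,\boldsymbol v),$$ with $A(\boldsymbol u,\boldsymbol v)=(2\nu\nabla^s\boldsymbol u,\nabla^s\boldsymbol v)$ and $C(\boldsymbol w;\boldsymbol u,\boldsymbol v)=-(\boldsymbol w\otimes\boldsymbol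 u,\nabla\boldsymbol v)$. For a real-valued stabilization parameter $\eta$ on the mesh skeleton put $$\mathscr A_{\rm stb}(\boldsymbol u,\boldsymbol v)=A(\boldsymbol u,\boldsymbol v)-(2\nu\boldsymbol n\cdot\nabla^s\boldsymbol u,\boldsymbol v)_{\partial\Omega}-(2\nu\boldsymbol n\cdot\nabla^s\boldsymbol v,\boldsymbol u)_{\partial\Omega}+\Big(2\nu\tfrac{C_{\rm Nit}}h\boldsymbol u,\boldsymbol v\Big)_{\partial\Omega}+J_h(\boldsymbol u,\boldsymbol v)+C(\boldsymbol u;\boldsymbol u,\boldsymbol v),$$ $$J_h(\boldsymbol u,\boldsymbol v)=\sum_{e}\big(\eta[\![\partial_{\boldsymbol n}^{\alpha'+1}\boldsymbol u]\!],[\![\partial_{\boldsymbol n}^{\alpha'+1}\boldsymbol v]\!]\big)_e,\qquad L_h(\boldsymbol v)=(\boldsymbol f,\boldsymbol v)-(2\nu\boldsymbol n\cdot\nabla^s\boldsymbol v,\boldsymbol u_D)_{\partial\Omega}+\Big(2\nu\tfrac{C_{\rm Nit}}h\boldsymbol u_D,\boldsymbol v\Big)_{\partial\Omega},$$ the sum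 running over the interior facets $e$ of the physical mesh, with $\boldsymbol n$ the unit normal (outward on $\partial\Omega$). Boundary values are limits from the interior, in the mean over thin collars in the flattening coordinates given by $\mathcal F$: traces are mean-square limits, the pairings of $\boldsymbol n\cdot\nabla^s(\cdot)$ on $\partial\Omega$ are limits of the collar means of the integral over $\partial\Omega$, and a jump is the mean-square limit of the difference of the values on the two sides of the facet. If $t\in(0,T]$ and $\boldsymbol u(t)\in\mathbf H^{\alpha'+3/2}(\Omega)$, then for every such $\eta$ and every $\boldsymbol v_h\in\mathring{\mathcal V}_h$ all terms of $\mathscr A_{\rm stb}(\boldsymbol u(t),\boldsymbol v_h)$ and $L_h(\boldsymbol v_h)$ are well defined, and $$(\partial_t\boldsymbol u(t),\boldsymbol v_h)+\mathscr A_{\rm stb}(\boldsymbol u(t),\boldsymbol v_h)=L_h(\boldsymbol v_h).$$ -/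

import Mathlib

open MeasureTheory Filter Topology

noncomputable section

namespace SkeletonStab

/-- Physical space `ℝ^d`, `d = n + 1`, with the Euclidean norm. -/
abbrev Phys (n : ℕ) : Type := EuclideanSpace ℝ (Fin (n + 1))

/-- Parametric space `ℝ^d`, `d = n + 1`. -/
abbrev Param (n : ℕ) : Type := Fin (n + 1) → ℝ

/-! ### Weak derivatives and Sobolev spaces -/

section Sobolev

variable {n : ℕ}

/-- `g` is the weak derivative `∂_{I 0} ⋯ ∂_{I (k-1)} u` of the vector field `u` on `Ω`. -/
def IsWeakDeriv (Ω : Set (Phys n)) {k : ℕ} (I : Fin k → Fin (n + 1)) (u g : Phys n → Phys n) :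
    Prop :=
  LocallyIntegrableOn u Ω ∧ LocallyIntegrableOn g Ω ∧
    ∀ φ : Phys n → ℝ, ContDiff ℝ ((⊤ : ℕ∞) : WithTop ℕ∞) φ → HasCompactSupport φ →
      tsupport φ ⊆ Ω →
      ∫ x in Ω, (iteratedFDeriv ℝ k φ x fun l => EuclideanSpace.single (I l) (1 : ℝ)) • u x
        = (-1 : ℝ) ^ k • ∫ x in Ω, φ x • g x

/-- `G i` is the weak derivative `∂_i u` on `Ω`, so that `(∇ u)_{ij} = ∂_i u_j = G i x j`. -/
def IsWeakGrad (Ω : Set (Phys n)) (u : Phys n → Phys n) (G : Fin (n + 1) → Phys n → Phys n) :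
    Prop :=
  ∀ i, IsWeakDeriv Ω (fun _ : Fin 1 => i) u (G i)

/-- Square integrability on `Ω`. -/
def MemL2 {V : Type*} [NormedAddCommGroup V] (Ω : Set (Phys n)) (f : Phys n → V) : Prop :=
  MemLp f 2 (volume.restrict Ω)

/-- The vector-valued Sobolev space `H¹(Ω)`. -/
def MemH1 (Ω : Set (Phys n)) (u : Phys n → Phys n) : Prop :=
  MemL2 Ω u ∧ ∃ G, IsWeakGrad Ω u G ∧ ∀ i, MemL2 Ω (G i)

/-- The square of the Gagliardo seminorm of order `θ` on `Ω`. -/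
def gagliardoSq (Ω : Set (Phys n)) (θ : ℝ) (g : Phys n → Phys n) : ENNReal :=
  ∫⁻ x in Ω, ∫⁻ y in Ω,
    ‖g x - g y‖ₑ ^ 2 / ENNReal.ofReal (‖x - y‖ ^ (((n + 1 : ℕ) : ℝ) + 2 * θ))

/-- The vector-valued Sobolev–Slobodeckij space `H^{m+θ}(Ω)`, `0 < θ < 1`. -/
def MemHFrac (Ω : Set (Phys n)) (m : ℕ) (θ : ℝ) (u : Phys n → Phys n) : Prop :=
  ∀ k ≤ m, ∀ I : Fin k → Fin (n + 1),
    ∃ g, IsWeakDeriv Ω I u g ∧ MemL2 Ω g ∧ (k = m → gagliardoSq Ω θ g < ⊤)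

/-- The space `L²₀(Ω)`. -/
def MemL20 (Ω : Set (Phys n)) (q : Phys n → ℝ) : Prop :=
  MemL2 Ω q ∧ ∫ x in Ω, q x = 0

end Sobolev

/-! ### Parametric mesh and geometry map -/

/-- Vectors of unique knot values `ζ i 0 < ⋯ < ζ i (N i)` in each parametric direction.  The
values `ζ i j` with `j > N i` play no role. -/
structure ParamMesh (n : ℕ) where
  N : Fin (n + 1) → ℕ
  N_pos : ∀ i, 0 < N i
  ζ : Fin (n + 1) → ℕ → ℝ
  ζ_lt : ∀ i j, j < N i → ζ i j < ζ i (j + 1)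

namespace ParamMesh

variable {n : ℕ} (M : ParamMesh n)

/-- The open parametric domain. -/
def openBox : Set (Param n) :=
  Set.univ.pi fun i => Set.Ioo (M.ζ i 0) (M.ζ i (M.N i))

/-- The closed parametric domain. -/
def closedBox : Set (Param n) :=
  Set.univ.pi fun i => Set.Icc (M.ζ i 0) (M.ζ i (M.N i))

/-- `c` is the multi-index of a parametric element. -/
def IsCell (c : Fin (n + 1) → ℕ) : Prop := ∀ i, c i < M.N i

/-- The open parametric element with multi-index `c`. -/
def cell (c : Fin (n + 1) → ℕ) : Set (Param n) :=
  Set.univ.pi fun i => Set.Ioo (M.ζ i (c i)) (M.ζ i (c i + 1))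

/-- The closed parametric element with multi-index `c`. -/
def closedCell (c : Fin (n + 1) → ℕ) : Set (Param n) :=
  Set.univ.pi fun i => Set.Icc (M.ζ i (c i)) (M.ζ i (c i + 1))

/-- The Jacobian matrix `(DF)_{ij} = ∂F_i/∂x̂_j` of the geometry map on the closed parametric
domain. -/
def jac (F : Param n → Phys n) (x : Param n) : Matrix (Fin (n + 1)) (Fin (n + 1)) ℝ :=
  Matrix.of fun i j => fderivWithin ℝ F M.closedBox x (Pi.single j 1) i

/-- Geometry maps: injective and `C¹` with invertible Jacobian on the closed parametric domain,
and `C^r` on every closed parametric element. -/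
structure IsGeometryMap (F : Param n → Phys n) (r : ℕ) : Prop where
  contDiffOn : ContDiffOn ℝ 1 F M.closedBox
  contDiffOn_cell : ∀ c, M.IsCell c → ContDiffOn ℝ (r : WithTop ℕ∞) F (M.closedCell c)
  injOn : Set.InjOn F M.closedBox
  det_ne_zero : ∀ x ∈ M.closedBox, (M.jac F x).det ≠ 0

/-- The physical domain `Ω`. -/
def domain (F : Param n → Phys n) : Set (Phys n) := F '' M.openBox

/-- The vector `(DF)^{-T} e_i`, normal to the image of the hyperplane `x̂_i = const`. -/
def conormal (F : Param n → Phys n) (i : Fin (n + 1)) (x : Param n) : Phys n :=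
  WithLp.toLp 2 fun j => (M.jac F x)⁻¹ i j

/-- The unit normal to the image of `x̂_i = const`, pointing in the direction of increasing
`x̂_i`. -/
def unitNormal (F : Param n → Phys n) (i : Fin (n + 1)) (x : Param n) : Phys n :=
  ‖M.conormal F i x‖⁻¹ • M.conormal F i x

/-- The surface element of the image of `x̂_i = const`:
`dS = |det DF| |(DF)^{-T} e_i| dx̂'`. -/
def areaFactor (F : Param n → Phys n) (i : Fin (n + 1)) (x : Param n) : ℝ :=
  |(M.jac F x).det| * ‖M.conormal F i x‖

/-- The parametric point with `i`-th coordinate `t` and remaining coordinates `y`. -/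
def ins (i : Fin (n + 1)) (t : ℝ) (y : Fin n → ℝ) : Param n :=
  i.insertNth (α := fun _ => ℝ) t y

/-! ### Boundary integrals and traces

The boundary consists of the images of the `2d` faces of the parametric box; they are indexed by a
direction `i` and a side `s` (`false`: lower, `true`: upper).  Functions on the boundary are
functions of the physical point. -/

/-- Parameter domain of the faces normal to direction `i`. -/
def faceDom (i : Fin (n + 1)) : Set (Fin n → ℝ) :=
  Set.univ.pi fun k => Set.Ioo (M.ζ (i.succAbove k) 0) (M.ζ (i.succAbove k) (M.N (i.succAbove k)))

/-- Orientation sign of a face: `+1` on the upper side, `-1` on the lower side. -/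
def sgn (s : Bool) : ℝ := if s then 1 else -1

/-- The value of `x̂_i` on the face `(i, s)`. -/
def bdryCoord (i : Fin (n + 1)) (s : Bool) : ℝ := if s then M.ζ i (M.N i) else M.ζ i 0

/-- The parametric point at distance `t` inward from the point `y` of the face `(i, s)`. -/
def inward (i : Fin (n + 1)) (s : Bool) (t : ℝ) (y : Fin n → ℝ) : Param n :=
  ins i (M.bdryCoord i s - sgn s * t) y

/-- The outward unit normal at the point `y` of the face `(i, s)`. -/
def outNormal (F : Param n → Phys n) (i : Fin (n + 1)) (s : Bool) (y : Fin n → ℝ) : Phys n :=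
  sgn s • M.unitNormal F i (M.inward i s 0 y)

/-- `g ∈ L²(∂Ω)`. -/
def MemL2Bdry (F : Param n → Phys n) (g : Phys n → Phys n) : Prop :=
  ∀ i s, MemLp (fun y => g (F (M.inward i s 0 y))) 2 (volume.restrict (M.faceDom i))

/-- The `L²(∂Ω)` inner product of vector fields on the boundary. -/
def bdryInner (F : Param n → Phys n) (g g' : Phys n → Phys n) : ℝ :=
  ∑ i, ∑ s : Bool, ∫ y in M.faceDom i,
    inner ℝ (g (F (M.inward i s 0 y))) (g' (F (M.inward i s 0 y)))
      * M.areaFactor F i (M.inward i s 0 y)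

/-- `g ∈ L²(∂Ω)` is the trace of `u`: in flattened coordinates, `u` converges to `g` in mean
square over collars of the boundary of width `ε → 0`. -/
def IsTrace (F : Param n → Phys n) (u g : Phys n → Phys n) : Prop :=
  M.MemL2Bdry F g ∧ ∀ i s,
    Tendsto (fun ε : ℝ => ENNReal.ofReal ε⁻¹ *
        ∫⁻ t in Set.Ioo 0 ε, ∫⁻ y in M.faceDom i,
          ‖u (F (M.inward i s t y)) - g (F (M.inward i s 0 y))‖ₑ ^ 2
            * ENNReal.ofReal (M.areaFactor F i (M.inward i s 0 y)))
      (𝓝[>] 0) (𝓝 0)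

/-- The vector `n · σ`, with components `∑_i n_i σ_{ij}`. -/
def contract (ν : Phys n) (σ : Matrix (Fin (n + 1)) (Fin (n + 1)) ℝ) : Phys n :=
  WithLp.toLp 2 fun j => ∑ i, ν i * σ i j

/-- `b = (n · σ, g)_{∂Ω}` for a tensor field `σ` on `Ω` and a vector field `g` on `∂Ω`, the boundary
values of `σ` being approached from the interior: `b` is the limit of the mean values of
`∫ (n · σ) · g dS` over collars of width `ε → 0`.  If `σ` has a trace `τ` in `L²(∂Ω)`, this is
`∫_{∂Ω} (n · τ) · g dS`. -/
def HasBdryPairing (F : Param n → Phys n)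
    (σ : Phys n → Matrix (Fin (n + 1)) (Fin (n + 1)) ℝ) (g : Phys n → Phys n) (b : ℝ) : Prop :=
  Tendsto (fun ε : ℝ => ε⁻¹ * ∑ i, ∑ s : Bool,
      ∫ t in Set.Ioo 0 ε, ∫ y in M.faceDom i,
        inner ℝ (contract (M.outNormal F i s y) (σ (F (M.inward i s t y))))
          (g (F (M.inward i s 0 y))) * M.areaFactor F i (M.inward i s 0 y))
    (𝓝[>] 0) (𝓝 b)

/-- The space `H¹₀(Ω)`: fields in `H¹(Ω)` with zero trace. -/
def MemH10 (F : Param n → Phys n) (u : Phys n → Phys n) : Prop :=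
  MemH1 (M.domain F) u ∧ M.IsTrace F u 0

/-- The space `H¹_n(Ω)`: fields in `H¹(Ω)` whose trace has zero normal component. -/
def MemH1n (F : Param n → Phys n) (u : Phys n → Phys n) : Prop :=
  MemH1 (M.domain F) u ∧ ∃ g, M.IsTrace F u g ∧ ∀ i s, ∀ᵐ y ∂(volume.restrict (M.faceDom i)),
    inner ℝ (g (F (M.inward i s 0 y))) (M.outNormal F i s y) = 0

/-! ### Interior facets and jumps

The interior facets are the images of the sets `x̂_i = ζ i j`, `0 < j < N i`, with the remaining
coordinates in an element with multi-index `c` of the mesh in the other directions.  On each of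
them `n` points in the direction of increasing `x̂_i`, so the positive element is the lower one. -/

/-- Parameter domain of an interior facet. -/
def facetDom (i : Fin (n + 1)) (c : Fin n → ℕ) : Set (Fin n → ℝ) :=
  Set.univ.pi fun k => Set.Ioo (M.ζ (i.succAbove k) (c k)) (M.ζ (i.succAbove k) (c k + 1))

/-- Multi-indices of the facets inside a hyperplane `x̂_i = const`. -/
def facetIdx (i : Fin (n + 1)) : Finset (Fin n → ℕ) :=
  Fintype.piFinset fun k => Finset.range (M.N (i.succAbove k))

/-- `D I` is the elementwise weak derivative `∂_{I 0} ⋯ ∂_{I (m-1)} φ`. -/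
def IsBrokenDeriv (F : Param n → Phys n) {m : ℕ} (φ : Phys n → Phys n)
    (D : (Fin m → Fin (n + 1)) → Phys n → Phys n) : Prop :=
  ∀ c, M.IsCell c → ∀ I, IsWeakDeriv (F '' M.cell c) I φ (D I)

/-- The `m`-th derivative in the direction `ν`, `(ν · ∇)^m φ`, from the family of partial
derivatives of order `m` of `φ`. -/
def dirDeriv {m : ℕ} (D : (Fin m → Fin (n + 1)) → Phys n → Phys n) (ν : Phys n) (x : Phys n) :
    Phys n :=
  ∑ I, (∏ l, ν (I l)) • D I x

/-- `w` is the jump `⟦∂_n^m φ⟧` on all interior facets: `w ∈ L²(e)` is the limit, in mean square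
over collars of width `ε → 0`, of the difference of the values of `∂_n^m φ` on the positive and
on the negative side of the facet `e`, where `n` is the normal at the point of the facet.  If the
two one-sided limits exist, `w` is their difference. -/
def IsNormalJump (F : Param n → Phys n) (m : ℕ) (φ w : Phys n → Phys n) : Prop :=
  ∃ D : (Fin m → Fin (n + 1)) → Phys n → Phys n, M.IsBrokenDeriv F φ D ∧
    ∀ i, ∀ j ∈ Finset.Ioo 0 (M.N i), ∀ c ∈ M.facetIdx i,
      MemLp (fun y => w (F (ins i (M.ζ i j) y))) 2 (volume.restrict (M.facetDom i c)) ∧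
      Tendsto (fun ε : ℝ => ENNReal.ofReal ε⁻¹ *
          ∫⁻ t in Set.Ioo 0 ε, ∫⁻ y in M.facetDom i c,
            ‖dirDeriv D (M.unitNormal F i (ins i (M.ζ i j) y)) (F (ins i (M.ζ i j - t) y))
              - dirDeriv D (M.unitNormal F i (ins i (M.ζ i j) y)) (F (ins i (M.ζ i j + t) y))
              - w (F (ins i (M.ζ i j) y))‖ₑ ^ 2
              * ENNReal.ofReal (M.areaFactor F i (ins i (M.ζ i j) y)))
        (𝓝[>] 0) (𝓝 0)

/-- The sum over interior facets `∑_e (η w, w')_e`. -/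
def skeletonInner (F : Param n → Phys n) (η : Phys n → ℝ) (w w' : Phys n → Phys n) : ℝ :=
  ∑ i, ∑ j ∈ Finset.Ioo 0 (M.N i), ∑ c ∈ M.facetIdx i, ∫ y in M.facetDom i c,
    η (F (ins i (M.ζ i j) y))
      * inner ℝ (w (F (ins i (M.ζ i j) y))) (w' (F (ins i (M.ζ i j) y)))
      * M.areaFactor F i (ins i (M.ζ i j) y)

end ParamMesh

/-! ### Divergence-conforming B-splines -/

/-- Open knot vector of degree `p` (zero-based): the end knots `ζ 0`, `ζ N` are repeated `p + 1`
times and each interior knot `ζ 1, …, ζ (N-1)` is repeated `β` times. -/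
def openKnot (p β N : ℕ) (ζ : ℕ → ℝ) (j : ℕ) : ℝ :=
  if j ≤ p then ζ 0 else ζ (min N ((j - (p + 1)) / β + 1))

/-- Cox–de Boor recursion for the B-spline of degree `p` with index `j` over the knots `ξ`; a
quotient with zero denominator is zero, which is the usual convention. -/
def bspline (ξ : ℕ → ℝ) : ℕ → ℕ → ℝ → ℝ
  | 0, j, x => if ξ j ≤ x ∧ x < ξ (j + 1) then 1 else 0
  | p + 1, j, x =>
      (x - ξ j) / (ξ (j + p + 1) - ξ j) * bspline ξ p j x
        + (ξ (j + p + 2) - x) / (ξ (j + p + 2) - ξ (j + 1)) * bspline ξ p (j + 1) x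

namespace ParamMesh

variable {n : ℕ} (M : ParamMesh n)

/-- The tensor-product B-spline space with degree `deg i` in direction `i` and all interior knots
of multiplicity `β`, that is, of regularity `deg i - β`. -/
def splineSpace (deg : Fin (n + 1) → ℕ) (β : ℕ) : Submodule ℝ (Param n → ℝ) :=
  Submodule.span ℝ {b | ∃ j : Fin (n + 1) → ℕ,
    (∀ i, j i < deg i + 1 + (M.N i - 1) * β) ∧
    b = fun x => ∏ i, bspline (openKnot (deg i) β (M.N i) (M.ζ i)) (deg i) (j i) (x i)}

/-- The pullback `det(DF) (DF)⁻¹ (v ∘ F)`. -/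
def pullback (F : Param n → Phys n) (v : Phys n → Phys n) (x : Param n) : Param n :=
  (M.jac F x).det • (M.jac F x)⁻¹.mulVec (WithLp.ofLp (v (F x)))

/-- The discrete velocity space `V_h` of degree `k'` and regularity `α'`: fields in `H¹_n(Ω)` such
that the `l`-th component of the pullback is a B-spline of degree `k' + 1` and regularity `α' + 1`
in direction `l`, and of degree `k'` and regularity `α'` in the other directions. -/
def MemVh (F : Param n → Phys n) (k' α' : ℕ) (v : Phys n → Phys n) : Prop :=
  M.MemH1n F v ∧ ∀ l, ∃ b ∈ M.splineSpace (fun i => if i = l then k' + 1 else k') (k' - α'),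
    ∀ x ∈ M.openBox, M.pullback F v x l = b x

/-- The solenoidal subspace of `V_h`. -/
def MemVhSol (F : Param n → Phys n) (k' α' : ℕ) (v : Phys n → Phys n) : Prop :=
  M.MemVh F k' α' v ∧ ∃ G, IsWeakGrad (M.domain F) v G ∧
    ∀ᵐ x ∂(volume.restrict (M.domain F)), ∑ i, G i x i = 0

end ParamMesh

/-! ### Variational forms -/

section Forms

variable {n : ℕ}

/-- The symmetric gradient `∇ˢ u` from the family `G i = ∂_i u`. -/
def symGrad (G : Fin (n + 1) → Phys n → Phys n) (x : Phys n) :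
    Matrix (Fin (n + 1)) (Fin (n + 1)) ℝ :=
  Matrix.of fun i j => (G i x j + G j x i) / 2

/-- The `L²(Ω)` inner product of vector fields. -/
def ip (Ω : Set (Phys n)) (u v : Phys n → Phys n) : ℝ := ∫ x in Ω, inner ℝ (u x) (v x)

/-- `A(u, v) = (2ν ∇ˢ u, ∇ˢ v)`, in terms of the gradients of `u` and `v`. -/
def formA (Ω : Set (Phys n)) (ν : ℝ) (Gu Gv : Fin (n + 1) → Phys n → Phys n) : ℝ :=
  ∫ x in Ω, 2 * ν * ∑ i, ∑ j, symGrad Gu x i j * symGrad Gv x i j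

/-- `B(u, q) = (∇ · u, q)`, in terms of the gradient of `u`. -/
def formB (Ω : Set (Phys n)) (Gu : Fin (n + 1) → Phys n → Phys n) (q : Phys n → ℝ) : ℝ :=
  ∫ x in Ω, (∑ i, Gu i x i) * q x

/-- `C(w; u, v) = -(w ⊗ u, ∇ v)`, in terms of the gradient of `v`. -/
def formC (Ω : Set (Phys n)) (w u : Phys n → Phys n) (Gv : Fin (n + 1) → Phys n → Phys n) : ℝ :=
  -∫ x in Ω, ∑ i, ∑ j, w x i * u x j * Gv i x j

/-- `u' ∈ L²(Ω)` is the derivative of `u` at time `t`, in `L²(Ω)`, on the time interval `(0, T]`. -/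
def HasTimeDeriv (Ω : Set (Phys n)) (T : ℝ) (u : ℝ → Phys n → Phys n) (u' : Phys n → Phys n)
    (t : ℝ) : Prop :=
  MemL2 Ω u' ∧
    Tendsto (fun s : ℝ =>
        eLpNorm (fun x => (s - t)⁻¹ • (u s x - u t x) - u' x) 2 (volume.restrict Ω))
      (𝓝[Set.Ioc 0 T \ {t}] t) (𝓝 0)

end Forms

namespace ParamMesh

variable {n : ℕ} (M : ParamMesh n)

/-- `(u, p)` is a weak solution on `(0, T]`, with time derivative `∂_t u = ut`, of the
incompressible Navier–Stokes equations with viscosity `ν`, source `f` and homogeneous Dirichlet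
boundary conditions. -/
structure IsWeakSolution (F : Param n → Phys n) (ν T : ℝ) (f u ut : ℝ → Phys n → Phys n)
    (p : ℝ → Phys n → ℝ) : Prop where
  velocity : ∀ t ∈ Set.Ioc 0 T, M.MemH10 F (u t)
  pressure : ∀ t ∈ Set.Ioc 0 T, MemL20 (M.domain F) (p t)
  time_deriv : ∀ t ∈ Set.Ioc 0 T, HasTimeDeriv (M.domain F) T u (ut t) t
  equation : ∀ t ∈ Set.Ioc 0 T, ∀ Gu, IsWeakGrad (M.domain F) (u t) Gu →
    ∀ v, M.MemH10 F v → ∀ Gv, IsWeakGrad (M.domain F) v Gv → ∀ q, MemL20 (M.domain F) q →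
      ip (M.domain F) (ut t) v + formA (M.domain F) ν Gu Gv
          + formC (M.domain F) (u t) (u t) Gv
          + formB (M.domain F) Gu q - formB (M.domain F) Gv (p t)
        = ip (M.domain F) (f t) v

/-- `a = A_stb(u, v) = A_h(u, v) + C(u; u, v)` with
`A_h(u, v) = A(u, v) - (2ν n·∇ˢu, v)_{∂Ω} - (2ν n·∇ˢv, u)_{∂Ω} + (2ν C_Nit/h u, v)_{∂Ω} + J_h(u, v)`
and `J_h(u, v) = ∑_e (η ⟦∂_n^{α'+1} u⟧, ⟦∂_n^{α'+1} v⟧)_e`: all derivatives, traces and jumps in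
these terms exist, and `a` is the resulting value. -/
def HasAstb (F : Param n → Phys n) (ν CNit h : ℝ) (η : Phys n → ℝ) (α' : ℕ)
    (u v : Phys n → Phys n) (a : ℝ) : Prop :=
  ∃ (Gu Gv : Fin (n + 1) → Phys n → Phys n) (gu gv wu wv : Phys n → Phys n) (b₁ b₂ : ℝ),
    (IsWeakGrad (M.domain F) u Gu ∧ ∀ i, MemL2 (M.domain F) (Gu i)) ∧
    (IsWeakGrad (M.domain F) v Gv ∧ ∀ i, MemL2 (M.domain F) (Gv i)) ∧
    M.IsTrace F u gu ∧ M.IsTrace F v gv ∧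
    M.HasBdryPairing F (fun x => (2 * ν) • symGrad Gu x) gv b₁ ∧
    M.HasBdryPairing F (fun x => (2 * ν) • symGrad Gv x) gu b₂ ∧
    M.IsNormalJump F (α' + 1) u wu ∧ M.IsNormalJump F (α' + 1) v wv ∧
    a = (formA (M.domain F) ν Gu Gv - b₁ - b₂ + 2 * ν * (CNit / h) * M.bdryInner F gu gv
          + M.skeletonInner F η wu wv)
        + formC (M.domain F) u u Gv

/-- `l = L_h(v) = (f, v) - (2ν n·∇ˢv, u_D)_{∂Ω} + (2ν C_Nit/h u_D, v)_{∂Ω}`: the derivatives and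
traces in these terms exist, and `l` is the resulting value. -/
def HasLh (F : Param n → Phys n) (ν CNit h : ℝ) (f uD v : Phys n → Phys n) (l : ℝ) : Prop :=
  ∃ (Gv : Fin (n + 1) → Phys n → Phys n) (gv : Phys n → Phys n) (b : ℝ),
    (IsWeakGrad (M.domain F) v Gv ∧ ∀ i, MemL2 (M.domain F) (Gv i)) ∧
    M.IsTrace F v gv ∧
    M.HasBdryPairing F (fun x => (2 * ν) • symGrad Gv x) uD b ∧
    l = ip (M.domain F) f v - b + 2 * ν * (CNit / h) * M.bdryInner F uD gv

end ParamMesh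

end SkeletonStab

end

noncomputable section

namespace SkeletonStab

/-! ### Weak derivatives: restriction, uniqueness, peeling off a classical derivative -/

section WeakDerivatives

variable {n : ℕ}

/-! The discrete field `v` is not admissible in the weak equation: only its normal trace vanishes,
while test functions must have zero trace. The remedy is to test with `χ_ε v`, where `χ_ε` is the
push-forward under `F` of a tensor product of piecewise linear ramps of width `ε`, and to let `ε →
0`. The cutoff is only locally Lipschitz, so weak derivatives are first extended to Lipschitz test
functions by mollification; this gives the product rule for `χ_ε v`
(`IsWeakDeriv.smul_of_locallyLipschitz`), and the linear decay of `χ_ε` at the boundary puts `χ_ε v`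
in `H¹₀`.

Terms carrying `χ_ε` itself converge by dominated convergence. Terms carrying `∇χ_ε` become fluxes:
after the change of variables, `|det DF| ∇χ_ε` is a combination of the area vectors `|det DF|
(DF)^{-T} e_l` with weights `±1/ε` on the boundary layers, so `∫ ∇χ_ε · H` is minus the mean outward
flux of `H` through the collars, with an additional tangential cutoff
(`IsGeometryMap.integral_cutoffGrad`). Three fields `H` occur. The convective field `(u·v)u` is
bounded by a multiple of `|u|²`, whose collar means vanish because `u` has zero trace. For the
pressure field `p v`, the flux of `v` is `O(t)` at depth `t`, because `v` and the area vectors are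
Lipschitz on closed cells and the normal trace of `v` is zero; this cancels `1/ε` and leaves an
integral of `|p|` over a shrinking collar. For the stress field `2ν ∇ˢu v`, the flux differs from
the collar mean defining the boundary pairing only by vanishing errors. The term `χ_ε p ∇·v` is
absent since `v` is solenoidal. Passing to the limit therefore proves both that the pairing `(2ν
n·∇ˢu, v)_{∂Ω}` exists and that it equals the residual (`IsGeometryMap.hasBdryPairing_of_equation`);
no `L²` trace of `∇ˢu` is needed.

The stabilization vanishes because derivatives of `u` of order `α'+1` have finite Gagliardo seminorm
of order `1/2`. Comparing the two values across a facet with the values at all nearby points bounds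
their mean square difference by the Gagliardo integral over a strip around the diagonal, which tends
to zero (`IsGeometryMap.tendsto_jump_of_gagliardo`). The jumps of `v` exist because on each cell
B-splines are polynomial and the Piola transform is smooth up to the cell boundary. The remaining
Nitsche terms vanish with the trace of `u` and the zero boundary data.

The forms allow any choice of weak derivatives, traces and jumps; their almost everywhere uniqueness
makes the identity hold for every admissible choice. -/

theorem iteratedFDeriv_apply_eq_zero_of_notMem_tsupport {φ : Phys n → ℝ} {k : ℕ} {x : Phys n}
    (hx : x ∉ tsupport φ) (m : Fin k → Phys n) : iteratedFDeriv ℝ k φ x m = 0 := by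
  have : x ∉ Function.support (iteratedFDeriv ℝ k φ) := fun h =>
    hx (support_iteratedFDeriv_subset k h)
  rw [Function.notMem_support.1 this]; rfl

theorem contDiff_iteratedFDeriv_apply {φ : Phys n → ℝ}
    (hφ : ContDiff ℝ ((⊤ : ℕ∞) : WithTop ℕ∞) φ) (k : ℕ) (m : Fin k → Phys n) :
    ContDiff ℝ ((⊤ : ℕ∞) : WithTop ℕ∞) (fun x => iteratedFDeriv ℝ k φ x m) := by
  have h : ContDiff ℝ ((⊤ : ℕ∞) : WithTop ℕ∞) (iteratedFDeriv ℝ k φ) :=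
    hφ.iteratedFDeriv_right (by exact_mod_cast le_top)
  exact (ContinuousMultilinearMap.apply ℝ (fun _ : Fin k => Phys n) ℝ m).contDiff.comp h

theorem tsupport_iteratedFDeriv_apply_subset {φ : Phys n → ℝ} (k : ℕ) (m : Fin k → Phys n) :
    tsupport (fun x => iteratedFDeriv ℝ k φ x m) ⊆ tsupport φ := by
  refine closure_minimal (fun x hx => ?_) (isClosed_tsupport φ)
  by_contra h
  exact hx (iteratedFDeriv_apply_eq_zero_of_notMem_tsupport h m)

/-- A test function supported in `U` is also one on `Ω`, and both sides of the defining identity are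
integrals over the whole space. -/
theorem IsWeakDeriv.mono {Ω U : Set (Phys n)} (hU : MeasurableSet U) (hΩ : MeasurableSet Ω)
    (hUΩ : U ⊆ Ω) {k : ℕ} {I : Fin k → Fin (n + 1)} {u g : Phys n → Phys n}
    (h : IsWeakDeriv Ω I u g) : IsWeakDeriv U I u g := by
  refine ⟨h.1.mono_set hUΩ, h.2.1.mono_set hUΩ, fun φ hφ hc hs => ?_⟩
  have key := h.2.2 φ hφ hc (hs.trans hUΩ)
  have e1 : ∀ S : Set (Phys n), MeasurableSet S → tsupport φ ⊆ S →
      ∫ x in S, (iteratedFDeriv ℝ k φ x fun l => EuclideanSpace.single (I l) (1 : ℝ)) • u x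
        = ∫ x, (iteratedFDeriv ℝ k φ x fun l => EuclideanSpace.single (I l) (1 : ℝ)) • u x :=
    fun S _ hS => setIntegral_eq_integral_of_forall_compl_eq_zero fun x hx => by
      rw [iteratedFDeriv_apply_eq_zero_of_notMem_tsupport (fun hx' => hx (hS hx')), zero_smul]
  have e2 : ∀ S : Set (Phys n), MeasurableSet S → tsupport φ ⊆ S →
      ∫ x in S, φ x • g x = ∫ x, φ x • g x :=
    fun S _ hS => setIntegral_eq_integral_of_forall_compl_eq_zero fun x hx => by
      rw [image_eq_zero_of_notMem_tsupport (fun hx' => hx (hS hx')), zero_smul]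
  rw [e1 U hU hs, e2 U hU hs, ← e1 Ω hΩ (hs.trans hUΩ), ← e2 Ω hΩ (hs.trans hUΩ), key]

theorem integrable_smul_of_locallyIntegrableOn {Ω : Set (Phys n)} {E : Type*}
    [NormedAddCommGroup E] [NormedSpace ℝ E] {g : Phys n → E}
    (hg : LocallyIntegrableOn g Ω) {φ : Phys n → ℝ} (hφ : Continuous φ)
    (hc : HasCompactSupport φ) (hs : tsupport φ ⊆ Ω) : Integrable fun x => φ x • g x := by
  have h1 : IntegrableOn g (tsupport φ) :=
    (hg.mono_set hs).integrableOn_isCompact hc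
  have h2 : IntegrableOn (fun x => φ x • g x) (tsupport φ) :=
    IntegrableOn.continuousOn_smul h1 hφ.continuousOn hc
  refine (integrableOn_iff_integrable_of_support_subset fun x hx => ?_).1 h2
  exact subset_tsupport _ fun h => hx (by simp [h])

theorem setIntegral_smul_of_tsupport_subset {Ω : Set (Phys n)} {E : Type*}
    [NormedAddCommGroup E] [NormedSpace ℝ E] (g : Phys n → E) {φ : Phys n → ℝ}
    (hs : tsupport φ ⊆ Ω) : ∫ x in Ω, φ x • g x = ∫ x, φ x • g x :=
  setIntegral_eq_integral_of_forall_compl_eq_zero fun x hx => by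
    rw [image_eq_zero_of_notMem_tsupport (fun hx' => hx (hs hx')), zero_smul]

/-- Fundamental lemma of the calculus of variations. It makes bounds, the divergence constraint and
vanishing jumps independent of the chosen representative of the derivative. -/
theorem IsWeakDeriv.ae_eq {Ω : Set (Phys n)} (hΩ : IsOpen Ω) {k : ℕ} {I : Fin k → Fin (n + 1)}
    {u g g' : Phys n → Phys n} (h : IsWeakDeriv Ω I u g) (h' : IsWeakDeriv Ω I u g') :
    ∀ᵐ x ∂(volume.restrict Ω), g x = g' x := by
  have := hΩ.ae_eq_zero_of_integral_contDiff_smul_eq_zero (μ := volume)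
    (f := fun x => g x - g' x) (h.2.1.sub h'.2.1) fun φ hφ hc hs => by
      have e := (h.2.2 φ hφ hc hs).symm.trans (h'.2.2 φ hφ hc hs)
      have e' := smul_right_injective (Phys n) (pow_ne_zero k (neg_ne_zero.2 one_ne_zero)) e
      simp only [setIntegral_smul_of_tsupport_subset _ hs] at e'
      simp_rw [smul_sub]
      rw [integral_sub (integrable_smul_of_locallyIntegrableOn h.2.1 hφ.continuous hc hs)
        (integrable_smul_of_locallyIntegrableOn h'.2.1 hφ.continuous hc hs), e', sub_self]
  rw [ae_restrict_iff' hΩ.measurableSet]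
  filter_upwards [this] with x hx hxΩ using sub_eq_zero.1 (hx hxΩ)

theorem isWeakDeriv_zero {Ω : Set (Phys n)} {I : Fin 0 → Fin (n + 1)} {u : Phys n → Phys n}
    (h : LocallyIntegrableOn u Ω) : IsWeakDeriv Ω I u u :=
  ⟨h, h, fun φ _ _ _ => by simp⟩

/-- Integration by parts of a continuously differentiable field against a test function. -/
theorem integral_lineDeriv_smul_of_hasLineDerivAt {U : Set (Phys n)} (hU : IsOpen U)
    {w w' : Phys n → Phys n} {e : Phys n} (hw : ContinuousOn w U) (hw' : ContinuousOn w' U)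
    (h : ∀ x ∈ U, HasLineDerivAt ℝ w (w' x) x e) {ψ : Phys n → ℝ} (hψ : ContDiff ℝ 1 ψ)
    (hc : HasCompactSupport ψ) (hs : tsupport ψ ⊆ U) :
    ∫ x in U, (fderiv ℝ ψ x e) • w x = -∫ x in U, ψ x • w' x := by
  have hs' : tsupport (fun x => fderiv ℝ ψ x e) ⊆ tsupport ψ :=
    closure_minimal (fun x hx => by
      by_contra hxs
      exact hx (by simp [fderiv_of_notMem_tsupport ℝ hxs])) (isClosed_tsupport ψ)
  have hcont : Continuous (fun x => fderiv ℝ ψ x e) :=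
    (hψ.continuous_fderiv one_ne_zero).clm_apply continuous_const
  have hc' : HasCompactSupport (fun x => fderiv ℝ ψ x e) := hc.of_isClosed_subset (isClosed_tsupport _) hs'
  rw [setIntegral_smul_of_tsupport_subset _ (hs'.trans hs),
    setIntegral_smul_of_tsupport_subset _ hs]
  have hwl := hw.locallyIntegrableOn (μ := volume) hU.measurableSet
  have hwl' := hw'.locallyIntegrableOn (μ := volume) hU.measurableSet
  have key := integral_bilinear_hasLineDerivAt_right_eq_neg_left_of_integrable (μ := volume)
    (B := (ContinuousLinearMap.lsmul ℝ ℝ : ℝ →L[ℝ] Phys n →L[ℝ] Phys n)) (f := ψ)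
    (f' := fun x => fderiv ℝ ψ x e) (g := w) (g' := w') (v := e)
    (integrable_smul_of_locallyIntegrableOn hwl hcont hc' (hs'.trans hs))
    (integrable_smul_of_locallyIntegrableOn hwl' hψ.continuous hc hs)
    (integrable_smul_of_locallyIntegrableOn hwl hψ.continuous hc hs)
    (fun x _ => ((hψ.differentiable one_ne_zero) x).hasFDerivAt.hasLineDerivAt e)
    (fun x hx => h x (hs hx))
  simp only [ContinuousLinearMap.lsmul_apply] at key
  rw [key, neg_neg]

/-- In `iteratedFDeriv` the first direction is the outermost derivative of the test function. It is
moved onto `w` by one classical integration by parts, and the remaining directions are handled by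
the weak derivative of `w'`. -/
theorem IsWeakDeriv.of_tail {U : Set (Phys n)} (hU : IsOpen U) {k : ℕ}
    {I : Fin (k + 1) → Fin (n + 1)} {w w' g : Phys n → Phys n}
    (hw : ContinuousOn w U) (hw' : ContinuousOn w' U)
    (h : ∀ x ∈ U, HasLineDerivAt ℝ w (w' x) x (EuclideanSpace.single (I 0) 1))
    (hg : IsWeakDeriv U (Fin.tail I) w' g) : IsWeakDeriv U I w g := by
  refine ⟨hw.locallyIntegrableOn hU.measurableSet, hg.2.1, fun φ hφ hc hs => ?_⟩
  set ψ : Phys n → ℝ := fun x =>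
    iteratedFDeriv ℝ k φ x fun l => EuclideanSpace.single (Fin.tail I l) (1 : ℝ) with hψ
  have hψs := tsupport_iteratedFDeriv_apply_subset (φ := φ) k
    (fun l => EuclideanSpace.single (Fin.tail I l) (1 : ℝ))
  have hψd : ContDiff ℝ ((⊤ : ℕ∞) : WithTop ℕ∞) ψ := contDiff_iteratedFDeriv_apply hφ k _
  have e : ∀ x, (iteratedFDeriv ℝ (k + 1) φ x fun l => EuclideanSpace.single (I l) (1 : ℝ))
      = fderiv ℝ ψ x (EuclideanSpace.single (I 0) 1) := fun x => by
    have hd : DifferentiableAt ℝ (iteratedFDeriv ℝ k φ) x :=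
      (hφ.differentiable_iteratedFDeriv (m := k) (by exact_mod_cast ENat.natCast_lt_top k)) x
    rw [iteratedFDeriv_succ_apply_left]
    have := ((ContinuousMultilinearMap.apply ℝ (fun _ : Fin k => Phys n) ℝ
      (fun l => EuclideanSpace.single (Fin.tail I l) (1 : ℝ))).hasFDerivAt.comp x
        hd.hasFDerivAt).fderiv
    have h2 : fderiv ℝ ψ x = _ := this
    rw [h2]; rfl
  simp_rw [e]
  have h1 : ContDiff ℝ 1 ψ := hψd.of_le (by exact_mod_cast le_top)
  rw [integral_lineDeriv_smul_of_hasLineDerivAt hU hw hw' h h1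
    (hc.of_isClosed_subset (isClosed_tsupport _) hψs) (hψs.trans hs), hg.2.2 φ hφ hc hs, pow_succ]
  simp

end WeakDerivatives

end SkeletonStab

namespace SkeletonStab

/-! ### Lipschitz test functions and the product rule -/

section LipschitzTest

variable {n : ℕ}

/-- Mollification of a compactly supported Lipschitz function commutes with line derivatives. -/
theorem fderiv_mollify_apply {χ : Phys n → ℝ} {C : NNReal} (hχ : LipschitzWith C χ)
    (ρ : ContDiffBump (0 : Phys n)) (e x : Phys n) :
    fderiv ℝ (convolution (ρ.normed volume) χ (ContinuousLinearMap.lsmul ℝ ℝ) volume) x e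
      = convolution (ρ.normed volume) (fun y => lineDeriv ℝ χ y e)
          (ContinuousLinearMap.lsmul ℝ ℝ) volume x := by
  set r := ρ.normed (volume : Measure (Phys n)) with hr
  have hrc : HasCompactSupport r := ρ.hasCompactSupport_normed
  have hrd : ContDiff ℝ 1 r := ρ.contDiff_normed
  have hint : LocallyIntegrable χ volume := hχ.continuous.locallyIntegrable
  have h1 := hrc.hasFDerivAt_convolution_left (ContinuousLinearMap.lsmul ℝ ℝ) hrd hint x
  rw [h1.fderiv]
  have hg : LipschitzWith _ (fun y : Phys n => r (x - y)) :=
    (hrd.lipschitzWith_of_hasCompactSupport hrc one_ne_zero).choose_spec.comp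
      ((LipschitzWith.const x).sub LipschitzWith.id)
  have hgc : HasCompactSupport (fun y : Phys n => r (x - y)) :=
    hrc.comp_homeomorph (Homeomorph.subLeft x)
  have h2 := LipschitzWith.integral_lineDeriv_mul_eq (μ := volume) hχ hg hgc e
  have h3 : ∀ y, lineDeriv ℝ (fun y : Phys n => r (x - y)) y (-e) = fderiv ℝ r (x - y) e := by
    intro y
    have hd : HasFDerivAt r (fderiv ℝ r (x - y)) (x - y) :=
      ((hrd.differentiable one_ne_zero) _).hasFDerivAt
    have : HasFDerivAt (fun y : Phys n => r (x - y)) ((fderiv ℝ r (x - y)).comp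
        (-ContinuousLinearMap.id ℝ (Phys n))) y :=
      HasFDerivAt.comp y hd ((hasFDerivAt_id y).const_sub x)
    rw [(this.hasLineDerivAt (-e)).lineDeriv]
    simp
  simp_rw [h3] at h2
  rw [convolution_eq_swap, convolution_eq_swap, ContinuousLinearMap.integral_apply]
  · simp only [ContinuousLinearMap.precompL_apply, ContinuousLinearMap.lsmul_apply, smul_eq_mul]
    rw [← h2]
    exact integral_congr_ae (Eventually.of_forall fun y => mul_comm _ _)
  · have := (hrc.fderiv ℝ).convolutionExists_left (μ := volume)
      ((ContinuousLinearMap.lsmul ℝ ℝ : ℝ →L[ℝ] ℝ →L[ℝ] ℝ).precompL (Phys n))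
      (hrd.continuous_fderiv one_ne_zero) hint x
    exact this.integrable_swap

theorem norm_mollify_le {h : Phys n → ℝ} {C : ℝ} (hC : ∀ y, |h y| ≤ C)
    (ρ : ContDiffBump (0 : Phys n)) (x : Phys n) :
    |convolution (ρ.normed volume) h (ContinuousLinearMap.lsmul ℝ ℝ) volume x| ≤ C := by
  rw [convolution_def, ← Real.norm_eq_abs]
  refine (norm_integral_le_of_norm_le (g := fun t => ρ.normed volume t * C)
    (ρ.integrable_normed.mul_const C) (Eventually.of_forall fun t => ?_)).trans_eq ?_
  · simp only [ContinuousLinearMap.lsmul_apply, smul_eq_mul, norm_mul, Real.norm_eq_abs]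
    rw [abs_of_nonneg (ρ.nonneg_normed t)]
    exact mul_le_mul_of_nonneg_left (hC _) (ρ.nonneg_normed t)
  · rw [integral_mul_const, ρ.integral_normed, one_mul]

/-- Weak derivatives may be tested with compactly supported Lipschitz functions. -/
theorem IsWeakDeriv.integral_lineDeriv_smul {Ω : Set (Phys n)} (hΩ : IsOpen Ω) {i : Fin (n + 1)}
    {v g : Phys n → Phys n} (h : IsWeakDeriv Ω (fun _ : Fin 1 => i) v g) {χ : Phys n → ℝ}
    {C : NNReal} (hχ : LipschitzWith C χ) (hc : HasCompactSupport χ) (hs : tsupport χ ⊆ Ω) :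
    ∫ x in Ω, lineDeriv ℝ χ x (EuclideanSpace.single i 1) • v x = -∫ x in Ω, χ x • g x := by
  set e : Phys n := EuclideanSpace.single i 1 with he
  have he1 : ‖e‖ = 1 := by simp [he]
  obtain ⟨δ, hδ, hK⟩ := hc.isCompact.exists_cthickening_subset_open hΩ hs
  set K := Metric.cthickening δ (tsupport χ) with hKdef
  have hKc : IsCompact K := hc.isCompact.cthickening
  -- The outer radius stays below `δ`, so all mollifications are supported in the compact set `K`
  -- inside `Ω`. The ratio `rOut = 2 * rIn` is fixed, as Lebesgue differentiation requires.
  let ρ : ℕ → ContDiffBump (0 : Phys n) := fun k =>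
    ⟨δ / (k + 1) / 2, δ / (k + 1), by positivity, half_lt_self (by positivity)⟩
  have hρ0 : Tendsto (fun k => (ρ k).rOut) atTop (𝓝 0) :=
    tendsto_const_div_atTop_nhds_zero_nat δ |>.comp (tendsto_add_atTop_nat 1) |>.congr
      fun k => by simp [ρ]
  let X : ℕ → Phys n → ℝ := fun k =>
    convolution ((ρ k).normed volume) χ (ContinuousLinearMap.lsmul ℝ ℝ) volume
  have hXd : ∀ k, ContDiff ℝ ((⊤ : ℕ∞) : WithTop ℕ∞) (X k) := fun k =>
    (ρ k).hasCompactSupport_normed.contDiff_convolution_left _ (ρ k).contDiff_normed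
      hχ.continuous.locallyIntegrable
  have hXs : ∀ k, tsupport (X k) ⊆ K := fun k => by
    refine closure_minimal (fun x hx => ?_) Metric.isClosed_cthickening
    obtain ⟨y, hy, z, hz, rfl⟩ := Set.mem_add.1 (support_convolution_subset _ hx)
    rw [(ρ k).support_normed_eq, Metric.mem_ball, dist_zero_right] at hy
    refine Metric.mem_cthickening_of_dist_le (y + z) z δ _ (subset_tsupport _ hz) ?_
    have : (ρ k).rOut ≤ δ := div_le_self hδ.le (by simp)
    simpa using hy.le.trans this
  have hXc : ∀ k, HasCompactSupport (X k) := fun k =>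
    hKc.of_isClosed_subset (isClosed_tsupport _) (hXs k)
  obtain ⟨Cχ, hCχ⟩ : ∃ Cχ, ∀ x, |χ x| ≤ Cχ :=
    (hc.exists_bound_of_continuous hχ.continuous)
  have hL : ∀ y, |lineDeriv ℝ χ y e| ≤ C := fun y => by
    simpa [he1] using norm_lineDeriv_le_of_lipschitz ℝ hχ (x₀ := y) (v := e)
  have hvK : IntegrableOn v K := (h.1.mono_set hK).integrableOn_isCompact hKc
  have hgK : IntegrableOn g K := (h.2.1.mono_set hK).integrableOn_isCompact hKc
  have toK : ∀ (a : Phys n → ℝ) (w : Phys n → Phys n), (∀ x ∉ K, a x = 0) →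
      ∫ x in Ω, a x • w x = ∫ x in K, a x • w x := fun a w ha => by
    rw [setIntegral_eq_integral_of_forall_compl_eq_zero fun x hx => by
        rw [ha x (fun h => hx (hK h)), zero_smul],
      setIntegral_eq_integral_of_forall_compl_eq_zero fun x hx => by rw [ha x hx, zero_smul]]
  have hχK : ∀ x ∉ K, χ x = 0 := fun x hx => image_eq_zero_of_notMem_tsupport fun h' =>
    hx (Metric.self_subset_cthickening _ h')
  have hχK' : ∀ x ∉ K, lineDeriv ℝ χ x e = 0 := fun x hx => by
    have hx' : x ∉ tsupport χ := fun h' => hx (Metric.self_subset_cthickening _ h')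
    have h0 : χ =ᶠ[𝓝 x] fun _ => (0 : ℝ) := notMem_tsupport_iff_eventuallyEq.1 hx'
    have h1 : HasFDerivAt χ (0 : Phys n →L[ℝ] ℝ) x := (hasFDerivAt_const (0 : ℝ) x).congr_of_eventuallyEq h0
    simpa using (h1.hasLineDerivAt e).lineDeriv
  have key : ∀ k, ∫ x in K, (fderiv ℝ (X k) x e) • v x = -∫ x in K, X k x • g x := fun k => by
    have := h.2.2 (X k) (hXd k) (hXc k) ((hXs k).trans hK)
    simp only [iteratedFDeriv_one_apply, pow_one, neg_smul, one_smul] at this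
    rwa [toK _ _ fun x hx => by rw [fderiv_of_notMem_tsupport ℝ fun h' => hx (hXs k h')]; rfl,
      toK _ _ fun x hx => image_eq_zero_of_notMem_tsupport fun h' => hx (hXs k h')] at this
  have hbump : ∀ᶠ k in atTop, (ρ k).rOut ≤ 2 * (ρ k).rIn := Eventually.of_forall fun k => by
    simp [ρ]; linarith
  -- Mollified line derivatives are bounded by the Lipschitz constant and converge at almost every
  -- point, so domination by `C * ‖v‖` suffices although the derivative of `χ` need not be
  -- continuous.
  have lim1 : Tendsto (fun k => ∫ x in K, (fderiv ℝ (X k) x e) • v x) atTop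
      (𝓝 (∫ x in K, lineDeriv ℝ χ x e • v x)) := by
    refine tendsto_integral_of_dominated_convergence (fun x => C * ‖v x‖) (fun k => ?_)
      (hvK.norm.const_mul _) (fun k => Eventually.of_forall fun x => ?_) ?_
    · exact (((hXd k).continuous_fderiv (by simp)).clm_apply
        continuous_const).aestronglyMeasurable.smul hvK.aestronglyMeasurable
    · rw [norm_smul, fderiv_mollify_apply hχ, Real.norm_eq_abs]
      exact mul_le_mul_of_nonneg_right (norm_mollify_le hL _ _) (norm_nonneg _)
    · have := ContDiffBump.ae_convolution_tendsto_right_of_locallyIntegrable (μ := volume)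
        hρ0 hbump (hχ.locallyIntegrable_lineDeriv (μ := volume) e)
      filter_upwards [ae_restrict_of_ae this] with x hx
      simp_rw [X, fderiv_mollify_apply hχ]
      exact hx.smul_const _
  have lim2 : Tendsto (fun k => ∫ x in K, X k x • g x) atTop (𝓝 (∫ x in K, χ x • g x)) := by
    refine tendsto_integral_of_dominated_convergence (fun x => Cχ * ‖g x‖) (fun k => ?_)
      (hgK.norm.const_mul _) (fun k => Eventually.of_forall fun x => ?_)
      (Eventually.of_forall fun x => ?_)
    · exact (hXd k).continuous.aestronglyMeasurable.smul hgK.aestronglyMeasurable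
    · rw [norm_smul, Real.norm_eq_abs]
      exact mul_le_mul_of_nonneg_right (norm_mollify_le hCχ _ _) (norm_nonneg _)
    · exact (ContDiffBump.convolution_tendsto_right_of_continuous hρ0 hχ.continuous x).smul_const _
  rw [toK _ _ hχK', toK _ _ hχK]
  simp_rw [key] at lim1
  exact tendsto_nhds_unique lim1 lim2.neg

/-- Product rule for a weak derivative with a bounded, locally Lipschitz factor. -/
theorem IsWeakDeriv.smul_of_locallyLipschitz {Ω : Set (Phys n)} (hΩ : IsOpen Ω) {i : Fin (n + 1)}
    {v g : Phys n → Phys n} (h : IsWeakDeriv Ω (fun _ : Fin 1 => i) v g) {φ P : Phys n → ℝ}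
    (hφ : ∀ x ∈ Ω, ∃ K : NNReal, ∃ s ∈ 𝓝 x, LipschitzOnWith K φ s)
    (hP : ∀ᵐ x ∂(volume.restrict Ω), HasLineDerivAt ℝ φ (P x) x (EuclideanSpace.single i 1))
    (hPv : LocallyIntegrableOn (fun x => P x • v x) Ω) :
    IsWeakDeriv Ω (fun _ : Fin 1 => i) (fun x => φ x • v x)
      (fun x => φ x • g x + P x • v x) := by
  have hφc : ContinuousOn φ Ω := fun x hx => by
    obtain ⟨K, s, hs, hL⟩ := hφ x hx
    exact (hL.continuousOn.continuousAt hs).continuousWithinAt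
  have hφv : LocallyIntegrableOn (fun x => φ x • v x) Ω :=
    h.1.continuousOn_smul hΩ.isLocallyClosed hφc
  have hφg : LocallyIntegrableOn (fun x => φ x • g x) Ω :=
    h.2.1.continuousOn_smul hΩ.isLocallyClosed hφc
  refine ⟨hφv, hφg.add hPv, fun ψ hψ hc hs => ?_⟩
  set e : Phys n := EuclideanSpace.single i 1 with he
  simp only [iteratedFDeriv_one_apply, pow_one, neg_smul, one_smul]
  -- The product rule for `φ v` against `ψ` is the identity for `v` tested with `ψ φ`, which is
  -- Lipschitz and compactly supported in `Ω`.
  set χ : Phys n → ℝ := fun x => ψ x * φ x with hχ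
  have hχs : tsupport χ ⊆ tsupport ψ := tsupport_mul_subset_left
  have hχc : HasCompactSupport χ := hc.of_isClosed_subset (isClosed_tsupport _) hχs
  have hψ1 : ContDiff ℝ 1 ψ := hψ.of_le (by exact_mod_cast le_top)
  obtain ⟨Kψ, hKψ⟩ := hψ1.lipschitzWith_of_hasCompactSupport hc one_ne_zero
  have hloc : LocallyLipschitz χ := by
    intro x
    by_cases hx : x ∈ tsupport ψ
    · obtain ⟨K, s, hsx, hL⟩ := hφ x (hs hx)
      obtain ⟨Cψ, hCψ⟩ := hc.exists_bound_of_continuous hψ.continuous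
      have hφx : ContinuousAt φ x := hL.continuousOn.continuousAt hsx
      have hb : ∀ᶠ y in 𝓝 x, |φ y| ≤ |φ x| + 1 :=
        (hφx.abs.eventually_lt (continuousAt_const (y := |φ x| + 1)) (by simp)).mono
          fun y hy => hy.le
      refine ⟨Real.toNNReal (Cψ * K + Kψ * (|φ x| + 1)), s ∩ {y | |φ y| ≤ |φ x| + 1},
        inter_mem hsx hb, LipschitzOnWith.of_dist_le_mul fun a ha b hb => ?_⟩
      have hC0 : 0 ≤ Cψ := (norm_nonneg _).trans (hCψ x)
      rw [Real.coe_toNNReal _ (by positivity), Real.dist_eq]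
      have e1 : χ a - χ b = ψ a * (φ a - φ b) + (ψ a - ψ b) * φ b := by simp only [hχ]; ring
      have e2 : |φ a - φ b| ≤ K * dist a b := by
        rw [← Real.dist_eq]; exact hL.dist_le_mul a ha.1 b hb.1
      have e3 : |ψ a - ψ b| ≤ Kψ * dist a b := by
        rw [← Real.dist_eq]; exact hKψ.dist_le_mul a b
      rw [e1]
      refine (abs_add_le _ _).trans ?_
      rw [abs_mul, abs_mul, add_mul]
      refine add_le_add ?_ ?_
      · rw [mul_assoc]; exact mul_le_mul (hCψ a) e2 (abs_nonneg _) hC0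
      · rw [mul_right_comm]; exact mul_le_mul e3 hb.2 (abs_nonneg _) (by positivity)
    · have h0 : ψ =ᶠ[𝓝 x] fun _ => (0 : ℝ) := notMem_tsupport_iff_eventuallyEq.1 hx
      refine ⟨0, _, h0, LipschitzOnWith.of_dist_le_mul fun a ha b hb => ?_⟩
      have ha' : ψ a = 0 := ha
      have hb' : ψ b = 0 := hb
      simp [hχ, ha', hb']
  obtain ⟨C, hC⟩ : ∃ C, LipschitzWith C χ := by
    obtain ⟨R, hR⟩ := hχc.isCompact.isBounded.subset_closedBall (0 : Phys n)
    obtain ⟨C, hC⟩ := (hloc.locallyLipschitzOn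
      (s := Metric.closedBall (0 : Phys n) (R + 1))).exists_lipschitzOnWith_of_compact
        (isCompact_closedBall _ _)
    obtain ⟨D, hD⟩ := hχc.exists_bound_of_continuous hloc.continuous
    have hD0 : 0 ≤ D := (norm_nonneg _).trans (hD 0)
    have hz : ∀ x ∉ Metric.closedBall (0 : Phys n) R, χ x = 0 := fun x hx =>
      image_eq_zero_of_notMem_tsupport fun h' => hx (hR h')
    -- A local Lipschitz bound is global on a compact ball of radius `R + 1`. If one point lies
    -- outside, either both values vanish or the points are at distance at least one, and the sup
    -- bound `D` serves as a Lipschitz constant.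
    have far : ∀ a b, b ∉ Metric.closedBall (0 : Phys n) (R + 1) →
        dist (χ a) (χ b) ≤ D * dist a b := fun a b hb => by
      have hb' : χ b = 0 := hz b fun h' => hb (Metric.closedBall_subset_closedBall (by simp) h')
      by_cases ha : a ∈ Metric.closedBall (0 : Phys n) R
      · have : 1 ≤ dist a b := by
          rw [Metric.mem_closedBall, dist_zero_right] at ha hb
          have := norm_sub_norm_le b a
          rw [dist_comm, dist_eq_norm]; linarith
        rw [hb', dist_zero_right]
        exact (hD a).trans (le_mul_of_one_le_right hD0 this)
      · rw [hb', hz a ha, dist_self]; positivity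
    refine ⟨C + D.toNNReal, LipschitzWith.of_dist_le_mul fun a b => ?_⟩
    rw [NNReal.coe_add, Real.coe_toNNReal _ hD0]
    have hd := dist_nonneg (x := a) (y := b)
    by_cases hb : b ∈ Metric.closedBall (0 : Phys n) (R + 1)
    · by_cases ha : a ∈ Metric.closedBall (0 : Phys n) (R + 1)
      · have := hC.dist_le_mul a ha b hb
        nlinarith
      · have := far b a ha
        rw [dist_comm (χ b), dist_comm b] at this
        nlinarith [C.coe_nonneg, mul_nonneg C.coe_nonneg hd]
    · nlinarith [far a b hb, mul_nonneg C.coe_nonneg hd]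
  have hψφ : ∀ᵐ x ∂(volume.restrict Ω),
      lineDeriv ℝ χ x e • v x = fderiv ℝ ψ x e • (φ x • v x) + ψ x • (P x • v x) := by
    filter_upwards [hP] with x hx
    have h1 : HasLineDerivAt ℝ ψ (fderiv ℝ ψ x e) x e :=
      (hψ1.differentiable one_ne_zero x).hasFDerivAt.hasLineDerivAt e
    have h2 : HasLineDerivAt ℝ χ (fderiv ℝ ψ x e * φ x + ψ x * P x) x e := by
      have := HasDerivAt.mul h1 hx
      simp only [zero_smul, add_zero] at this
      exact this
    rw [h2.lineDeriv, add_smul, mul_smul, mul_smul]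
  have key := h.integral_lineDeriv_smul hΩ hC hχc (hχs.trans hs)
  rw [integral_congr_ae hψφ] at key
  have hs' : tsupport (fun x => fderiv ℝ ψ x e) ⊆ tsupport ψ :=
    closure_minimal (fun x hx => by
      by_contra hxs
      exact hx (by simp [fderiv_of_notMem_tsupport ℝ hxs])) (isClosed_tsupport ψ)
  have i1 : Integrable (fun x => fderiv ℝ ψ x e • (φ x • v x)) :=
    integrable_smul_of_locallyIntegrableOn hφv
      ((hψ1.continuous_fderiv one_ne_zero).clm_apply continuous_const)
      (hc.of_isClosed_subset (isClosed_tsupport _) hs') (hs'.trans hs)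
  have i2 := integrable_smul_of_locallyIntegrableOn hPv hψ.continuous hc hs
  have i3 := integrable_smul_of_locallyIntegrableOn hφg hψ.continuous hc hs
  rw [integral_add i1.integrableOn i2.integrableOn] at key
  simp_rw [smul_add]
  rw [integral_add i3.integrableOn i2.integrableOn]
  have e4 : ∫ x in Ω, χ x • g x = ∫ x in Ω, ψ x • φ x • g x := by simp only [hχ, mul_smul]
  rw [e4] at key
  rw [eq_sub_of_add_eq key]; abel

end LipschitzTest

end SkeletonStab

namespace SkeletonStab

/-! ### Smoothness of determinants and inverse matrices -/

section MatrixSmooth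

variable {E : Type*} [NormedAddCommGroup E] [NormedSpace ℝ E] {d : ℕ} {m : WithTop ℕ∞} {s : Set E}

theorem contDiffOn_matrix_det {A : E → Matrix (Fin d) (Fin d) ℝ}
    (hA : ∀ i j, ContDiffOn ℝ m (fun x => A x i j) s) : ContDiffOn ℝ m (fun x => (A x).det) s := by
  simp_rw [Matrix.det_apply]
  exact ContDiffOn.sum fun σ _ => (contDiffOn_prod fun i _ => hA _ _).const_smul _

/-- Cramer's rule: each adjugate entry is the determinant of the matrix with one row replaced by a
constant one. -/
theorem contDiffOn_matrix_inv {A : E → Matrix (Fin d) (Fin d) ℝ}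
    (hA : ∀ i j, ContDiffOn ℝ m (fun x => A x i j) s) (h0 : ∀ x ∈ s, (A x).det ≠ 0) (i j : Fin d) :
    ContDiffOn ℝ m (fun x => (A x)⁻¹ i j) s := by
  simp_rw [Matrix.inv_def, Matrix.smul_apply, Ring.inverse_eq_inv', smul_eq_mul,
    Matrix.adjugate_apply]
  refine ((contDiffOn_matrix_det hA).inv h0).mul (contDiffOn_matrix_det fun k l => ?_)
  by_cases hk : k = j
  · subst hk; simpa using contDiffOn_const
  · simpa [Matrix.updateRow_ne hk] using hA k l

end MatrixSmooth

namespace ParamMesh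

variable {n : ℕ} (M : ParamMesh n)

/-! ### Parametric boxes and cells -/

section Boxes

theorem ζ_strictMono {i : Fin (n + 1)} {a b : ℕ} (hab : a < b) (hb : b ≤ M.N i) :
    M.ζ i a < M.ζ i b := by
  induction b with
  | zero => omega
  | succ b ih =>
    have h1 := M.ζ_lt i b (by omega)
    rcases Nat.lt_succ_iff_lt_or_eq.1 hab with h | rfl
    · exact (ih h (by omega)).trans h1
    · exact h1

theorem ζ_mono {i : Fin (n + 1)} {a b : ℕ} (hab : a ≤ b) (hb : b ≤ M.N i) :
    M.ζ i a ≤ M.ζ i b := by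
  rcases hab.lt_or_eq with h | rfl
  · exact (M.ζ_strictMono h hb).le
  · exact le_rfl

theorem isOpen_openBox : IsOpen M.openBox := isOpen_set_pi Set.finite_univ fun _ _ => isOpen_Ioo

theorem isOpen_cell (c : Fin (n + 1) → ℕ) : IsOpen (M.cell c) :=
  isOpen_set_pi Set.finite_univ fun _ _ => isOpen_Ioo

theorem isCompact_closedBox : IsCompact M.closedBox := isCompact_univ_pi fun _ => isCompact_Icc

theorem isCompact_closedCell (c : Fin (n + 1) → ℕ) : IsCompact (M.closedCell c) :=
  isCompact_univ_pi fun _ => isCompact_Icc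

theorem openBox_subset_closedBox : M.openBox ⊆ M.closedBox :=
  Set.pi_mono fun _ _ => Set.Ioo_subset_Icc_self

theorem cell_subset_closedCell (c : Fin (n + 1) → ℕ) : M.cell c ⊆ M.closedCell c :=
  Set.pi_mono fun _ _ => Set.Ioo_subset_Icc_self

theorem cell_subset_openBox {c : Fin (n + 1) → ℕ} (hc : M.IsCell c) : M.cell c ⊆ M.openBox :=
  Set.pi_mono fun i _ => Set.Ioo_subset_Ioo (M.ζ_mono (Nat.zero_le _) (hc i).le)
    (M.ζ_mono (hc i) le_rfl)

theorem closedCell_subset_closedBox {c : Fin (n + 1) → ℕ} (hc : M.IsCell c) :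
    M.closedCell c ⊆ M.closedBox :=
  Set.pi_mono fun i _ => Set.Icc_subset_Icc (M.ζ_mono (Nat.zero_le _) (hc i).le)
    (M.ζ_mono (hc i) le_rfl)

theorem uniqueDiffOn_closedBox : UniqueDiffOn ℝ M.closedBox :=
  UniqueDiffOn.univ_pi fun i => uniqueDiffOn_Icc (M.ζ_strictMono (M.N_pos i) le_rfl)

theorem uniqueDiffOn_closedCell {c : Fin (n + 1) → ℕ} (hc : M.IsCell c) :
    UniqueDiffOn ℝ (M.closedCell c) :=
  UniqueDiffOn.univ_pi fun i => uniqueDiffOn_Icc (M.ζ_lt i _ (hc i))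

theorem convex_closedBox : Convex ℝ M.closedBox := convex_pi fun _ _ => convex_Icc _ _

theorem convex_closedCell (c : Fin (n + 1) → ℕ) : Convex ℝ (M.closedCell c) :=
  convex_pi fun _ _ => convex_Icc _ _

theorem closedBox_mem_nhds {x : Param n} (hx : x ∈ M.openBox) : M.closedBox ∈ 𝓝 x :=
  mem_of_superset (M.isOpen_openBox.mem_nhds hx) M.openBox_subset_closedBox

end Boxes

/-! ### The geometry map and its inverse -/

section Geometry

variable {M} {F : Param n → Phys n} {r : ℕ}

theorem fderivWithin_apply_eq (x w : Param n) :
    fderivWithin ℝ F M.closedBox x w = WithLp.toLp 2 ((M.jac F x).mulVec w) := by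
  ext i
  have : w = ∑ j, w j • (Pi.single j (1 : ℝ) : Param n) := by
    ext k; simp [Finset.sum_apply, Pi.single_apply]
  conv_lhs => rw [this]
  simp [Matrix.mulVec, dotProduct, jac, mul_comm]

/-- The inverse of the derivative of the geometry map. -/
def dinv (M : ParamMesh n) (F : Param n → Phys n) (x : Param n) : Phys n →L[ℝ] Param n :=
  LinearMap.toContinuousLinearMap
    ((M.jac F x)⁻¹.mulVecLin ∘ₗ (WithLp.linearEquiv 2 ℝ (Fin (n + 1) → ℝ)).toLinearMap)

theorem dinv_apply (x : Param n) (z : Phys n) :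
    M.dinv F x z = (M.jac F x)⁻¹.mulVec (WithLp.ofLp z) := rfl

namespace IsGeometryMap

variable (hF : M.IsGeometryMap F r)
include hF

theorem continuousOn : ContinuousOn F M.closedBox := hF.contDiffOn.continuousOn

theorem isUnit_det {x : Param n} (hx : x ∈ M.closedBox) : IsUnit (M.jac F x).det :=
  isUnit_iff_ne_zero.2 (hF.det_ne_zero x hx)

theorem hasFDerivWithinAt {x : Param n} (hx : x ∈ M.closedBox) :
    HasFDerivWithinAt F (fderivWithin ℝ F M.closedBox x) M.closedBox x :=
  (hF.contDiffOn.differentiableOn one_ne_zero x hx).hasFDerivWithinAt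

theorem contDiffAt {x : Param n} (hx : x ∈ M.openBox) : ContDiffAt ℝ 1 F x :=
  hF.contDiffOn.contDiffAt (M.closedBox_mem_nhds hx)

end IsGeometryMap

/-- The derivative of the geometry map as a linear equivalence. -/
def IsGeometryMap.dequiv (hF : M.IsGeometryMap F r) {x : Param n} (hx : x ∈ M.closedBox) :
    Param n ≃L[ℝ] Phys n :=
  ContinuousLinearEquiv.equivOfInverse (fderivWithin ℝ F M.closedBox x) (M.dinv F x)
    (fun w => by
      rw [dinv_apply, fderivWithin_apply_eq, Matrix.mulVec_mulVec,
        Matrix.nonsing_inv_mul _ (hF.isUnit_det hx), Matrix.one_mulVec])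
    (fun z => by
      rw [dinv_apply, fderivWithin_apply_eq, Matrix.mulVec_mulVec,
        Matrix.mul_nonsing_inv _ (hF.isUnit_det hx), Matrix.one_mulVec])

namespace IsGeometryMap

variable (hF : M.IsGeometryMap F r)
include hF

theorem hasFDerivAt_dequiv {x : Param n} (hx : x ∈ M.openBox) :
    HasFDerivAt F (hF.dequiv (M.openBox_subset_closedBox hx) : Param n →L[ℝ] Phys n) x :=
  (hF.hasFDerivWithinAt (M.openBox_subset_closedBox hx)).hasFDerivAt (M.closedBox_mem_nhds hx)

/-- Inverse function theorem: at every point of the open box the derivative is invertible, so `F`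
maps neighbourhoods to neighbourhoods. -/
theorem isOpen_image {U : Set (Param n)} (hU : IsOpen U) (hUB : U ⊆ M.openBox) :
    IsOpen (F '' U) := by
  rw [isOpen_iff_mem_nhds]
  rintro _ ⟨x, hx, rfl⟩
  have h := (hF.contDiffAt (hUB hx)).hasStrictFDerivAt' (hF.hasFDerivAt_dequiv (hUB hx)) one_ne_zero
  rw [← h.map_nhds_eq_of_equiv]
  exact image_mem_map (hU.mem_nhds hx)

end IsGeometryMap

/-- The geometry map as an open partial homeomorphism from the parametric to the physical
domain. -/
def IsGeometryMap.homeo (hF : M.IsGeometryMap F r) : OpenPartialHomeomorph (Param n) (Phys n) :=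
  OpenPartialHomeomorph.ofContinuousOpenRestrict
    (Set.InjOn.toPartialEquiv F M.openBox (hF.injOn.mono M.openBox_subset_closedBox))
    (hF.continuousOn.mono M.openBox_subset_closedBox)
    (fun U hU => by
      obtain ⟨V, hV, rfl⟩ := isOpen_induced_iff.1 hU
      have := hF.isOpen_image (hV.inter M.isOpen_openBox) Set.inter_subset_right
      convert this using 1
      ext z
      constructor
      · rintro ⟨x, hx, rfl⟩; exact ⟨x, ⟨hx, x.2⟩, rfl⟩
      · rintro ⟨x, hx, rfl⟩; exact ⟨⟨x, hx.2⟩, hx.1, rfl⟩)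
    M.isOpen_openBox

namespace IsGeometryMap

variable (hF : M.IsGeometryMap F r)

theorem homeo_symm_apply {x : Param n} (hx : x ∈ M.openBox) : hF.homeo.symm (F x) = x :=
  hF.homeo.left_inv hx

include hF

theorem isOpen_domain : IsOpen (M.domain F) := hF.isOpen_image M.isOpen_openBox subset_rfl

theorem hasFDerivAt_symm {x : Param n} (hx : x ∈ M.openBox) :
    HasFDerivAt hF.homeo.symm (M.dinv F x) (F x) := by
  have hT : F x ∈ hF.homeo.target := hF.homeo.map_source hx
  have := hF.homeo.hasFDerivAt_symm (f' := hF.dequiv (M.openBox_subset_closedBox hx)) hT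
    (by rw [hF.homeo_symm_apply hx]; exact hF.hasFDerivAt_dequiv hx)
  exact this

theorem contDiffAt_symm {x : Param n} (hx : x ∈ M.openBox) :
    ContDiffAt ℝ 1 hF.homeo.symm (F x) := by
  have hT : F x ∈ hF.homeo.target := hF.homeo.map_source hx
  refine hF.homeo.contDiffAt_symm (f₀' := hF.dequiv (M.openBox_subset_closedBox hx)) hT ?_ ?_
  · rw [hF.homeo_symm_apply hx]; exact hF.hasFDerivAt_dequiv hx
  · rw [hF.homeo_symm_apply hx]; exact hF.contDiffAt hx

theorem continuousOn_jac (i j : Fin (n + 1)) :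
    ContinuousOn (fun x => M.jac F x i j) M.closedBox := by
  have h := hF.contDiffOn.continuousOn_fderivWithin M.uniqueDiffOn_closedBox le_rfl
  have h2 : ContinuousOn (fun x => fderivWithin ℝ F M.closedBox x (Pi.single j 1)) M.closedBox :=
    h.clm_apply continuousOn_const
  exact (EuclideanSpace.proj (𝕜 := ℝ) i).continuous.comp_continuousOn h2

/-- The Jacobian is defined by differentiating within the whole box, where `F` is only `C¹`. On a
closed cell, a set of unique differentiability, it agrees with the derivative within that cell,
which inherits the cellwise smoothness of `F` less one order. -/
theorem contDiffOn_jac_cell {c : Fin (n + 1) → ℕ} (hc : M.IsCell c) {m : ℕ} (hm : m + 1 ≤ r)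
    (i j : Fin (n + 1)) : ContDiffOn ℝ m (fun x => M.jac F x i j) (M.closedCell c) := by
  have h := (hF.contDiffOn_cell c hc).fderivWithin (m := m) (M.uniqueDiffOn_closedCell hc)
    (by exact_mod_cast hm)
  have h2 : ContDiffOn ℝ m (fun x => fderivWithin ℝ F (M.closedCell c) x (Pi.single j 1))
      (M.closedCell c) := h.clm_apply contDiffOn_const
  refine ((EuclideanSpace.proj (𝕜 := ℝ) i).contDiff.comp_contDiffOn h2).congr fun x hx => ?_
  simp only [jac, Matrix.of_apply, Function.comp_apply]
  rw [← fderivWithin_subset (M.closedCell_subset_closedBox hc) (M.uniqueDiffOn_closedCell hc x hx)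
    (hF.contDiffOn.differentiableOn one_ne_zero x (M.closedCell_subset_closedBox hc hx))]
  rfl

theorem continuousOn_det : ContinuousOn (fun x => (M.jac F x).det) M.closedBox :=
  (contDiffOn_matrix_det (m := 0) fun i j => contDiffOn_zero.2 (hF.continuousOn_jac i j)).continuousOn

theorem continuousOn_jacInv (i j : Fin (n + 1)) :
    ContinuousOn (fun x => (M.jac F x)⁻¹ i j) M.closedBox :=
  (contDiffOn_matrix_inv (m := 0) (fun i j => contDiffOn_zero.2 (hF.continuousOn_jac i j))
    hF.det_ne_zero i j).continuousOn

theorem exists_det_bounds : ∃ c C : ℝ, 0 < c ∧ 0 < C ∧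
    ∀ x ∈ M.closedBox, c ≤ |(M.jac F x).det| ∧ |(M.jac F x).det| ≤ C := by
  have hne : M.closedBox.Nonempty := ⟨fun i => M.ζ i 0, fun i _ =>
    ⟨le_rfl, M.ζ_mono (Nat.zero_le _) le_rfl⟩⟩
  obtain ⟨a, ha, ha'⟩ := M.isCompact_closedBox.exists_isMinOn hne hF.continuousOn_det.abs
  obtain ⟨b, hb, hb'⟩ := M.isCompact_closedBox.exists_isMaxOn hne hF.continuousOn_det.abs
  exact ⟨_, _, abs_pos.2 (hF.det_ne_zero a ha), abs_pos.2 (hF.det_ne_zero b hb),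
    fun x hx => ⟨ha' hx, hb' hx⟩⟩

theorem exists_lipschitz : ∃ L : NNReal, LipschitzOnWith L F M.closedBox := by
  have h := hF.contDiffOn.continuousOn_fderivWithin M.uniqueDiffOn_closedBox le_rfl
  obtain ⟨C, hC⟩ := M.isCompact_closedBox.exists_bound_of_continuousOn h
  refine ⟨C.toNNReal, M.convex_closedBox.lipschitzOnWith_of_nnnorm_hasFDerivWithin_le
    (fun x hx => hF.hasFDerivWithinAt hx) fun x hx => ?_⟩
  rw [← NNReal.coe_le_coe]
  exact (hC x hx).trans (Real.le_coe_toNNReal C)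

end IsGeometryMap

end Geometry

end ParamMesh

end SkeletonStab

namespace SkeletonStab

namespace ParamMesh

/-! ### Change of variables between parametric and physical domain -/

section ChangeOfVariables

variable {n : ℕ} {M : ParamMesh n} {F : Param n → Phys n} {r : ℕ}

theorem preimage_toLp_image (F : Param n → Phys n) (S : Set (Param n)) :
    (MeasurableEquiv.toLp 2 (Fin (n + 1) → ℝ)) ⁻¹' (F '' S) = (fun y => WithLp.ofLp (F y)) '' S := by
  ext z
  constructor
  · rintro ⟨x, hx, h⟩; exact ⟨x, hx, by simp [h]⟩
  · rintro ⟨x, hx, rfl⟩; exact ⟨x, hx, rfl⟩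

namespace IsGeometryMap

variable (hF : M.IsGeometryMap F r)
include hF

/-- The derivative of the geometry map, in coordinates, as an endomorphism of `ℝ^d`. -/
theorem exists_hasFDerivWithinAt_ofLp : ∃ F' : Param n → Param n →L[ℝ] Param n,
    ∀ x ∈ M.openBox, HasFDerivWithinAt (fun y => WithLp.ofLp (F y)) (F' x) M.openBox x ∧
      (F' x).det = (M.jac F x).det := by
  refine ⟨fun x => (PiLp.continuousLinearEquiv 2 ℝ (fun _ : Fin (n + 1) => ℝ) :
    Phys n →L[ℝ] Param n).comp (fderivWithin ℝ F M.closedBox x), fun x hx => ⟨?_, ?_⟩⟩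
  · exact (PiLp.continuousLinearEquiv 2 ℝ (fun _ : Fin (n + 1) => ℝ) :
      Phys n →L[ℝ] Param n).hasFDerivAt.comp_hasFDerivWithinAt x
        ((hF.hasFDerivWithinAt (M.openBox_subset_closedBox hx)).mono M.openBox_subset_closedBox)
  · rw [← LinearMap.det_toLin', ContinuousLinearMap.det]
    congr 1
    ext w i
    simp [fderivWithin_apply_eq]

theorem injOn_ofLp : Set.InjOn (fun y => WithLp.ofLp (F y)) M.openBox := fun _ ha _ hb h =>
  hF.injOn (M.openBox_subset_closedBox ha) (M.openBox_subset_closedBox hb)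
    (WithLp.ofLp_injective 2 h)

/-- The Jacobian formula is applied to `F` in coordinates, a self-map of `Fin (n + 1) → ℝ`; the
passage to the Euclidean norm by `toLp` preserves volume. -/
theorem lintegral_image {S : Set (Param n)} (hS : MeasurableSet S) (hSB : S ⊆ M.openBox)
    (g : Phys n → ENNReal) :
    ∫⁻ z in F '' S, g z = ∫⁻ x in S, ENNReal.ofReal |(M.jac F x).det| * g (F x) := by
  obtain ⟨F', hF'⟩ := hF.exists_hasFDerivWithinAt_ofLp
  have h1 := lintegral_image_eq_lintegral_abs_det_fderiv_mul (volume : Measure (Param n)) hS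
    (fun x hx => ((hF' x (hSB hx)).1.mono hSB)) (hF.injOn_ofLp.mono hSB)
    (fun z => g (MeasurableEquiv.toLp 2 _ z))
  have h2 := (PiLp.volume_preserving_toLp (Fin (n + 1))).setLIntegral_comp_preimage_emb
    (MeasurableEquiv.toLp 2 (Fin (n + 1) → ℝ)).measurableEmbedding g (F '' S)
  rw [← h2]
  change ∫⁻ a in (MeasurableEquiv.toLp 2 (Fin (n + 1) → ℝ)) ⁻¹' (F '' S), _ = _
  rw [preimage_toLp_image]
  refine h1.trans (setLIntegral_congr_fun hS fun x hx => ?_)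
  simp only [(hF' x (hSB hx)).2]
  rfl

theorem setIntegral_image {E : Type*} [NormedAddCommGroup E] [NormedSpace ℝ E]
    {S : Set (Param n)} (hS : MeasurableSet S) (hSB : S ⊆ M.openBox) (g : Phys n → E) :
    ∫ z in F '' S, g z = ∫ x in S, |(M.jac F x).det| • g (F x) := by
  obtain ⟨F', hF'⟩ := hF.exists_hasFDerivWithinAt_ofLp
  have h1 := integral_image_eq_integral_abs_det_fderiv_smul (volume : Measure (Param n)) hS
    (fun x hx => ((hF' x (hSB hx)).1.mono hSB)) (hF.injOn_ofLp.mono hSB)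
    (fun z => g (MeasurableEquiv.toLp 2 _ z))
  have h2 := (PiLp.volume_preserving_toLp (Fin (n + 1))).setIntegral_preimage_emb
    (MeasurableEquiv.toLp 2 (Fin (n + 1) → ℝ)).measurableEmbedding g (F '' S)
  rw [← h2]
  change ∫ a in (MeasurableEquiv.toLp 2 (Fin (n + 1) → ℝ)) ⁻¹' (F '' S), _ = _
  rw [preimage_toLp_image]
  refine h1.trans (setIntegral_congr_fun hS fun x hx => ?_)
  simp only [(hF' x (hSB hx)).2]
  rfl

theorem aemeasurable : AEMeasurable F (volume.restrict M.openBox) :=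
  (hF.continuousOn.mono M.openBox_subset_closedBox).aemeasurable M.isOpen_openBox.measurableSet

/-- The determinant is bounded below on the compact box, which gives the constant. This comparison
of measures carries integrability, measurability and almost everywhere statements from `Ω` back to
the parametric domain. -/
theorem map_volume_le : ∃ C : NNReal,
    Measure.map F (volume.restrict M.openBox) ≤ C • volume.restrict (M.domain F) := by
  obtain ⟨c, _, hc, _, hb⟩ := hF.exists_det_bounds
  refine ⟨Real.toNNReal c⁻¹, Measure.le_iff.2 fun s hs => ?_⟩
  rw [Measure.map_apply_of_aemeasurable hF.aemeasurable hs]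
  have h1 := hF.lintegral_image M.isOpen_openBox.measurableSet subset_rfl (s.indicator 1)
  have h2 : ∫⁻ z in F '' M.openBox, s.indicator 1 z = volume.restrict (M.domain F) s := by
    rw [lintegral_indicator_one hs]; rfl
  have hms : NullMeasurableSet (F ⁻¹' s) (volume.restrict M.openBox) :=
    hF.aemeasurable.nullMeasurableSet_preimage hs
  rw [h2] at h1
  rw [Measure.smul_apply, h1, ENNReal.smul_def, smul_eq_mul,
    ← lintegral_const_mul' _ _ ENNReal.coe_ne_top, ← lintegral_indicator_one₀ hms]
  refine setLIntegral_mono' M.isOpen_openBox.measurableSet fun x hx => ?_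
  by_cases hxs : F x ∈ s
  · have hx' := (hb x (M.openBox_subset_closedBox hx)).1
    simp only [Set.mem_preimage, hxs, Set.indicator_of_mem, Pi.one_apply, mul_one]
    change 1 ≤ ENNReal.ofReal c⁻¹ * _
    rw [← ENNReal.ofReal_mul (by positivity), ENNReal.one_le_ofReal]
    rw [inv_mul_eq_div, le_div_iff₀ hc, one_mul]; exact hx'
  · simp [hxs]

/-- The set `S` need not be measurable, so the change of variables is applied to a measurable null
set that contains it. -/
theorem volume_image_eq_zero {S : Set (Param n)} (hSB : S ⊆ M.openBox)
    (h0 : volume S = 0) : volume (F '' S) = 0 := by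
  set T := toMeasurable volume S ∩ M.openBox with hT
  have hTm : MeasurableSet T := (measurableSet_toMeasurable _ _).inter M.isOpen_openBox.measurableSet
  have hT0 : volume T = 0 := measure_mono_null Set.inter_subset_left (by rwa [measure_toMeasurable])
  refine measure_mono_null (Set.image_mono (Set.subset_inter (subset_toMeasurable volume _) hSB)) ?_
  have := hF.lintegral_image hTm Set.inter_subset_right 1
  simpa [Measure.restrict_eq_zero.2 hT0] using this

theorem ae_domain_of_ae {P : Phys n → Prop}
    (h : ∀ᵐ x ∂(volume.restrict M.openBox), P (F x)) :
    ∀ᵐ z ∂(volume.restrict (M.domain F)), P z := by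
  rw [ae_restrict_iff' hF.isOpen_domain.measurableSet]
  rw [ae_restrict_iff' M.isOpen_openBox.measurableSet] at h
  refine measure_mono_null ?_ (hF.volume_image_eq_zero
    (S := {x | ¬ (x ∈ M.openBox → P (F x))} ) (fun x hx => ?_) h)
  · rintro z hz
    simp only [Set.mem_compl_iff, Set.mem_ofPred_eq, Classical.not_imp] at hz
    obtain ⟨⟨x, hx, rfl⟩, hPx⟩ := hz
    exact ⟨x, by simpa using ⟨hx, hPx⟩, rfl⟩
  · by_contra h'; exact hx fun h'' => absurd h'' h'

theorem isFiniteMeasure_domain : IsFiniteMeasure (volume.restrict (M.domain F)) :=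
  ⟨by
    rw [Measure.restrict_apply_univ]
    exact (measure_mono (Set.image_mono M.openBox_subset_closedBox)).trans_lt
      (M.isCompact_closedBox.image_of_continuousOn hF.continuousOn).measure_lt_top⟩

end IsGeometryMap

end ChangeOfVariables

/-! ### Collar coordinates -/

section Slabs

variable {n : ℕ} {M : ParamMesh n} {F : Param n → Phys n} {r : ℕ}

/-- The affine chart `(t, y) ↦ (a + σ t, y)` preserves volume when `σ = ±1`. -/
theorem measurePreserving_ins (i : Fin (n + 1)) (a : ℝ) {σ : ℝ} (hσ : σ = 1 ∨ σ = -1) :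
    MeasurePreserving (fun q : ℝ × (Fin n → ℝ) => ins i (a + σ * q.1) q.2)
      ((volume : Measure ℝ).prod volume) volume := by
  have h1 : MeasurePreserving (fun t : ℝ => a + σ * t) volume volume := by
    rcases hσ with rfl | rfl
    · simpa using measurePreserving_add_left volume a
    · simpa [sub_eq_add_neg] using Measure.measurePreserving_sub_left volume a
  have h2 := h1.prod (MeasurePreserving.id (volume : Measure (Fin n → ℝ)))
  exact (volume_preserving_piFinSuccAbove (fun _ : Fin (n + 1) => ℝ) i).symm.comp h2

theorem measurableEmbedding_ins (i : Fin (n + 1)) (a : ℝ) {σ : ℝ} (hσ : σ = 1 ∨ σ = -1) :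
    MeasurableEmbedding (fun q : ℝ × (Fin n → ℝ) => ins i (a + σ * q.1) q.2) := by
  let e : ℝ ≃ᵐ ℝ := if σ = 1 then MeasurableEquiv.addLeft a else MeasurableEquiv.subLeft a
  have he : ∀ t, e t = a + σ * t := fun t => by
    rcases hσ with rfl | rfl
    · simp [e]
    · have : (-1 : ℝ) ≠ 1 := by norm_num
      simp only [e, this, if_false, neg_mul, one_mul]
      exact sub_eq_add_neg a t
  have := ((e.prodCongr (MeasurableEquiv.refl (Fin n → ℝ))).trans
    (MeasurableEquiv.piFinSuccAbove (fun _ : Fin (n + 1) => ℝ) i).symm).measurableEmbedding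
  refine (funext fun q => ?_ : _ = fun q : ℝ × (Fin n → ℝ) => ins i (a + σ * q.1) q.2) ▸ this
  rw [← he]; rfl

/-- The slab measure on `(0, ε) × S`. -/
def slab (ε : ℝ) (S : Set (Fin n → ℝ)) : Measure (ℝ × (Fin n → ℝ)) :=
  (volume.restrict (Set.Ioo 0 ε)).prod (volume.restrict S)

theorem slab_eq (ε : ℝ) (S : Set (Fin n → ℝ)) :
    slab ε S = (((volume : Measure ℝ).prod volume).restrict (Set.Ioo 0 ε ×ˢ S)) :=
  Measure.prod_restrict _ _

theorem map_ins_slab_le (i : Fin (n + 1)) (a : ℝ) {σ : ℝ} (hσ : σ = 1 ∨ σ = -1) {ε : ℝ}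
    {S : Set (Fin n → ℝ)} {B : Set (Param n)}
    (hS : ∀ t ∈ Set.Ioo 0 ε, ∀ y ∈ S, ins i (a + σ * t) y ∈ B) :
    Measure.map (fun q : ℝ × (Fin n → ℝ) => ins i (a + σ * q.1) q.2) (slab ε S)
      ≤ volume.restrict B := by
  have hp := (measurePreserving_ins (n := n) i a hσ)
  refine Measure.le_iff.2 fun s hs => ?_
  rw [Measure.map_apply hp.measurable hs, slab_eq, Measure.restrict_apply (hp.measurable hs),
    Measure.restrict_apply hs, ← hp.measure_preimage_emb (measurableEmbedding_ins i a hσ)]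
  exact measure_mono fun q hq => ⟨hq.1, hS q.1 hq.2.1 q.2 hq.2.2⟩

theorem aemeasurable_comp_ins (hF : M.IsGeometryMap F r) (i : Fin (n + 1)) (a : ℝ) {σ : ℝ}
    (hσ : σ = 1 ∨ σ = -1) {ε : ℝ} {S : Set (Fin n → ℝ)}
    (hS : ∀ t ∈ Set.Ioo 0 ε, ∀ y ∈ S, ins i (a + σ * t) y ∈ M.openBox) :
    AEMeasurable (fun q : ℝ × (Fin n → ℝ) => F (ins i (a + σ * q.1) q.2)) (slab ε S) :=
  (hF.aemeasurable.mono_measure (map_ins_slab_le i a hσ hS)).comp_measurable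
    (measurePreserving_ins i a hσ).measurable

/-- The chart onto a parametric slab preserves volume and `F` distorts it by a bounded factor.
Through this bound, functions and null sets on `Ω` are transported to collars, and the constant does
not depend on the face, the side or the width. -/
theorem map_comp_ins_le (hF : M.IsGeometryMap F r) : ∃ C : NNReal, ∀ (i : Fin (n + 1)) (a σ : ℝ),
    (σ = 1 ∨ σ = -1) → ∀ (ε : ℝ) (S : Set (Fin n → ℝ)),
    (∀ t ∈ Set.Ioo 0 ε, ∀ y ∈ S, ins i (a + σ * t) y ∈ M.openBox) →
    Measure.map (fun q : ℝ × (Fin n → ℝ) => F (ins i (a + σ * q.1) q.2)) (slab ε S)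
      ≤ C • volume.restrict (M.domain F) := by
  obtain ⟨C, hC⟩ := hF.map_volume_le
  refine ⟨C, fun i a σ hσ ε S hS => le_trans ?_ hC⟩
  have hm := map_ins_slab_le i a hσ hS
  have := AEMeasurable.map_map_of_aemeasurable (hF.aemeasurable.mono_measure hm)
    (measurePreserving_ins (n := n) i a hσ).measurable.aemeasurable
  change Measure.map (F ∘ _) _ ≤ _
  rw [← this]
  exact Measure.map_mono_of_aemeasurable hm hF.aemeasurable

theorem memLp_comp_ins (hF : M.IsGeometryMap F r) {E : Type*} [NormedAddCommGroup E]
    {p : ENNReal} {g : Phys n → E} (hg : MemLp g p (volume.restrict (M.domain F)))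
    (i : Fin (n + 1)) (a : ℝ) {σ : ℝ} (hσ : σ = 1 ∨ σ = -1) {ε : ℝ} {S : Set (Fin n → ℝ)}
    (hS : ∀ t ∈ Set.Ioo 0 ε, ∀ y ∈ S, ins i (a + σ * t) y ∈ M.openBox) :
    MemLp (fun q : ℝ × (Fin n → ℝ) => g (F (ins i (a + σ * q.1) q.2))) p (slab ε S) := by
  obtain ⟨C, hC⟩ := map_comp_ins_le hF
  exact MemLp.comp_of_map (hg.of_measure_le_smul ENNReal.coe_ne_top (hC i a σ hσ ε S hS))
    (aemeasurable_comp_ins hF i a hσ hS)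

theorem aestronglyMeasurable_comp_ins (hF : M.IsGeometryMap F r) {E : Type*} [TopologicalSpace E]
    {g : Phys n → E} (hg : AEStronglyMeasurable g (volume.restrict (M.domain F)))
    (i : Fin (n + 1)) (a : ℝ) {σ : ℝ} (hσ : σ = 1 ∨ σ = -1) {ε : ℝ} {S : Set (Fin n → ℝ)}
    (hS : ∀ t ∈ Set.Ioo 0 ε, ∀ y ∈ S, ins i (a + σ * t) y ∈ M.openBox) :
    AEStronglyMeasurable (fun q : ℝ × (Fin n → ℝ) => g (F (ins i (a + σ * q.1) q.2)))
      (slab ε S) := by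
  obtain ⟨C, hC⟩ := map_comp_ins_le hF
  have hac := (Measure.absolutelyContinuous_of_le (hC i a σ hσ ε S hS)).trans
    (Measure.AbsolutelyContinuous.rfl.smul_left _)
  exact (hg.mono_ac hac).comp_aemeasurable (aemeasurable_comp_ins hF i a hσ hS)

theorem ae_comp_ins (hF : M.IsGeometryMap F r) {P : Phys n → Prop}
    (hP : ∀ᵐ z ∂(volume.restrict (M.domain F)), P z)
    (i : Fin (n + 1)) (a : ℝ) {σ : ℝ} (hσ : σ = 1 ∨ σ = -1) {ε : ℝ} {S : Set (Fin n → ℝ)}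
    (hS : ∀ t ∈ Set.Ioo 0 ε, ∀ y ∈ S, ins i (a + σ * t) y ∈ M.openBox) :
    ∀ᵐ q ∂(slab ε S), P (F (ins i (a + σ * q.1) q.2)) := by
  obtain ⟨C, hC⟩ := map_comp_ins_le hF
  have hac := (Measure.absolutelyContinuous_of_le (hC i a σ hσ ε S hS)).trans
    (Measure.AbsolutelyContinuous.rfl.smul_left _)
  exact ae_of_ae_map (aemeasurable_comp_ins hF i a hσ hS) (hac.ae_le hP)

end Slabs

end ParamMesh

end SkeletonStab

namespace SkeletonStab

/-! ### Almost every point lies in an open cell -/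

section Grid

theorem exists_mem_Ioo_of_forall_ne {ζ : ℕ → ℝ} {N : ℕ} {x : ℝ} (hx : x ∈ Set.Ioo (ζ 0) (ζ N))
    (hne : ∀ j, x ≠ ζ j) : ∃ c < N, x ∈ Set.Ioo (ζ c) (ζ (c + 1)) := by
  induction N with
  | zero => exact absurd (hx.1.trans hx.2) (lt_irrefl _)
  | succ N ih =>
    rcases lt_or_gt_of_ne (hne N) with h | h
    · obtain ⟨c, hc, hxc⟩ := ih ⟨hx.1, h⟩
      exact ⟨c, hc.trans (Nat.lt_succ_self N), hxc⟩
    · exact ⟨N, Nat.lt_succ_self N, h, hx.2⟩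

/-- Almost every point of a box lies in an open cell of any grid on it. -/
theorem ae_exists_mem_grid_cell {ι : Type*} [Fintype ι] (N : ι → ℕ) (ζ : ι → ℕ → ℝ) :
    ∀ᵐ y : ι → ℝ, y ∈ Set.univ.pi (fun k => Set.Ioo (ζ k 0) (ζ k (N k))) →
      ∃ c : ι → ℕ, (∀ k, c k < N k) ∧
        y ∈ Set.univ.pi fun k => Set.Ioo (ζ k (c k)) (ζ k (c k + 1)) := by
  have h : ∀ᵐ y : ι → ℝ, ∀ k j, y k ≠ ζ k j := by
    refine ae_all_iff.2 fun k => ae_all_iff.2 fun j => ?_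
    have := Measure.pi_hyperplane (fun _ : ι => (volume : Measure ℝ)) k (ζ k j)
    rw [ae_iff]
    simpa [volume_pi] using this
  filter_upwards [h] with y hy hyB
  choose c hc hyc using fun k => exists_mem_Ioo_of_forall_ne (hyB k trivial) (hy k)
  exact ⟨c, hc, fun k _ => hyc k⟩

end Grid

/-- The iterated partial derivative `∂_{I (k-1)} ⋯ ∂_{I 0} w`. -/
def iteratedPartial {n : ℕ} : (k : ℕ) → (Fin k → Fin (n + 1)) → (Phys n → Phys n) → Phys n → Phys n
  | 0, _, w => w
  | k + 1, I, w =>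
    iteratedPartial k (Fin.tail I) fun z => lineDeriv ℝ w z (EuclideanSpace.single (I 0) 1)

namespace ParamMesh

variable {n : ℕ} (M : ParamMesh n)

theorem ae_exists_mem_cell :
    ∀ᵐ x ∂(volume.restrict M.openBox), ∃ c, M.IsCell c ∧ x ∈ M.cell c := by
  rw [ae_restrict_iff' M.isOpen_openBox.measurableSet]
  exact ae_exists_mem_grid_cell M.N M.ζ

theorem measurableSet_faceDom (i : Fin (n + 1)) : MeasurableSet (M.faceDom i) :=
  (isOpen_set_pi Set.finite_univ fun _ _ => isOpen_Ioo).measurableSet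

theorem measurableSet_facetDom (i : Fin (n + 1)) (c : Fin n → ℕ) :
    MeasurableSet (M.facetDom i c) :=
  (isOpen_set_pi Set.finite_univ fun _ _ => isOpen_Ioo).measurableSet

theorem ae_exists_mem_facetDom (i : Fin (n + 1)) :
    ∀ᵐ y ∂(volume.restrict (M.faceDom i)), ∃ c ∈ M.facetIdx i, y ∈ M.facetDom i c := by
  rw [ae_restrict_iff' (M.measurableSet_faceDom i)]
  filter_upwards [ae_exists_mem_grid_cell (fun k => M.N (i.succAbove k))
    (fun k => M.ζ (i.succAbove k))] with y hy hyB
  obtain ⟨c, hc, hyc⟩ := hy hyB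
  exact ⟨c, Fintype.mem_piFinset.2 fun k => Finset.mem_range.2 (hc k), hyc⟩

end ParamMesh

/-! ### Cellwise smoothness of splines and of discrete velocities -/

section Splines

/-- No knot lies inside `(a, b)`, so the degree zero functions are constant there, and each step of
the recursion only multiplies by affine factors and adds. -/
theorem exists_contDiff_eq_bspline {ξ : ℕ → ℝ} {a b : ℝ} (hξ : ∀ j, ξ j ≤ a ∨ b ≤ ξ j)
    (m : WithTop ℕ∞) (p j : ℕ) :
    ∃ f : ℝ → ℝ, ContDiff ℝ m f ∧ ∀ x ∈ Set.Ioo a b, bspline ξ p j x = f x := by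
  induction p generalizing j with
  | zero =>
    refine ⟨fun _ => if ξ j ≤ a ∧ b ≤ ξ (j + 1) then 1 else 0, contDiff_const, fun x hx => ?_⟩
    rw [bspline]
    refine if_congr ⟨fun h => ⟨?_, ?_⟩, fun h => ⟨h.1.trans hx.1.le, hx.2.trans_le h.2⟩⟩ rfl rfl
    · exact (hξ j).resolve_right fun h' => absurd (h'.trans h.1) (not_le.2 hx.2)
    · exact (hξ (j + 1)).resolve_left fun h' => absurd (h.2.trans_le h') (not_lt.2 hx.1.le)
  | succ p ih =>
    obtain ⟨f, hf, hfe⟩ := ih j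
    obtain ⟨g, hg, hge⟩ := ih (j + 1)
    refine ⟨fun x => (x - ξ j) / (ξ (j + p + 1) - ξ j) * f x
        + (ξ (j + p + 2) - x) / (ξ (j + p + 2) - ξ (j + 1)) * g x, ?_, fun x hx => ?_⟩
    · exact (((contDiff_id.sub contDiff_const).div_const _).mul hf).add
        (((contDiff_const.sub contDiff_id).div_const _).mul hg)
    · rw [bspline, hfe x hx, hge x hx]

namespace ParamMesh

variable {n : ℕ} (M : ParamMesh n)

/-- The `min` in the knot vector caps the index at `N`, so every knot, also beyond the range of
meaningful indices, is one of the mesh values, and none of these is interior to an element. -/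
theorem openKnot_le_or_ge (p β : ℕ) (i : Fin (n + 1)) {c : ℕ} (hc : c < M.N i) (j : ℕ) :
    openKnot p β (M.N i) (M.ζ i) j ≤ M.ζ i c ∨ M.ζ i (c + 1) ≤ openKnot p β (M.N i) (M.ζ i) j := by
  have key : ∀ q ≤ M.N i, M.ζ i q ≤ M.ζ i c ∨ M.ζ i (c + 1) ≤ M.ζ i q := fun q hq => by
    rcases le_or_gt q c with h | h
    · exact Or.inl (M.ζ_mono h hc.le)
    · exact Or.inr (M.ζ_mono h hq)
  unfold openKnot
  split_ifs
  · exact key 0 (Nat.zero_le _)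
  · exact key _ (min_le_left _ _)

theorem exists_contDiff_eq_of_mem_splineSpace {deg : Fin (n + 1) → ℕ} {β : ℕ}
    {b : Param n → ℝ} (hb : b ∈ M.splineSpace deg β) {c : Fin (n + 1) → ℕ} (hc : M.IsCell c)
    (m : WithTop ℕ∞) : ∃ g : Param n → ℝ, ContDiff ℝ m g ∧ ∀ x ∈ M.cell c, b x = g x := by
  induction hb using Submodule.span_induction with
  | mem b hb =>
    obtain ⟨j, -, rfl⟩ := hb
    choose f hf hfe using fun i => exists_contDiff_eq_bspline
      (M.openKnot_le_or_ge (deg i) β i (hc i)) m (deg i) (j i)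
    refine ⟨fun x => ∏ i, f i (x i), contDiff_prod fun i _ => (hf i).comp (contDiff_apply ℝ ℝ i),
      fun x hx => Finset.prod_congr rfl fun i _ => hfe i _ (hx i trivial)⟩
  | zero => exact ⟨fun _ => 0, contDiff_const, fun _ _ => rfl⟩
  | add b b' _ _ h h' =>
    obtain ⟨g, hg, hge⟩ := h
    obtain ⟨g', hg', hge'⟩ := h'
    exact ⟨fun x => g x + g' x, hg.add hg', fun x hx => by
      rw [Pi.add_apply, hge x hx, hge' x hx]⟩
  | smul a b _ h =>
    obtain ⟨g, hg, hge⟩ := h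
    exact ⟨fun x => a * g x, contDiff_const.mul hg, fun x hx => by
      rw [Pi.smul_apply, hge x hx, smul_eq_mul]⟩

variable {M} {F : Param n → Phys n} {r : ℕ}

/-- On every cell, a discrete velocity in parametric coordinates extends smoothly to the closed
cell. -/
theorem MemVh.exists_contDiffOn_cell (hF : M.IsGeometryMap F r) {k' α' : ℕ}
    {v : Phys n → Phys n} (hv : M.MemVh F k' α' v) {m : ℕ} (hm : m + 1 ≤ r)
    {c : Fin (n + 1) → ℕ} (hc : M.IsCell c) :
    ∃ V : Param n → Phys n, ContDiffOn ℝ m V (M.closedCell c) ∧ ∀ x ∈ M.cell c, v (F x) = V x := by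
  choose b hb hbe using hv.2
  choose g hg hge using fun l => M.exists_contDiff_eq_of_mem_splineSpace (hb l) hc (m : WithTop ℕ∞)
  -- The inverse Piola transform of the smooth extensions of the spline components. It contains
  -- first derivatives of `F`, whence `m + 1 ≤ r`.
  refine ⟨fun x => WithLp.toLp 2 ((M.jac F x).det⁻¹ • (M.jac F x).mulVec fun l => g l x),
    ?_, fun x hx => ?_⟩
  · rw [contDiffOn_piLp]
    intro i
    have hJ := hF.contDiffOn_jac_cell hc hm
    have hdet : ContDiffOn ℝ m (fun x => (M.jac F x).det) (M.closedCell c) :=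
      contDiffOn_matrix_det hJ
    simp only [Pi.smul_apply, Matrix.mulVec, dotProduct, smul_eq_mul]
    exact (hdet.inv fun x hx => hF.det_ne_zero x (M.closedCell_subset_closedBox hc hx)).mul
      (ContDiffOn.sum fun l _ => (hJ i l).mul (hg l).contDiffOn)
  · have hxB := M.cell_subset_openBox hc hx
    have hu := hF.isUnit_det (M.openBox_subset_closedBox hxB)
    have e : (fun l => g l x) = M.pullback F v x := funext fun l => by
      rw [← hge l x hx, hbe l x hxB]
    beta_reduce
    rw [e, pullback, Matrix.mulVec_smul, smul_smul, inv_mul_cancel₀ hu.ne_zero, one_smul,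
      Matrix.mulVec_mulVec, Matrix.mul_nonsing_inv _ hu, Matrix.one_mulVec]

theorem IsGeometryMap.contDiffOn_dinv_cell (hF : M.IsGeometryMap F r) {m : ℕ} (hm : m + 1 ≤ r)
    {c : Fin (n + 1) → ℕ} (hc : M.IsCell c) (e : Phys n) :
    ContDiffOn ℝ m (fun x => M.dinv F x e) (M.closedCell c) := by
  rw [contDiffOn_pi]
  intro i
  simp only [dinv_apply, Matrix.mulVec, dotProduct]
  exact ContDiffOn.sum fun l _ => (contDiffOn_matrix_inv (hF.contDiffOn_jac_cell hc hm)
    (fun x hx => hF.det_ne_zero x (M.closedCell_subset_closedBox hc hx)) i l).mul contDiffOn_const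

/-- Chain rule for `w = g ∘ F⁻¹` on the image of the cell; the derivative is again the composition
of a function on the closed cell with `F⁻¹`, which allows iteration. -/
theorem IsGeometryMap.hasFDerivAt_of_comp_eq (hF : M.IsGeometryMap F r) {c : Fin (n + 1) → ℕ}
    (hc : M.IsCell c) {w : Phys n → Phys n} {g : Param n → Phys n}
    (hg : DifferentiableOn ℝ g (M.closedCell c)) (hwg : ∀ x ∈ M.cell c, w (F x) = g x)
    {x : Param n} (hx : x ∈ M.cell c) :
    HasFDerivAt w ((fderivWithin ℝ g (M.closedCell c) x).comp (M.dinv F x)) (F x) := by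
  have hxB := M.cell_subset_openBox hc hx
  have hnh : M.closedCell c ∈ 𝓝 x :=
    mem_of_superset ((M.isOpen_cell c).mem_nhds hx) (M.cell_subset_closedCell c)
  have h1 : HasFDerivAt g (fderivWithin ℝ g (M.closedCell c) x) (hF.homeo.symm (F x)) := by
    rw [hF.homeo_symm_apply hxB]
    exact (hg x (M.cell_subset_closedCell c hx)).hasFDerivWithinAt.hasFDerivAt hnh
  refine (h1.comp (F x) (hF.hasFDerivAt_symm hxB)).congr_of_eventuallyEq ?_
  filter_upwards [(hF.isOpen_image (M.isOpen_cell c) (M.cell_subset_openBox hc)).mem_nhds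
    ⟨x, hx, rfl⟩]
  rintro _ ⟨y, hy, rfl⟩
  rw [Function.comp_apply, hF.homeo_symm_apply (M.cell_subset_openBox hc hy), hwg y hy]

theorem IsGeometryMap.continuousOn_of_comp_eq (hF : M.IsGeometryMap F r) {c : Fin (n + 1) → ℕ}
    (hc : M.IsCell c) {w : Phys n → Phys n} {g : Param n → Phys n}
    (hg : ContinuousOn g (M.closedCell c)) (hwg : ∀ x ∈ M.cell c, w (F x) = g x) :
    ContinuousOn w (F '' M.cell c) := by
  have h1 : ContinuousOn (fun z => g (hF.homeo.symm z)) (F '' M.cell c) := by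
    refine hg.comp (hF.homeo.continuousOn_symm.mono ?_) ?_
    · exact Set.image_mono (M.cell_subset_openBox hc)
    · rintro _ ⟨y, hy, rfl⟩
      rw [hF.homeo_symm_apply (M.cell_subset_openBox hc hy)]
      exact M.cell_subset_closedCell c hy
  refine h1.congr ?_
  rintro _ ⟨y, hy, rfl⟩
  simp only [hF.homeo_symm_apply (M.cell_subset_openBox hc hy), hwg y hy]

/-- A field that is `C^k` up to the boundary of a cell in parametric coordinates has weak
derivatives of order `k` that are continuous up to the boundary of the cell. -/
theorem IsGeometryMap.isWeakDeriv_iteratedPartial (hF : M.IsGeometryMap F r)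
    {c : Fin (n + 1) → ℕ} (hc : M.IsCell c) {k : ℕ} (hk : k ≤ r) (I : Fin k → Fin (n + 1))
    {w : Phys n → Phys n} {g : Param n → Phys n} (hg : ContDiffOn ℝ k g (M.closedCell c))
    (hwg : ∀ x ∈ M.cell c, w (F x) = g x) :
    IsWeakDeriv (F '' M.cell c) I w (iteratedPartial k I w) ∧
      ∃ gI : Param n → Phys n, ContinuousOn gI (M.closedCell c) ∧
        ∀ x ∈ M.cell c, iteratedPartial k I w (F x) = gI x := by
  have hU := hF.isOpen_image (M.isOpen_cell c) (M.cell_subset_openBox hc)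
  induction k generalizing w g with
  | zero =>
    exact ⟨isWeakDeriv_zero ((hF.continuousOn_of_comp_eq hc hg.continuousOn
      hwg).locallyIntegrableOn hU.measurableSet), g, hg.continuousOn, hwg⟩
  | succ k ih =>
    set e : Phys n := EuclideanSpace.single (I 0) 1
    -- Parametric form of the partial derivative in the first direction. One order is lost by
    -- differentiating `g`, and `(DF)⁻¹` is as smooth as required because `k + 1 ≤ r`.
    set g' : Param n → Phys n := fun x => fderivWithin ℝ g (M.closedCell c) x (M.dinv F x e)
    have hg' : ContDiffOn ℝ k g' (M.closedCell c) :=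
      (hg.fderivWithin (m := k) (M.uniqueDiffOn_closedCell hc) (by exact_mod_cast le_rfl)).clm_apply
        (hF.contDiffOn_dinv_cell hk hc e)
    have hd : ∀ x ∈ M.cell c, HasLineDerivAt ℝ w (g' x) (F x) e := fun x hx =>
      (hF.hasFDerivAt_of_comp_eq hc (hg.differentiableOn (by simp)) hwg hx).hasLineDerivAt e
    have hw' : ∀ x ∈ M.cell c, lineDeriv ℝ w (F x) e = g' x := fun x hx => (hd x hx).lineDeriv
    obtain ⟨hD, gI, hgI, hDg⟩ := ih (by omega) (Fin.tail I) (w := fun z => lineDeriv ℝ w z e) hg' hw'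
    refine ⟨IsWeakDeriv.of_tail hU (hF.continuousOn_of_comp_eq hc hg.continuousOn hwg)
      (hF.continuousOn_of_comp_eq hc hg'.continuousOn hw') ?_ hD, gI, hgI, hDg⟩
    rintro _ ⟨x, hx, rfl⟩
    rw [hw' x hx]
    exact hd x hx

end ParamMesh

end Splines

end SkeletonStab

namespace SkeletonStab

theorem enorm_sub_sq_le {E : Type*} [NormedAddCommGroup E] (x y z : E) :
    ‖x - z‖ₑ ^ 2 ≤ 2 * (‖y - x‖ₑ ^ 2 + ‖y - z‖ₑ ^ 2) := by
  have h1 : ‖x - z‖ₑ ≤ ‖y - x‖ₑ + ‖y - z‖ₑ := by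
    have : x - z = (y - z) - (y - x) := by abel
    rw [this, add_comm]
    exact enorm_sub_le
  have h2 := ENNReal.rpow_add_le_mul_rpow_add_rpow ‖y - x‖ₑ ‖y - z‖ₑ (p := 2) (by norm_num)
  have e : (2 : ENNReal) ^ ((2 : ℝ) - 1) = 2 := by norm_num
  rw [e] at h2
  simp only [ENNReal.rpow_two] at h2
  exact (pow_le_pow_left' h1 2).trans h2

namespace ParamMesh

variable {n : ℕ}

/-! ### Collars inside the mesh -/

section Collars

theorem ins_mem_pi_iff {i : Fin (n + 1)} {t : ℝ} {y : Fin n → ℝ} {S : Fin (n + 1) → Set ℝ} :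
    ins i t y ∈ Set.univ.pi S ↔ t ∈ S i ∧ ∀ k, y k ∈ S (i.succAbove k) := by
  simp only [Set.mem_univ_pi, Fin.forall_iff_succAbove i, ins, Fin.insertNth_apply_same,
    Fin.insertNth_apply_succAbove]

theorem continuous_ins (i : Fin (n + 1)) : Continuous fun q : ℝ × (Fin n → ℝ) => ins i q.1 q.2 :=
  Continuous.finInsertNth i continuous_fst continuous_snd

variable (M : ParamMesh n)

/-- Collars narrower than this common width stay in the single layer of cells adjacent to a face or
facet. -/
theorem exists_mesh_width : ∃ δ : ℝ, 0 < δ ∧ ∀ i, ∀ j < M.N i, δ ≤ M.ζ i (j + 1) - M.ζ i j := by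
  have hne : ((Finset.univ : Finset (Fin (n + 1))).sigma fun i => Finset.range (M.N i)).Nonempty :=
    ⟨⟨0, 0⟩, by simp [M.N_pos 0]⟩
  obtain ⟨a, ha, hmin⟩ := Finset.exists_min_image _
    (fun q : Σ _ : Fin (n + 1), ℕ => M.ζ q.1 (q.2 + 1) - M.ζ q.1 q.2) hne
  refine ⟨_, sub_pos.2 (M.ζ_lt a.1 a.2 (by simpa using ha)), fun i j hj => ?_⟩
  exact hmin ⟨i, j⟩ (by simpa using hj)

theorem isCell_insertNth {i : Fin (n + 1)} {c : Fin n → ℕ} (hc : c ∈ M.facetIdx i) {j : ℕ}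
    (hj : j < M.N i) : M.IsCell (i.insertNth (α := fun _ => ℕ) j c) := by
  intro k
  revert k
  rw [Fin.forall_iff_succAbove i]
  simp only [Fin.insertNth_apply_same, Fin.insertNth_apply_succAbove]
  exact ⟨hj, fun k => Finset.mem_range.1 (Fintype.mem_piFinset.1 hc k)⟩

theorem ins_mem_cell {i : Fin (n + 1)} {c : Fin n → ℕ} {j : ℕ} {t : ℝ} {y : Fin n → ℝ}
    (ht : t ∈ Set.Ioo (M.ζ i j) (M.ζ i (j + 1))) (hy : y ∈ M.facetDom i c) :
    ins i t y ∈ M.cell (i.insertNth (α := fun _ => ℕ) j c) := by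
  rw [cell, ins_mem_pi_iff]
  simp only [Fin.insertNth_apply_same, Fin.insertNth_apply_succAbove]
  exact ⟨ht, fun k => hy k trivial⟩

theorem ins_mem_closedCell {i : Fin (n + 1)} {c : Fin n → ℕ} {j : ℕ} {t : ℝ} {y : Fin n → ℝ}
    (ht : t ∈ Set.Icc (M.ζ i j) (M.ζ i (j + 1))) (hy : y ∈ M.facetDom i c) :
    ins i t y ∈ M.closedCell (i.insertNth (α := fun _ => ℕ) j c) := by
  rw [closedCell, ins_mem_pi_iff]
  simp only [Fin.insertNth_apply_same, Fin.insertNth_apply_succAbove]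
  exact ⟨ht, fun k => Set.Ioo_subset_Icc_self (hy k trivial)⟩

theorem ins_mem_openBox {i : Fin (n + 1)} {t : ℝ} {y : Fin n → ℝ}
    (ht : t ∈ Set.Ioo (M.ζ i 0) (M.ζ i (M.N i))) (hy : y ∈ M.faceDom i) :
    ins i t y ∈ M.openBox := by
  rw [openBox, ins_mem_pi_iff]
  exact ⟨ht, fun k => hy k trivial⟩

theorem ins_mem_closedBox {i : Fin (n + 1)} {t : ℝ} {y : Fin n → ℝ}
    (ht : t ∈ Set.Icc (M.ζ i 0) (M.ζ i (M.N i))) (hy : y ∈ M.faceDom i) :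
    ins i t y ∈ M.closedBox := by
  rw [closedBox, ins_mem_pi_iff]
  exact ⟨ht, fun k => Set.Ioo_subset_Icc_self (hy k trivial)⟩

theorem facetDom_subset_faceDom {i : Fin (n + 1)} {c : Fin n → ℕ} (hc : c ∈ M.facetIdx i) :
    M.facetDom i c ⊆ M.faceDom i :=
  Set.pi_mono fun k _ => by
    have hk := Finset.mem_range.1 (Fintype.mem_piFinset.1 hc k)
    exact Set.Ioo_subset_Ioo (M.ζ_mono (Nat.zero_le _) hk.le) (M.ζ_mono hk le_rfl)

theorem inward_eq (i : Fin (n + 1)) (s : Bool) (t : ℝ) (y : Fin n → ℝ) :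
    M.inward i s t y = ins i (M.bdryCoord i s + (-sgn s) * t) y := by
  rw [inward, neg_mul, sub_eq_add_neg]

theorem neg_sgn_eq (s : Bool) : -sgn s = 1 ∨ -sgn s = -1 := by
  cases s <;> simp [sgn]

theorem inward_mem_openBox {δ : ℝ} (hδ : ∀ i, ∀ j < M.N i, δ ≤ M.ζ i (j + 1) - M.ζ i j)
    {i : Fin (n + 1)} (s : Bool) {t : ℝ} (ht : t ∈ Set.Ioo 0 δ) {y : Fin n → ℝ}
    (hy : y ∈ M.faceDom i) : M.inward i s t y ∈ M.openBox := by
  refine M.ins_mem_openBox ?_ hy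
  have hN := M.N_pos i
  cases s
  · have h1 := hδ i 0 hN
    have h2 : M.ζ i (0 + 1) ≤ M.ζ i (M.N i) := M.ζ_mono hN le_rfl
    simp only [bdryCoord, sgn, Bool.false_eq_true, if_false]
    constructor <;> linarith [ht.1, ht.2]
  · have h1 := hδ i (M.N i - 1) (by omega)
    have h2 : M.ζ i 0 ≤ M.ζ i (M.N i - 1) := M.ζ_mono (Nat.zero_le _) (by omega)
    rw [Nat.sub_add_cancel hN] at h1
    simp only [bdryCoord, sgn, if_true]
    constructor <;> linarith [ht.1, ht.2]

/-- The layer of cells adjacent to a face. -/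
def bdryLayer (i : Fin (n + 1)) (s : Bool) : ℕ := if s then M.N i - 1 else 0

theorem bdryLayer_lt (i : Fin (n + 1)) (s : Bool) : M.bdryLayer i s < M.N i := by
  have := M.N_pos i
  cases s <;> simp [bdryLayer] <;> omega

theorem inward_mem_cell {δ : ℝ} (hδ : ∀ i, ∀ j < M.N i, δ ≤ M.ζ i (j + 1) - M.ζ i j)
    {i : Fin (n + 1)} (s : Bool) {t : ℝ} (ht : t ∈ Set.Ioo 0 δ) {c : Fin n → ℕ} {y : Fin n → ℝ}
    (hy : y ∈ M.facetDom i c) :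
    M.inward i s t y ∈ M.cell (i.insertNth (α := fun _ => ℕ) (M.bdryLayer i s) c) := by
  refine M.ins_mem_cell ?_ hy
  have h1 := hδ i _ (M.bdryLayer_lt i s)
  have hN := M.N_pos i
  cases s
  · simp only [bdryCoord, sgn, bdryLayer, Bool.false_eq_true, if_false] at h1 ⊢
    constructor <;> linarith [ht.1, ht.2]
  · simp only [bdryCoord, sgn, bdryLayer, if_true, Nat.sub_add_cancel hN] at h1 ⊢
    constructor <;> linarith [ht.1, ht.2]

theorem inward_mem_closedCell {δ : ℝ} (hδ : ∀ i, ∀ j < M.N i, δ ≤ M.ζ i (j + 1) - M.ζ i j)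
    {i : Fin (n + 1)} (s : Bool) {t : ℝ} (ht : t ∈ Set.Icc 0 δ) {c : Fin n → ℕ} {y : Fin n → ℝ}
    (hy : y ∈ M.facetDom i c) :
    M.inward i s t y ∈ M.closedCell (i.insertNth (α := fun _ => ℕ) (M.bdryLayer i s) c) := by
  refine M.ins_mem_closedCell ?_ hy
  have h1 := hδ i _ (M.bdryLayer_lt i s)
  have hN := M.N_pos i
  cases s
  · simp only [bdryCoord, sgn, bdryLayer, Bool.false_eq_true, if_false] at h1 ⊢
    constructor <;> linarith [ht.1, ht.2]
  · simp only [bdryCoord, sgn, bdryLayer, if_true, Nat.sub_add_cancel hN] at h1 ⊢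
    constructor <;> linarith [ht.1, ht.2]

theorem bdryCoord_mem (i : Fin (n + 1)) (s : Bool) :
    M.bdryCoord i s ∈ Set.Icc (M.ζ i 0) (M.ζ i (M.N i)) := by
  have := M.ζ_mono (i := i) (Nat.zero_le (M.N i)) le_rfl
  cases s <;> simp [bdryCoord, this]

theorem inward_zero (i : Fin (n + 1)) (s : Bool) (y : Fin n → ℝ) :
    M.inward i s 0 y = ins i (M.bdryCoord i s) y := by simp [inward]

end Collars

/-! ### Normals and area factors -/

section AreaFactor

variable {M : ParamMesh n} {F : Param n → Phys n} {r : ℕ}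

theorem IsGeometryMap.conormal_ne_zero (hF : M.IsGeometryMap F r) (i : Fin (n + 1)) {x : Param n}
    (hx : x ∈ M.closedBox) : M.conormal F i x ≠ 0 := fun h => by
  have h1 : ∀ j, (M.jac F x)⁻¹ i j = 0 := fun j => congrFun (congrArg WithLp.ofLp h) j
  have h2 := congrFun (congrFun (Matrix.nonsing_inv_mul _ (hF.isUnit_det hx)) i) i
  rw [Matrix.mul_apply, Finset.sum_eq_zero fun j _ => by rw [h1, zero_mul],
    Matrix.one_apply_eq] at h2
  exact zero_ne_one h2

theorem IsGeometryMap.continuousOn_conormal (hF : M.IsGeometryMap F r) (i : Fin (n + 1)) :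
    ContinuousOn (M.conormal F i) M.closedBox :=
  (PiLp.continuous_toLp 2 _).comp_continuousOn
    (continuousOn_pi.2 fun j => hF.continuousOn_jacInv i j)

theorem IsGeometryMap.continuousOn_areaFactor (hF : M.IsGeometryMap F r) (i : Fin (n + 1)) :
    ContinuousOn (M.areaFactor F i) M.closedBox :=
  hF.continuousOn_det.abs.mul (hF.continuousOn_conormal i).norm

theorem IsGeometryMap.areaFactor_pos (hF : M.IsGeometryMap F r) (i : Fin (n + 1)) {x : Param n}
    (hx : x ∈ M.closedBox) : 0 < M.areaFactor F i x :=
  mul_pos (abs_pos.2 (hF.det_ne_zero x hx)) (norm_pos_iff.2 (hF.conormal_ne_zero i hx))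

theorem IsGeometryMap.continuousOn_unitNormal (hF : M.IsGeometryMap F r) (i : Fin (n + 1)) :
    ContinuousOn (M.unitNormal F i) M.closedBox :=
  ((hF.continuousOn_conormal i).norm.inv₀ fun _ hx =>
    (norm_pos_iff.2 (hF.conormal_ne_zero i hx)).ne').smul (hF.continuousOn_conormal i)

theorem norm_unitNormal_le (i : Fin (n + 1)) (x : Param n) : ‖M.unitNormal F i x‖ ≤ 1 := by
  rw [unitNormal, norm_smul, norm_inv, norm_norm]
  exact inv_mul_le_one

/-- Restriction of a continuous function on the closed box to a section `x̂_i = a`. -/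
theorem continuousOn_comp_ins_const {E : Type*} [TopologicalSpace E] {f : Param n → E}
    (hf : ContinuousOn f M.closedBox) {i : Fin (n + 1)} {a : ℝ}
    (ha : a ∈ Set.Icc (M.ζ i 0) (M.ζ i (M.N i))) :
    ContinuousOn (fun y => f (ins i a y)) (M.faceDom i) :=
  hf.comp ((continuous_ins i).comp (continuous_const.prodMk continuous_id)).continuousOn
    fun _ hy => M.ins_mem_closedBox ha hy

end AreaFactor

/-! ### Mean square limits over collars and their uniqueness -/

section CollarLimits

/-- The mean square deviation of `a` from `g` on the collar of width `ε`. -/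
def collarErr {E : Type*} [NormedAddCommGroup E] (S : Set (Fin n → ℝ)) (A : (Fin n → ℝ) → ℝ)
    (a : ℝ → (Fin n → ℝ) → E)
    (g : (Fin n → ℝ) → E) (ε : ℝ) : ENNReal :=
  ENNReal.ofReal ε⁻¹ * ∫⁻ t in Set.Ioo 0 ε, ∫⁻ y in S, ‖a t y - g y‖ₑ ^ 2 * ENNReal.ofReal (A y)

variable {E : Type*} [NormedAddCommGroup E] {S : Set (Fin n → ℝ)} {A : (Fin n → ℝ) → ℝ}

theorem slab_mono {ε ε' : ℝ} (h : ε ≤ ε') : slab ε S ≤ slab ε' S := by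
  rw [slab_eq, slab_eq]
  exact Measure.restrict_mono (Set.prod_mono (Set.Ioo_subset_Ioo le_rfl h) subset_rfl) le_rfl

theorem aemeasurable_collar_integrand {ε : ℝ} {b : ℝ × (Fin n → ℝ) → E}
    (hb : AEStronglyMeasurable b (slab ε S)) (hA : AEMeasurable A (volume.restrict S)) :
    AEMeasurable (fun q => ‖b q‖ₑ ^ 2 * ENNReal.ofReal (A q.2)) (slab ε S) :=
  (hb.enorm.pow_const 2).mul hA.ennreal_ofReal.comp_snd

theorem aestronglyMeasurable_comp_snd_slab {ε : ℝ} {g : (Fin n → ℝ) → E}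
    (hg : AEStronglyMeasurable g (volume.restrict S)) :
    AEStronglyMeasurable (fun q : ℝ × (Fin n → ℝ) => g q.2) (slab ε S) := hg.comp_snd

theorem collarErr_eq {ε : ℝ} {a : ℝ → (Fin n → ℝ) → E} {g : (Fin n → ℝ) → E}
    (ha : AEStronglyMeasurable (fun q : ℝ × (Fin n → ℝ) => a q.1 q.2) (slab ε S))
    (hg : AEStronglyMeasurable g (volume.restrict S)) (hA : AEMeasurable A (volume.restrict S)) :
    collarErr S A a g ε = ENNReal.ofReal ε⁻¹ *
      ∫⁻ q, ‖a q.1 q.2 - g q.2‖ₑ ^ 2 * ENNReal.ofReal (A q.2) ∂(slab ε S) := by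
  rw [collarErr, slab, lintegral_prod]
  exact aemeasurable_collar_integrand (ha.sub (aestronglyMeasurable_comp_snd_slab hg)) hA

theorem collarErr_congr {ε : ℝ} {a a' : ℝ → (Fin n → ℝ) → E} {g : (Fin n → ℝ) → E}
    (h : ∀ᵐ q ∂(slab ε S), a q.1 q.2 = a' q.1 q.2) :
    collarErr S A a g ε = collarErr S A a' g ε := by
  rw [collarErr, collarErr]
  congr 1
  have := Measure.ae_ae_of_ae_prod h
  exact lintegral_congr_ae (this.mono fun t ht => lintegral_congr_ae (ht.mono fun y hy => by
    simp only at hy ⊢; rw [hy]))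

theorem lintegral_slab_snd {ε : ℝ} (hε : 0 < ε) {f : (Fin n → ℝ) → ENNReal}
    (hf : AEMeasurable f (volume.restrict S)) :
    ENNReal.ofReal ε⁻¹ * ∫⁻ q, f q.2 ∂(slab ε S) = ∫⁻ y in S, f y := by
  rw [slab, lintegral_prod _ hf.comp_snd]
  simp only [lintegral_const, Measure.restrict_apply_univ, Real.volume_Ioo, sub_zero]
  rw [mul_comm (∫⁻ y in S, f y), ← mul_assoc, ← ENNReal.ofReal_mul (by positivity),
    inv_mul_cancel₀ hε.ne', ENNReal.ofReal_one, one_mul]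

/-- Mean square limits over collars are unique. -/
theorem ae_eq_of_collarErr_tendsto (hS : MeasurableSet S) {ε₀ : ℝ} (hε₀ : 0 < ε₀)
    {a : ℝ → (Fin n → ℝ) → E} {g g' : (Fin n → ℝ) → E}
    (ha : AEStronglyMeasurable (fun q : ℝ × (Fin n → ℝ) => a q.1 q.2) (slab ε₀ S))
    (hg : AEStronglyMeasurable g (volume.restrict S))
    (hg' : AEStronglyMeasurable g' (volume.restrict S)) (hA : AEMeasurable A (volume.restrict S))
    (hA0 : ∀ y ∈ S, 0 < A y) (h : Tendsto (collarErr S A a g) (𝓝[>] 0) (𝓝 0))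
    (h' : Tendsto (collarErr S A a g') (𝓝[>] 0) (𝓝 0)) :
    ∀ᵐ y ∂(volume.restrict S), g y = g' y := by
  have hm : AEMeasurable (fun y => ‖g y - g' y‖ₑ ^ 2 * ENNReal.ofReal (A y)) (volume.restrict S) :=
    ((hg.sub hg').enorm.pow_const 2).mul hA.ennreal_ofReal
  -- The difference `g - g'` does not depend on the depth, so it equals its own collar mean, and
  -- inserting the value of `a` bounds it by the two deviations.
  have key : ∀ᶠ ε in 𝓝[>] (0 : ℝ), ∫⁻ y in S, ‖g y - g' y‖ₑ ^ 2 * ENNReal.ofReal (A y)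
      ≤ 2 * (collarErr S A a g ε + collarErr S A a g' ε) := by
    filter_upwards [Ioo_mem_nhdsGT hε₀] with ε hε
    have ha' := ha.mono_measure (slab_mono (S := S) hε.2.le)
    have hm1 : AEMeasurable (fun q : ℝ × (Fin n → ℝ) =>
        ‖a q.1 q.2 - g q.2‖ₑ ^ 2 * ENNReal.ofReal (A q.2)) (slab ε S) :=
      aemeasurable_collar_integrand (ha'.sub (aestronglyMeasurable_comp_snd_slab hg)) hA
    rw [collarErr_eq ha' hg hA, collarErr_eq ha' hg' hA, ← mul_add, ← mul_assoc, mul_comm 2,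
      mul_assoc, ← lintegral_add_left' hm1,
      ← lintegral_const_mul' _ _ (by norm_num), ← lintegral_slab_snd hε.1 hm]
    refine mul_le_mul_right (lintegral_mono fun q => ?_) _
    rw [← add_mul, ← mul_assoc]
    exact mul_le_mul_left (enorm_sub_sq_le _ _ _) _
  have h0 : ∫⁻ y in S, ‖g y - g' y‖ₑ ^ 2 * ENNReal.ofReal (A y) = 0 := by
    refine le_antisymm (ge_of_tendsto ?_ key) (zero_le)
    have := ENNReal.Tendsto.const_mul (a := 2) (h.add h') (Or.inr (by norm_num))
    simpa using this
  rw [lintegral_eq_zero_iff' hm] at h0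
  filter_upwards [h0, ae_restrict_mem hS] with y hy hyS
  have := hA0 y hyS
  simpa [this.not_ge, sub_eq_zero] using hy

end CollarLimits

end ParamMesh

end SkeletonStab

namespace SkeletonStab

namespace ParamMesh

variable {n : ℕ} {M : ParamMesh n} {F : Param n → Phys n} {r : ℕ}

/-! ### Fractional regularity forces the jump to vanish -/

section Gagliardo

/-- Balls of the sup norm are cubes. Since each side of the box is at least `ε`, at least one of the
two halves, or an interval of equivalent length, survives in each direction even when the centre is
on the boundary. -/
theorem le_volume_openBox_inter_ball {ε : ℝ} (hε0 : 0 < ε)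
    (hε : ∀ i, ε ≤ M.ζ i (M.N i) - M.ζ i 0) {x : Param n} (hx : x ∈ M.closedBox) :
    ENNReal.ofReal (ε ^ (n + 1)) ≤ volume (M.openBox ∩ Metric.ball x ε) := by
  have e : Set.univ.pi (fun i => Set.Ioo (max (M.ζ i 0) (x i - ε)) (min (M.ζ i (M.N i)) (x i + ε)))
      ⊆ M.openBox ∩ Metric.ball x ε := by
    intro y hy
    refine ⟨fun i _ => ⟨(le_max_left _ _).trans_lt (hy i trivial).1,
      (hy i trivial).2.trans_le (min_le_left _ _)⟩, ?_⟩
    rw [Metric.mem_ball, dist_pi_lt_iff hε0]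
    intro i
    rw [Real.dist_eq, abs_lt]
    have h1 := (le_max_right _ _).trans_lt (hy i trivial).1
    have h2 := (hy i trivial).2.trans_le (min_le_right _ _)
    constructor <;> linarith
  refine le_trans ?_ (measure_mono e)
  rw [Real.volume_pi_Ioo, ← Fin.prod_const (n + 1) ε, ENNReal.ofReal_prod_of_nonneg fun _ _ => hε0.le]
  refine Finset.prod_le_prod' fun i _ => ENNReal.ofReal_le_ofReal ?_
  have := hx i trivial
  have := hε i
  rcases max_cases (M.ζ i 0) (x i - ε) with h | h <;>
    rcases min_cases (M.ζ i (M.N i)) (x i + ε) with h' | h' <;>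
    simp only [Set.mem_Icc] at * <;> linarith [h.1, h'.1]

/-- Finiteness of the Gagliardo seminorm in parametric coordinates. -/
theorem IsGeometryMap.lintegral_gagliardo_ne_top (hF : M.IsGeometryMap F r) {θ : ℝ}
    {g : Phys n → Phys n} (h : gagliardoSq (M.domain F) θ g < ⊤) :
    ∫⁻ x in M.openBox, ∫⁻ z in M.openBox, ‖g (F x) - g (F z)‖ₑ ^ 2
      / ENNReal.ofReal (‖F x - F z‖ ^ (((n + 1 : ℕ) : ℝ) + 2 * θ)) ≠ ⊤ := by
  obtain ⟨c, _, hc, _, hb⟩ := hF.exists_det_bounds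
  have hB := M.isOpen_openBox.measurableSet
  have hcs : ENNReal.ofReal c ≠ 0 := (ENNReal.ofReal_pos.2 hc).ne'
  rw [gagliardoSq, domain, hF.lintegral_image hB subset_rfl] at h
  have hle : ENNReal.ofReal c * (ENNReal.ofReal c *
      ∫⁻ x in M.openBox, ∫⁻ z in M.openBox, ‖g (F x) - g (F z)‖ₑ ^ 2
        / ENNReal.ofReal (‖F x - F z‖ ^ (((n + 1 : ℕ) : ℝ) + 2 * θ))) < ⊤ := by
    refine lt_of_le_of_lt ?_ h
    rw [← lintegral_const_mul' _ _ ENNReal.ofReal_ne_top,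
      ← lintegral_const_mul' _ _ ENNReal.ofReal_ne_top]
    refine setLIntegral_mono' hB fun x hx => mul_le_mul'
      (ENNReal.ofReal_le_ofReal (hb x (M.openBox_subset_closedBox hx)).1) ?_
    rw [hF.lintegral_image hB subset_rfl, ← lintegral_const_mul' _ _ ENNReal.ofReal_ne_top]
    exact setLIntegral_mono' hB fun z hz => mul_le_mul_left
      (ENNReal.ofReal_le_ofReal (hb z (M.openBox_subset_closedBox hz)).1) _
  intro htop
  rw [htop, ENNReal.mul_top hcs, ENNReal.mul_top hcs] at hle
  exact lt_irrefl _ hle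

/-- The measure of a strip around the diagonal of `B × B` tends to zero with its width. -/
theorem tendsto_measure_strip (M : ParamMesh n) :
    Tendsto (fun ε : ℝ => ((volume.restrict M.openBox).prod (volume.restrict M.openBox))
      {p : Param n × Param n | dist p.1 p.2 < 2 * ε}) (𝓝[>] 0) (𝓝 0) := by
  have hfin : volume M.openBox ≠ ⊤ :=
    ((measure_mono M.openBox_subset_closedBox).trans_lt M.isCompact_closedBox.measure_lt_top).ne
  have hm : ∀ ε : ℝ, MeasurableSet {p : Param n × Param n | dist p.1 p.2 < 2 * ε} := fun ε =>
    (isOpen_lt (continuous_fst.dist continuous_snd) continuous_const).measurableSet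
  have hle : ∀ ε ∈ Set.Ioi (0 : ℝ),
      ((volume.restrict M.openBox).prod (volume.restrict M.openBox))
        {p : Param n × Param n | dist p.1 p.2 < 2 * ε}
      ≤ ENNReal.ofReal ((2 * (2 * ε)) ^ (n + 1)) * volume M.openBox := fun ε hε => by
    rw [Measure.prod_apply (hm ε), ← Measure.restrict_apply_univ M.openBox,
      ← lintegral_const]
    refine lintegral_mono fun x => ?_
    refine (Measure.restrict_apply_le _ _).trans ?_
    have : (Prod.mk x ⁻¹' {p : Param n × Param n | dist p.1 p.2 < 2 * ε})
        = Metric.ball x (2 * ε) := by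
      ext z; simp [dist_comm]
    rw [this, Real.volume_pi_ball _ (by have : (0 : ℝ) < ε := hε; positivity), Fintype.card_fin]
  refine tendsto_of_tendsto_of_tendsto_of_le_of_le' tendsto_const_nhds ?_
    (Eventually.of_forall fun _ => zero_le) (eventually_mem_nhdsWithin.mono hle)
  have h1 : Tendsto (fun ε : ℝ => ENNReal.ofReal ((2 * (2 * ε)) ^ (n + 1))) (𝓝[>] 0) (𝓝 0) := by
    have : Tendsto (fun ε : ℝ => (2 * (2 * ε)) ^ (n + 1)) (𝓝 0) (𝓝 ((2 * (2 * 0)) ^ (n + 1))) :=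
      (by fun_prop : Continuous fun ε : ℝ => (2 * (2 * ε)) ^ (n + 1)).tendsto 0
    have := ENNReal.tendsto_ofReal (this.mono_left (nhdsWithin_le_nhds (s := Set.Ioi 0)))
    simpa using this
  simpa using ENNReal.Tendsto.mul_const h1 (Or.inr hfin)

theorem lintegral_comp_ins_le (i : Fin (n + 1)) (a : ℝ) {σ : ℝ} (hσ : σ = 1 ∨ σ = -1) {ε : ℝ}
    {S : Set (Fin n → ℝ)} {B : Set (Param n)}
    (hS : ∀ t ∈ Set.Ioo 0 ε, ∀ y ∈ S, ins i (a + σ * t) y ∈ B) (H : Param n → ENNReal) :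
    ∫⁻ q, H (ins i (a + σ * q.1) q.2) ∂(slab ε S) ≤ ∫⁻ x in B, H x := by
  rw [← (measurableEmbedding_ins i a hσ).lintegral_map]
  exact lintegral_mono' (map_ins_slab_le i a hσ hS) le_rfl

/-- A field with finite Gagliardo seminorm of order `1/2` has no jump, in mean square, across the
image of a hyperplane `x̂_i = a`. -/
theorem IsGeometryMap.tendsto_jump_of_gagliardo (hF : M.IsGeometryMap F r) {g : Phys n → Phys n}
    (hg : MemL2 (M.domain F) g) (hG : gagliardoSq (M.domain F) (1 / 2) g < ⊤)
    {i : Fin (n + 1)} {a : ℝ} (ha : a ∈ Set.Ioo (M.ζ i 0) (M.ζ i (M.N i)))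
    {S : Set (Fin n → ℝ)} (hSm : MeasurableSet S) (hS : S ⊆ M.faceDom i) :
    Tendsto (fun ε : ℝ => ENNReal.ofReal ε⁻¹ * ∫⁻ q,
      ‖g (F (ins i (a + (-1) * q.1) q.2)) - g (F (ins i (a + 1 * q.1) q.2))‖ₑ ^ 2 ∂(slab ε S))
      (𝓝[>] 0) (𝓝 0) := by
  obtain ⟨L, hL⟩ := hF.exists_lipschitz
  obtain ⟨δ, hδ0, hδ⟩ := M.exists_mesh_width
  set μ := (volume : Measure (Param n)).restrict M.openBox with hμ
  have hBm := M.isOpen_openBox.measurableSet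
  set G : Param n → Phys n := fun x => g (F x) with hGdef
  have hGm : AEStronglyMeasurable G μ := by
    obtain ⟨C, hC⟩ := hF.map_volume_le
    exact (hg.1.mono_ac ((Measure.absolutelyContinuous_of_le hC).trans
      (Measure.AbsolutelyContinuous.rfl.smul_left _))).comp_aemeasurable hF.aemeasurable
  set Kd : Param n × Param n → ENNReal := fun p => ‖G p.1 - G p.2‖ₑ ^ 2 with hKd
  set w : Param n × Param n → ENNReal := fun p =>
    ENNReal.ofReal (‖F p.1 - F p.2‖ ^ (((n + 1 : ℕ) : ℝ) + 2 * (1 / 2))) with hw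
  have hKdm : AEMeasurable Kd (μ.prod μ) := (hGm.comp_fst.sub hGm.comp_snd).enorm.pow_const 2
  have hwm : AEMeasurable w (μ.prod μ) :=
    (((hF.aemeasurable.comp_fst).sub (hF.aemeasurable.comp_snd)).norm.pow_const _).ennreal_ofReal
  have hI : ∫⁻ p, Kd p / w p ∂(μ.prod μ) ≠ ⊤ := by
    rw [lintegral_prod (fun p => Kd p / w p) (hKdm.div hwm)]
    exact hF.lintegral_gagliardo_ne_top hG
  -- Strip around the diagonal. The integral of the finite Gagliardo integrand over it tends to zero
  -- by absolute continuity.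
  set T : ℝ → Set (Param n × Param n) := fun ε => {p | dist p.1 p.2 < 2 * ε} with hT
  have hTm : ∀ ε, MeasurableSet (T ε) := fun ε =>
    (isOpen_lt (continuous_fst.dist continuous_snd) continuous_const).measurableSet
  have hlim := tendsto_setLIntegral_zero hI (tendsto_measure_strip M)
  -- The Gagliardo exponent is `d + 2θ = n + 2` for `d = n + 1` and `θ = 1/2`. The weight on the
  -- strip is at most `(2Lε)^(n+2)`; dividing by the volume `ε^(n+1)` of the comparison set and by
  -- the collar width `ε` leaves exactly `C`. The factor `4` comes from two quadratic triangle
  -- inequalities.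
  set C : ℝ := 4 * (2 * L) ^ (n + 2) with hC
  have hlim' : Tendsto (fun ε => ENNReal.ofReal C * ∫⁻ p in T ε, Kd p / w p ∂(μ.prod μ))
      (𝓝[>] 0) (𝓝 0) := by
    simpa using ENNReal.Tendsto.const_mul (a := ENNReal.ofReal C) hlim
      (Or.inr ENNReal.ofReal_ne_top)
  refine tendsto_of_tendsto_of_tendsto_of_le_of_le' tendsto_const_nhds hlim'
    (Eventually.of_forall fun _ => zero_le) ?_
  have hpos : 0 < min δ (min (a - M.ζ i 0) (M.ζ i (M.N i) - a)) :=
    lt_min hδ0 (lt_min (sub_pos.2 ha.1) (sub_pos.2 ha.2))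
  filter_upwards [Ioo_mem_nhdsGT hpos] with ε hε
  have hε0 : 0 < ε := hε.1
  have hε1 : ε < δ := hε.2.trans_le (min_le_left _ _)
  have hε2 : ε < a - M.ζ i 0 := hε.2.trans_le ((min_le_right _ _).trans (min_le_left _ _))
  have hε3 : ε < M.ζ i (M.N i) - a := hε.2.trans_le ((min_le_right _ _).trans (min_le_right _ _))
  have hwide : ∀ i, ε ≤ M.ζ i (M.N i) - M.ζ i 0 := fun i => by
    have h1 := hδ i 0 (M.N_pos i)
    have h2 := M.ζ_mono (i := i) (a := 0 + 1) (M.N_pos i) le_rfl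
    linarith
  have hin : ∀ σ : ℝ, (σ = 1 ∨ σ = -1) → ∀ t ∈ Set.Ioo 0 ε, ∀ y ∈ S,
      ins i (a + σ * t) y ∈ M.openBox := fun σ hσ t ht y hy =>
    M.ins_mem_openBox (by
      rcases hσ with rfl | rfl <;> constructor <;> linarith [ht.1, ht.2]) (hS hy)
  set H : Param n → ENNReal := fun x => ∫⁻ z, (T ε).indicator Kd (x, z) ∂μ with hH
  have hHm : AEMeasurable H μ := (hKdm.indicator (hTm ε)).lintegral_prod_right'
  -- The two values on either side of the hyperplane are compared with the value at every `z` in a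
  -- cube of radius `ε` about the facet point; all these pairs lie in the strip.
  have hpt : ∀ t ∈ Set.Ioo 0 ε, ∀ y ∈ S, ENNReal.ofReal (ε ^ (n + 1)) *
      ‖G (ins i (a + (-1) * t) y) - G (ins i (a + 1 * t) y)‖ₑ ^ 2
      ≤ 2 * (H (ins i (a + (-1) * t) y) + H (ins i (a + 1 * t) y)) := fun t ht y hy => by
    have hx0 : ins i a y ∈ M.closedBox := M.ins_mem_closedBox ⟨ha.1.le, ha.2.le⟩ (hS hy)
    have hvol := le_volume_openBox_inter_ball hε0 hwide hx0
    set Z := M.openBox ∩ Metric.ball (ins i a y) ε with hZ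
    have hZm : MeasurableSet Z := hBm.inter Metric.isOpen_ball.measurableSet
    have hHle : ∀ σ : ℝ, (σ = 1 ∨ σ = -1) →
        ∫⁻ z in Z, ‖G z - G (ins i (a + σ * t) y)‖ₑ ^ 2 ≤ H (ins i (a + σ * t) y) := by
      intro σ hσ
      have h1 : ∀ z ∈ Z, ‖G z - G (ins i (a + σ * t) y)‖ₑ ^ 2
          ≤ (T ε).indicator Kd (ins i (a + σ * t) y, z) := fun z hz => by
        have hd : dist (ins i (a + σ * t) y) (ins i a y) ≤ ε := by
          rw [dist_pi_le_iff hε0.le, Fin.forall_iff_succAbove i]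
          simp only [ins, Fin.insertNth_apply_same, Fin.insertNth_apply_succAbove, dist_self]
          refine ⟨?_, fun _ => hε0.le⟩
          rw [Real.dist_eq, add_sub_cancel_left, abs_le]
          rcases hσ with rfl | rfl <;> constructor <;> linarith [ht.1, ht.2]
        have hmem : (ins i (a + σ * t) y, z) ∈ T ε := by
          have h2 : dist z (ins i a y) < ε := hz.2
          change dist (ins i (a + σ * t) y) z < 2 * ε
          have := dist_triangle_right (ins i (a + σ * t) y) z (ins i a y)
          linarith
        rw [Set.indicator_of_mem hmem]
        simp only [hKd]
        rw [enorm_sub_rev]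
      exact (setLIntegral_mono' hZm h1).trans
        (lintegral_mono' (Measure.restrict_mono Set.inter_subset_left le_rfl) le_rfl)
    calc _ ≤ volume Z * ‖G (ins i (a + (-1) * t) y) - G (ins i (a + 1 * t) y)‖ₑ ^ 2 := by gcongr
      _ = ∫⁻ z in Z, ‖G (ins i (a + (-1) * t) y) - G (ins i (a + 1 * t) y)‖ₑ ^ 2 := by
        rw [lintegral_const, Measure.restrict_apply_univ, mul_comm]
      _ ≤ ∫⁻ z in Z, 2 * (‖G z - G (ins i (a + (-1) * t) y)‖ₑ ^ 2
            + ‖G z - G (ins i (a + 1 * t) y)‖ₑ ^ 2) :=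
        lintegral_mono fun z => enorm_sub_sq_le _ _ _
      _ = 2 * ((∫⁻ z in Z, ‖G z - G (ins i (a + (-1) * t) y)‖ₑ ^ 2)
            + ∫⁻ z in Z, ‖G z - G (ins i (a + 1 * t) y)‖ₑ ^ 2) := by
        rw [lintegral_const_mul' _ _ (by norm_num), lintegral_add_left']
        exact (((hGm.mono_measure (Measure.restrict_mono (Set.inter_subset_left :
          M.openBox ∩ Metric.ball (ins i a y) ε ⊆ _) le_rfl)).sub
          aestronglyMeasurable_const).enorm.pow_const 2)
      _ ≤ _ := by gcongr <;> [exact hHle (-1) (Or.inr rfl); exact hHle 1 (Or.inl rfl)]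
  -- On the strip, the unweighted difference is the Gagliardo integrand times its weight, and the
  -- Lipschitz bound of `F` controls the weight. At a vanishing weight, excluded by cases, the
  -- difference itself vanishes.
  have hHB : ∫⁻ x, H x ∂μ ≤ ENNReal.ofReal ((2 * L * ε) ^ (n + 2)) *
      ∫⁻ p in T ε, Kd p / w p ∂(μ.prod μ) := by
    rw [hH, ← lintegral_prod _ (hKdm.indicator (hTm ε)), lintegral_indicator (hTm ε),
      ← lintegral_const_mul' _ _ ENNReal.ofReal_ne_top]
    have hae : ∀ᵐ p ∂((μ.prod μ).restrict (T ε)),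
        p ∈ T ε ∧ p.1 ∈ M.openBox ∧ p.2 ∈ M.openBox := by
      have h1 : ∀ᵐ p ∂(μ.prod μ), p ∈ M.openBox ×ˢ M.openBox := by
        rw [hμ, Measure.prod_restrict]
        exact ae_restrict_mem (hBm.prod hBm)
      filter_upwards [ae_restrict_mem (hTm ε), ae_restrict_of_ae h1] with p hp hp' using ⟨hp, hp'⟩
    refine lintegral_mono_ae (hae.mono fun p hp => ?_)
    by_cases h0 : F p.1 = F p.2
    · simp [hKd, hGdef, h0]
    have hpos : 0 < ‖F p.1 - F p.2‖ := norm_pos_iff.2 (sub_ne_zero.2 h0)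
    have hw0 : w p ≠ 0 := (ENNReal.ofReal_pos.2 (Real.rpow_pos_of_pos hpos _)).ne'
    have hwle : w p ≤ ENNReal.ofReal ((2 * L * ε) ^ (n + 2)) := by
      refine ENNReal.ofReal_le_ofReal ?_
      have e : ((n + 1 : ℕ) : ℝ) + 2 * (1 / 2) = ((n + 2 : ℕ) : ℝ) := by push_cast; ring
      rw [e, Real.rpow_natCast]
      refine pow_le_pow_left₀ hpos.le ?_ _
      rw [← dist_eq_norm]
      have h1 := hL.dist_le_mul p.1 (M.openBox_subset_closedBox hp.2.1) p.2
        (M.openBox_subset_closedBox hp.2.2)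
      have h2 : dist p.1 p.2 < 2 * ε := hp.1
      nlinarith [L.coe_nonneg]
    calc Kd p = w p * (Kd p / w p) := (ENNReal.mul_div_cancel hw0 ENNReal.ofReal_ne_top).symm
      _ ≤ _ := by gcongr
  set X := ∫⁻ q, ‖G (ins i (a + (-1) * q.1) q.2) - G (ins i (a + 1 * q.1) q.2)‖ₑ ^ 2
    ∂(slab ε S) with hX
  have hslab : ∀ᵐ q ∂(slab ε S), q.1 ∈ Set.Ioo 0 ε ∧ q.2 ∈ S := by
    rw [slab_eq]; exact ae_restrict_mem (measurableSet_Ioo.prod hSm)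
  have hXle : ENNReal.ofReal (ε ^ (n + 1)) * X ≤ 4 * ∫⁻ x, H x ∂μ := by
    rw [hX, ← lintegral_const_mul' _ _ ENNReal.ofReal_ne_top]
    calc _ ≤ ∫⁻ q, 2 * (H (ins i (a + (-1) * q.1) q.2) + H (ins i (a + 1 * q.1) q.2))
          ∂(slab ε S) := lintegral_mono_ae (hslab.mono fun q hq => hpt q.1 hq.1 q.2 hq.2)
      _ = 2 * ((∫⁻ q, H (ins i (a + (-1) * q.1) q.2) ∂(slab ε S))
            + ∫⁻ q, H (ins i (a + 1 * q.1) q.2) ∂(slab ε S)) := by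
        rw [lintegral_const_mul' _ _ (by norm_num), lintegral_add_left']
        exact (hHm.mono_measure (map_ins_slab_le i a (Or.inr rfl)
          (hin (-1) (Or.inr rfl)))).comp_measurable
            (measurePreserving_ins i a (Or.inr rfl)).measurable
      _ ≤ 2 * ((∫⁻ x, H x ∂μ) + ∫⁻ x, H x ∂μ) := by
        gcongr
        · exact lintegral_comp_ins_le i a (Or.inr rfl) (hin (-1) (Or.inr rfl)) H
        · exact lintegral_comp_ins_le i a (Or.inl rfl) (hin 1 (Or.inl rfl)) H
      _ = _ := by rw [← two_mul, ← mul_assoc]; norm_num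
  have hL0 := L.coe_nonneg
  calc ENNReal.ofReal ε⁻¹ * X
      = ENNReal.ofReal (ε⁻¹ * (ε ^ (n + 1))⁻¹) * (ENNReal.ofReal (ε ^ (n + 1)) * X) := by
        rw [← mul_assoc, ← ENNReal.ofReal_mul (by positivity)]
        congr 2
        field_simp
    _ ≤ ENNReal.ofReal (ε⁻¹ * (ε ^ (n + 1))⁻¹) * (4 * (ENNReal.ofReal ((2 * L * ε) ^ (n + 2)) *
          ∫⁻ p in T ε, Kd p / w p ∂(μ.prod μ))) := by
        exact mul_le_mul_right (hXle.trans (mul_le_mul_right hHB _)) _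
    _ = ENNReal.ofReal C * ∫⁻ p in T ε, Kd p / w p ∂(μ.prod μ) := by
        have h4 : (4 : ENNReal) = ENNReal.ofReal 4 := by norm_num
        rw [h4, ← mul_assoc, ← mul_assoc, ← ENNReal.ofReal_mul (by positivity),
          ← ENNReal.ofReal_mul (by positivity)]
        congr 2
        rw [hC, mul_pow (2 * (L : ℝ)) ε]
        field_simp
        ring

end Gagliardo

end ParamMesh

end SkeletonStab

namespace SkeletonStab

namespace ParamMesh

variable {n : ℕ} {M : ParamMesh n} {F : Param n → Phys n} {r : ℕ}

/-! ### Collar limits from uniform convergence, and measurability -/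

section CollarTools

theorem enorm_sq_eq_ofReal {E : Type*} [NormedAddCommGroup E] (x : E) :
    ‖x‖ₑ ^ 2 = ENNReal.ofReal (‖x‖ ^ 2) := by
  rw [ENNReal.ofReal_pow (norm_nonneg x), ofReal_norm]

theorem facetDom_volume_lt_top (M : ParamMesh n) (i : Fin (n + 1)) (c : Fin n → ℕ) :
    volume (M.facetDom i c) < ⊤ :=
  (measure_mono (Set.pi_mono fun _ _ => Set.Ioo_subset_Icc_self)).trans_lt
    (isCompact_univ_pi fun k => isCompact_Icc (a := M.ζ (i.succAbove k) (c k))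
      (b := M.ζ (i.succAbove k) (c k + 1))).measure_lt_top

theorem faceDom_volume_lt_top (M : ParamMesh n) (i : Fin (n + 1)) : volume (M.faceDom i) < ⊤ :=
  (measure_mono (Set.pi_mono fun _ _ => Set.Ioo_subset_Icc_self)).trans_lt
    (isCompact_univ_pi fun k => isCompact_Icc (a := M.ζ (i.succAbove k) 0)
      (b := M.ζ (i.succAbove k) (M.N (i.succAbove k)))).measure_lt_top

theorem tendsto_collarErr_of_uniform {E : Type*} [NormedAddCommGroup E] {S : Set (Fin n → ℝ)}
    (hS : MeasurableSet S) (hSv : volume S < ⊤) {A : (Fin n → ℝ) → ℝ} {A₀ : ℝ}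
    (hA : ∀ y ∈ S, A y ≤ A₀) {a : ℝ → (Fin n → ℝ) → E} {g : (Fin n → ℝ) → E}
    (h : ∀ η > 0, ∃ δ > 0, ∀ᵐ y ∂(volume.restrict S), ∀ t ∈ Set.Ioo 0 δ, ‖a t y - g y‖ ≤ η) :
    Tendsto (collarErr S A a g) (𝓝[>] 0) (𝓝 0) := by
  set K := ENNReal.ofReal A₀ * volume S with hK
  have hKt : K ≠ ⊤ := ENNReal.mul_ne_top ENNReal.ofReal_ne_top hSv.ne
  have key : ∀ η > 0, ∀ᶠ ε in 𝓝[>] (0 : ℝ), collarErr S A a g ε ≤ ENNReal.ofReal (η ^ 2) * K := by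
    intro η hη
    obtain ⟨δ, hδ, hb⟩ := h η hη
    filter_upwards [Ioo_mem_nhdsGT hδ] with ε hε
    have : ∫⁻ t in Set.Ioo 0 ε, ∫⁻ y in S, ‖a t y - g y‖ₑ ^ 2 * ENNReal.ofReal (A y)
        ≤ ∫⁻ t in Set.Ioo 0 ε, ∫⁻ y in S, ENNReal.ofReal (η ^ 2) * ENNReal.ofReal A₀ := by
      refine setLIntegral_mono' measurableSet_Ioo fun t ht => lintegral_mono_ae ?_
      filter_upwards [hb, ae_restrict_mem hS] with y hby hy
      rw [enorm_sq_eq_ofReal]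
      exact mul_le_mul' (ENNReal.ofReal_le_ofReal (pow_le_pow_left₀ (norm_nonneg _)
        (hby t ⟨ht.1, ht.2.trans hε.2⟩) 2)) (ENNReal.ofReal_le_ofReal (hA y hy))
    refine (mul_le_mul_right this _).trans_eq ?_
    simp only [lintegral_const, Measure.restrict_apply_univ, Real.volume_Ioo, sub_zero]
    rw [mul_comm _ (ENNReal.ofReal ε), ← mul_assoc, ← ENNReal.ofReal_mul (inv_nonneg.2 hε.1.le),
      inv_mul_cancel₀ hε.1.ne', ENNReal.ofReal_one, one_mul, hK, mul_assoc]
  rw [ENNReal.tendsto_nhds_zero]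
  intro e he
  obtain ⟨η, hη, hle⟩ : ∃ η > (0 : ℝ), ENNReal.ofReal (η ^ 2) * K ≤ e := by
    have h1 : Tendsto (fun η : ℝ => ENNReal.ofReal (η ^ 2) * K) (𝓝[>] 0) (𝓝 0) := by
      have h2 : Tendsto (fun η : ℝ => η ^ 2) (𝓝[>] 0) (𝓝 (0 ^ 2)) :=
        ((continuous_pow 2).tendsto (0 : ℝ)).mono_left nhdsWithin_le_nhds
      simpa using ENNReal.Tendsto.mul_const (ENNReal.tendsto_ofReal h2) (Or.inr hKt)
    obtain ⟨η, hη1, hη2⟩ := ((ENNReal.tendsto_nhds_zero.1 h1 e he).and self_mem_nhdsWithin).exists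
    exact ⟨η, hη2, hη1⟩
  exact (key η hη).mono fun ε hε => hε.trans hle

theorem IsGeometryMap.exists_areaFactor_le (hF : M.IsGeometryMap F r) :
    ∃ A₀ : ℝ, 0 ≤ A₀ ∧ ∀ i, ∀ x ∈ M.closedBox, M.areaFactor F i x ≤ A₀ := by
  choose C hC using fun i => M.isCompact_closedBox.exists_bound_of_continuousOn
    (hF.continuousOn_areaFactor i)
  refine ⟨∑ i, |C i|, Finset.sum_nonneg fun _ _ => abs_nonneg _, fun i x hx => ?_⟩
  exact ((Real.le_norm_self _).trans (hC i x hx)).trans ((le_abs_self _).trans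
    (Finset.single_le_sum (f := fun i => |C i|) (fun _ _ => abs_nonneg _) (Finset.mem_univ i)))

theorem IsGeometryMap.aemeasurable_areaFactor_ins (hF : M.IsGeometryMap F r) {i : Fin (n + 1)}
    {a : ℝ} (ha : a ∈ Set.Icc (M.ζ i 0) (M.ζ i (M.N i))) {S : Set (Fin n → ℝ)}
    (hSm : MeasurableSet S) (hS : S ⊆ M.faceDom i) :
    AEMeasurable (fun y => M.areaFactor F i (ins i a y)) (volume.restrict S) :=
  ((continuousOn_comp_ins_const (hF.continuousOn_areaFactor i) ha).mono hS).aemeasurable hSm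

theorem IsGeometryMap.ae_domain_of_ae_cells (hF : M.IsGeometryMap F r) {P : Phys n → Prop}
    (h : ∀ c, M.IsCell c → ∀ᵐ z ∂(volume.restrict (F '' M.cell c)), P z) :
    ∀ᵐ z ∂(volume.restrict (M.domain F)), P z := by
  have h1 : ∀ᵐ z ∂(volume.restrict (M.domain F)), ∃ c, M.IsCell c ∧ z ∈ F '' M.cell c :=
    hF.ae_domain_of_ae (M.ae_exists_mem_cell.mono fun x ⟨c, hc, hx⟩ => ⟨c, hc, x, hx, rfl⟩)
  have h2 : ∀ᵐ z : Phys n, ∀ c : Fin (n + 1) → ℕ, M.IsCell c → z ∈ F '' M.cell c → P z :=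
    ae_all_iff.2 fun c => by
      by_cases hc : M.IsCell c
      · have := h c hc
        rw [ae_restrict_iff' (hF.isOpen_image (M.isOpen_cell c)
          (M.cell_subset_openBox hc)).measurableSet] at this
        exact this.mono fun z hz _ => hz
      · exact Eventually.of_forall fun z h' => absurd h' hc
  filter_upwards [h1, ae_restrict_of_ae h2] with z ⟨c, hc, hz⟩ h3 using h3 c hc hz

theorem mem_Ioo_of_mem_Ioo_knots {i : Fin (n + 1)} {j : ℕ} (hj : j ∈ Finset.Ioo 0 (M.N i)) :
    M.ζ i j ∈ Set.Ioo (M.ζ i 0) (M.ζ i (M.N i)) := by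
  rw [Finset.mem_Ioo] at hj
  exact ⟨M.ζ_strictMono hj.1 hj.2.le, M.ζ_strictMono hj.2 le_rfl⟩

end CollarTools

/-! ### Directional derivatives of order `m` -/

section DirDeriv

variable {m : ℕ}

/-- The coefficients are products of components of a vector of norm at most one, hence bounded by
one. -/
theorem norm_dirDeriv_sub_le {ν : Phys n} (hν : ‖ν‖ ≤ 1)
    (D D' : (Fin m → Fin (n + 1)) → Phys n) :
    ‖∑ I, (∏ l, ν (I l)) • D I - ∑ I, (∏ l, ν (I l)) • D' I‖ ≤ ∑ I, ‖D I - D' I‖ := by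
  rw [← Finset.sum_sub_distrib]
  refine (norm_sum_le _ _).trans (Finset.sum_le_sum fun I _ => ?_)
  rw [← smul_sub, norm_smul]
  refine mul_le_of_le_one_left (norm_nonneg _) ?_
  rw [norm_prod]
  exact Finset.prod_le_one (fun _ _ => norm_nonneg _) fun l _ => (PiLp.norm_apply_le ν _).trans hν

theorem IsGeometryMap.aestronglyMeasurable_dirDeriv (hF : M.IsGeometryMap F r)
    {D : (Fin m → Fin (n + 1)) → Phys n → Phys n}
    (hD : ∀ I, AEStronglyMeasurable (D I) (volume.restrict (M.domain F)))
    {i : Fin (n + 1)} {b a σ : ℝ} (hb : b ∈ Set.Icc (M.ζ i 0) (M.ζ i (M.N i)))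
    (hσ : σ = 1 ∨ σ = -1) {ε : ℝ} {S : Set (Fin n → ℝ)} (hSm : MeasurableSet S)
    (hSf : S ⊆ M.faceDom i)
    (hS : ∀ t ∈ Set.Ioo 0 ε, ∀ y ∈ S, ins i (a + σ * t) y ∈ M.openBox) :
    AEStronglyMeasurable (fun q : ℝ × (Fin n → ℝ) =>
      dirDeriv D (M.unitNormal F i (ins i b q.2)) (F (ins i (a + σ * q.1) q.2))) (slab ε S) := by
  simp only [dirDeriv]
  refine Finset.aestronglyMeasurable_fun_sum _ fun I _ => ?_
  refine AEStronglyMeasurable.smul (f := fun q : ℝ × (Fin n → ℝ) =>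
    ∏ l, M.unitNormal F i (ins i b q.2) (I l)) ?_
    (aestronglyMeasurable_comp_ins hF (hD I) i a hσ hS)
  have hc : ContinuousOn (fun y => ∏ l, M.unitNormal F i (ins i b y) (I l)) S :=
    continuousOn_finsetProd _ fun l _ =>
      (EuclideanSpace.proj (𝕜 := ℝ) (I l)).continuous.comp_continuousOn
        ((continuousOn_comp_ins_const (hF.continuousOn_unitNormal i) hb).mono hSf)
  exact aestronglyMeasurable_comp_snd_slab (hc.aestronglyMeasurable hSm)

end DirDeriv

/-! ### Vanishing jumps of the exact solution -/

section JumpOfSolution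

variable {m : ℕ} {u : Phys n → Phys n}

theorem ins_facet_mem_openBox {δ : ℝ} (hδ : ∀ i, ∀ j < M.N i, δ ≤ M.ζ i (j + 1) - M.ζ i j)
    {i : Fin (n + 1)} {j : ℕ} (hj : j ∈ Finset.Ioo 0 (M.N i)) {σ : ℝ} (hσ : σ = 1 ∨ σ = -1)
    {t : ℝ} (ht : t ∈ Set.Ioo 0 δ) {y : Fin n → ℝ} (hy : y ∈ M.faceDom i) :
    ins i (M.ζ i j + σ * t) y ∈ M.openBox := by
  rw [Finset.mem_Ioo] at hj
  refine M.ins_mem_openBox ?_ hy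
  have h1 := hδ i j hj.2
  have h2 := hδ i (j - 1) (by omega)
  rw [Nat.sub_add_cancel hj.1] at h2
  have h3 := M.ζ_mono (i := i) (a := 0) (b := j - 1) (Nat.zero_le _) (by omega)
  have h4 := M.ζ_mono (i := i) (a := j + 1) (b := M.N i) (by omega) le_rfl
  rcases hσ with rfl | rfl <;> constructor <;> linarith [ht.1, ht.2]

/-- The difference of the one-sided values of `∂_n^m` across a facet. -/
def facetDiff (M : ParamMesh n) (F : Param n → Phys n)
    (D : (Fin m → Fin (n + 1)) → Phys n → Phys n) (i : Fin (n + 1)) (a : ℝ) (t : ℝ)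
    (y : Fin n → ℝ) : Phys n :=
  dirDeriv D (M.unitNormal F i (ins i a y)) (F (ins i (a - t) y))
    - dirDeriv D (M.unitNormal F i (ins i a y)) (F (ins i (a + t) y))

theorem IsGeometryMap.aestronglyMeasurable_facetDiff (hF : M.IsGeometryMap F r)
    {D : (Fin m → Fin (n + 1)) → Phys n → Phys n}
    (hD : ∀ I, AEStronglyMeasurable (D I) (volume.restrict (M.domain F)))
    {δ : ℝ} (hδ : ∀ i, ∀ j < M.N i, δ ≤ M.ζ i (j + 1) - M.ζ i j)
    {i : Fin (n + 1)} {j : ℕ} (hj : j ∈ Finset.Ioo 0 (M.N i)) {c : Fin n → ℕ}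
    (hc : c ∈ M.facetIdx i) :
    AEStronglyMeasurable (fun q : ℝ × (Fin n → ℝ) => M.facetDiff F D i (M.ζ i j) q.1 q.2)
      (slab δ (M.facetDom i c)) := by
  have hb := Set.Ioo_subset_Icc_self (mem_Ioo_of_mem_Ioo_knots hj)
  have hSf := M.facetDom_subset_faceDom hc
  have h1 := hF.aestronglyMeasurable_dirDeriv hD hb (Or.inr rfl) (M.measurableSet_facetDom i c) hSf
    (fun t ht y hy => ins_facet_mem_openBox hδ hj (Or.inr rfl) ht (hSf hy))
  have h2 := hF.aestronglyMeasurable_dirDeriv hD hb (Or.inl rfl) (M.measurableSet_facetDom i c) hSf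
    (fun t ht y hy => ins_facet_mem_openBox hδ hj (Or.inl rfl) ht (hSf hy))
  refine (h1.sub h2).congr (Eventually.of_forall fun q => ?_)
  simp [facetDiff, sub_eq_add_neg]

/-- The same normal is used on both sides, so the jump of `∂_n^m` is a combination, with
coefficients at most one, of the jumps of the partial derivatives, and each of these vanishes by the
Gagliardo estimate. -/
theorem IsGeometryMap.tendsto_collarErr_facetDiff (hF : M.IsGeometryMap F r)
    {D : (Fin m → Fin (n + 1)) → Phys n → Phys n} (hD : ∀ I, MemL2 (M.domain F) (D I))
    (hG : ∀ I, gagliardoSq (M.domain F) (1 / 2) (D I) < ⊤) {i : Fin (n + 1)} {j : ℕ}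
    (hj : j ∈ Finset.Ioo 0 (M.N i)) {c : Fin n → ℕ} (hc : c ∈ M.facetIdx i) :
    Tendsto (collarErr (M.facetDom i c) (fun y => M.areaFactor F i (ins i (M.ζ i j) y))
      (M.facetDiff F D i (M.ζ i j)) fun _ => 0) (𝓝[>] 0) (𝓝 0) := by
  obtain ⟨δ, hδ0, hδ⟩ := M.exists_mesh_width
  obtain ⟨A₀, hA0, hA⟩ := hF.exists_areaFactor_le
  have hSm := M.measurableSet_facetDom i c
  have hSf := M.facetDom_subset_faceDom hc
  have ha := mem_Ioo_of_mem_Ioo_knots hj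
  -- Number of partial derivatives of order `m`, the constant in the Cauchy–Schwarz bound for the
  -- square of their sum.
  set K : ℝ := ((Finset.univ : Finset (Fin m → Fin (n + 1))).card : ℝ) with hK
  set J : (Fin m → Fin (n + 1)) → ℝ → ENNReal := fun I ε => ENNReal.ofReal ε⁻¹ * ∫⁻ q,
      ‖D I (F (ins i (M.ζ i j + (-1) * q.1) q.2)) - D I (F (ins i (M.ζ i j + 1 * q.1) q.2))‖ₑ ^ 2
      ∂(slab ε (M.facetDom i c)) with hJ
  have hlim : Tendsto (fun ε => ENNReal.ofReal (K * A₀) * ∑ I, J I ε) (𝓝[>] 0) (𝓝 0) := by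
    have h1 : Tendsto (fun ε => ∑ I, J I ε) (𝓝[>] 0) (𝓝 (∑ _I, 0)) :=
      tendsto_finsetSum _ fun I _ => hF.tendsto_jump_of_gagliardo (hD I) (hG I) ha hSm hSf
    have h2 := ENNReal.Tendsto.const_mul (a := ENNReal.ofReal (K * A₀)) h1
      (Or.inr ENNReal.ofReal_ne_top)
    rwa [Finset.sum_const_zero, mul_zero] at h2
  refine tendsto_of_tendsto_of_tendsto_of_le_of_le' tendsto_const_nhds hlim
    (Eventually.of_forall fun _ => zero_le) ?_
  filter_upwards [Ioo_mem_nhdsGT hδ0] with ε hε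
  have hbox : ∀ σ : ℝ, (σ = 1 ∨ σ = -1) → ∀ t ∈ Set.Ioo 0 ε, ∀ y ∈ M.facetDom i c,
      ins i (M.ζ i j + σ * t) y ∈ M.openBox := fun σ hσ t ht y hy =>
    ins_facet_mem_openBox hδ hj hσ ⟨ht.1, ht.2.trans hε.2⟩ (hSf hy)
  rw [collarErr_eq ((hF.aestronglyMeasurable_facetDiff (fun I => (hD I).1) hδ hj hc).mono_measure
    (slab_mono hε.2.le)) aestronglyMeasurable_const
    (hF.aemeasurable_areaFactor_ins (Set.Ioo_subset_Icc_self ha) hSm hSf)]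
  simp only [hJ]
  rw [← Finset.mul_sum, ← mul_assoc, mul_comm (ENNReal.ofReal (K * A₀)), mul_assoc,
    ← lintegral_finsetSum',
    ← lintegral_const_mul' (ENNReal.ofReal (K * A₀)) _ ENNReal.ofReal_ne_top]
  · refine mul_le_mul_right (lintegral_mono_ae ?_) _
    have hslab : ∀ᵐ q ∂(slab ε (M.facetDom i c)), q.2 ∈ M.facetDom i c := by
      rw [slab_eq]
      exact (ae_restrict_mem (measurableSet_Ioo.prod hSm)).mono fun q hq => hq.2
    filter_upwards [hslab] with q hq
    have hx := M.ins_mem_closedBox (Set.Ioo_subset_Icc_self ha) (hSf hq)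
    simp only [enorm_sq_eq_ofReal]
    rw [← ENNReal.ofReal_mul (by positivity),
      ← ENNReal.ofReal_sum_of_nonneg fun _ _ => by positivity, ← ENNReal.ofReal_mul (by positivity)]
    refine ENNReal.ofReal_le_ofReal ?_
    have h1 := norm_dirDeriv_sub_le (m := m) 
      (norm_unitNormal_le (M := M) (F := F) i (ins i (M.ζ i j) q.2))
      (fun I => D I (F (ins i (M.ζ i j + (-1) * q.1) q.2)))
      (fun I => D I (F (ins i (M.ζ i j + 1 * q.1) q.2)))
    have h2 := sq_sum_le_card_mul_sum_sq (s := (Finset.univ : Finset (Fin m → Fin (n + 1))))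
      (f := fun I => ‖D I (F (ins i (M.ζ i j + (-1) * q.1) q.2))
        - D I (F (ins i (M.ζ i j + 1 * q.1) q.2))‖)
    have e : ‖M.facetDiff F D i (M.ζ i j) q.1 q.2 - 0‖ ≤ ∑ I,
        ‖D I (F (ins i (M.ζ i j + (-1) * q.1) q.2))
        - D I (F (ins i (M.ζ i j + 1 * q.1) q.2))‖ := by
      refine le_trans (le_of_eq ?_) h1
      simp [facetDiff, dirDeriv, sub_eq_add_neg]
    have h3 := (pow_le_pow_left₀ (norm_nonneg _) e 2).trans h2
    have h4 := hA i _ hx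
    have h5 := (hF.areaFactor_pos i hx).le
    calc _ ≤ (K * ∑ I, ‖D I (F (ins i (M.ζ i j + (-1) * q.1) q.2))
        - D I (F (ins i (M.ζ i j + 1 * q.1) q.2))‖ ^ 2) * A₀ :=
          mul_le_mul h3 h4 h5 (by positivity)
      _ = _ := by ring
  · intro I _
    exact ((aestronglyMeasurable_comp_ins hF (hD I).1 i _ (Or.inr rfl) (hbox _ (Or.inr rfl))).sub
      (aestronglyMeasurable_comp_ins hF (hD I).1 i _ (Or.inl rfl)
        (hbox _ (Or.inl rfl)))).enorm.pow_const 2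

theorem IsGeometryMap.isBrokenDeriv_of_isWeakDeriv (hF : M.IsGeometryMap F r)
    {D : (Fin m → Fin (n + 1)) → Phys n → Phys n}
    (hD : ∀ I, IsWeakDeriv (M.domain F) I u (D I)) : M.IsBrokenDeriv F u D := fun c hc I =>
  (hD I).mono (hF.isOpen_image (M.isOpen_cell c) (M.cell_subset_openBox hc)).measurableSet
    hF.isOpen_domain.measurableSet (Set.image_mono (M.cell_subset_openBox hc))

/-- A field in `H^{m+1/2}(Ω)` has vanishing jumps `⟦∂_n^m u⟧`. -/
theorem IsGeometryMap.isNormalJump_zero (hF : M.IsGeometryMap F r)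
    (hu : MemHFrac (M.domain F) m (1 / 2) u) : M.IsNormalJump F m u 0 := by
  choose D hD hD2 hDG using hu m le_rfl
  refine ⟨D, hF.isBrokenDeriv_of_isWeakDeriv hD, fun i j hj c hc => ⟨MemLp.zero, ?_⟩⟩
  exact hF.tendsto_collarErr_facetDiff hD2 (fun I => hDG I rfl) hj hc

/-- Every jump `⟦∂_n^m u⟧` of a field in `H^{m+1/2}(Ω)` vanishes almost everywhere. -/
theorem IsNormalJump.ae_eq_zero (hF : M.IsGeometryMap F r)
    (hu : MemHFrac (M.domain F) m (1 / 2) u) {w : Phys n → Phys n} (hw : M.IsNormalJump F m u w)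
    {i : Fin (n + 1)} {j : ℕ} (hj : j ∈ Finset.Ioo 0 (M.N i)) {c : Fin n → ℕ}
    (hc : c ∈ M.facetIdx i) :
    ∀ᵐ y ∂(volume.restrict (M.facetDom i c)), w (F (ins i (M.ζ i j) y)) = 0 := by
  choose D hD hD2 hDG using hu m le_rfl
  obtain ⟨D', hD', hw'⟩ := hw
  obtain ⟨δ, hδ0, hδ⟩ := M.exists_mesh_width
  obtain ⟨hwL, hwt⟩ := hw' i j hj c hc
  have hSf := M.facetDom_subset_faceDom hc
  -- The elementwise derivatives underlying `w` agree almost everywhere with the global weak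
  -- derivatives, so both families give the same collar means and uniqueness of the limit applies.
  have hDD : ∀ᵐ z ∂(volume.restrict (M.domain F)), ∀ I, D I z = D' I z :=
    ae_all_iff.2 fun I => hF.ae_domain_of_ae_cells fun c hc =>
      (hF.isBrokenDeriv_of_isWeakDeriv hD c hc I).ae_eq
        (hF.isOpen_image (M.isOpen_cell c) (M.cell_subset_openBox hc)) (hD' c hc I)
  have hae : ∀ ε < δ, ∀ᵐ q ∂(slab ε (M.facetDom i c)),
      M.facetDiff F D' i (M.ζ i j) q.1 q.2 = M.facetDiff F D i (M.ζ i j) q.1 q.2 := by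
    intro ε hε
    have hbox : ∀ σ : ℝ, (σ = 1 ∨ σ = -1) → ∀ t ∈ Set.Ioo 0 ε, ∀ y ∈ M.facetDom i c,
        ins i (M.ζ i j + σ * t) y ∈ M.openBox := fun σ hσ t ht y hy =>
      ins_facet_mem_openBox hδ hj hσ ⟨ht.1, ht.2.trans hε⟩ (hSf hy)
    filter_upwards [ae_comp_ins hF hDD i _ (Or.inr rfl) (hbox _ (Or.inr rfl)),
      ae_comp_ins hF hDD i _ (Or.inl rfl) (hbox _ (Or.inl rfl))] with q h1 h2
    rw [neg_one_mul, ← sub_eq_add_neg] at h1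
    rw [one_mul] at h2
    simp only [facetDiff, dirDeriv, h1, h2]
  have hwt' : Tendsto (collarErr (M.facetDom i c) (fun y => M.areaFactor F i (ins i (M.ζ i j) y))
      (M.facetDiff F D i (M.ζ i j)) fun y => w (F (ins i (M.ζ i j) y))) (𝓝[>] 0) (𝓝 0) := by
    refine hwt.congr' ?_
    filter_upwards [Ioo_mem_nhdsGT hδ0] with ε hε
    exact collarErr_congr (hae ε hε.2)
  have ha := mem_Ioo_of_mem_Ioo_knots hj
  exact ae_eq_of_collarErr_tendsto (M.measurableSet_facetDom i c) hδ0
    (hF.aestronglyMeasurable_facetDiff (fun I => (hD2 I).1) hδ hj hc) hwL.1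
    aestronglyMeasurable_const
    (hF.aemeasurable_areaFactor_ins (Set.Ioo_subset_Icc_self ha) (M.measurableSet_facetDom i c) hSf)
    (fun y hy => hF.areaFactor_pos i (M.ins_mem_closedBox (Set.Ioo_subset_Icc_self ha) (hSf hy)))
    hwt' (hF.tendsto_collarErr_facetDiff hD2 (fun I => hDG I rfl) hj hc)

/-- Each integrand vanishes almost everywhere, so nothing about `η` or `w'`, not even measurability,
is needed. -/
theorem skeletonInner_eq_zero (hF : M.IsGeometryMap F r)
    (hu : MemHFrac (M.domain F) m (1 / 2) u) {w : Phys n → Phys n} (hw : M.IsNormalJump F m u w)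
    (η : Phys n → ℝ) (w' : Phys n → Phys n) : M.skeletonInner F η w w' = 0 := by
  refine Finset.sum_eq_zero fun i _ => Finset.sum_eq_zero fun j hj =>
    Finset.sum_eq_zero fun c hc => integral_eq_zero_of_ae ?_
  filter_upwards [hw.ae_eq_zero hF hu hj hc] with y hy
  simp [hy]

end JumpOfSolution

end ParamMesh

end SkeletonStab

namespace SkeletonStab

namespace ParamMesh

variable {n : ℕ} {M : ParamMesh n} {F : Param n → Phys n} {r : ℕ}

/-! ### Existence of jumps for cellwise smooth fields -/

section JumpOfSpline

variable {m : ℕ}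

theorem dist_ins_ins (i : Fin (n + 1)) (a b : ℝ) (y : Fin n → ℝ) :
    dist (ins i a y) (ins i b y) = dist a b := by
  refine le_antisymm ?_ ?_
  · rw [dist_pi_le_iff dist_nonneg, Fin.forall_iff_succAbove i]
    simp [ins]
  · simpa only [ins, Fin.insertNth_apply_same] using dist_le_pi_dist (ins i a y) (ins i b y) i

theorem ne_knot_of_mem_facetDom {i : Fin (n + 1)} {c : Fin n → ℕ} (hc : c ∈ M.facetIdx i)
    {y : Fin n → ℝ} (hy : y ∈ M.facetDom i c) (k : Fin n) {j : ℕ}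
    (hj : j ≤ M.N (i.succAbove k)) : y k ≠ M.ζ (i.succAbove k) j := fun h => by
  have hck := Finset.mem_range.1 (Fintype.mem_piFinset.1 hc k)
  have := hy k trivial
  rw [h] at this
  rcases le_or_gt j (c k) with h' | h'
  · exact absurd this.1 (not_lt.2 (M.ζ_mono h' hck.le))
  · exact absurd this.2 (not_lt.2 (M.ζ_mono h' hj))

/-- The one-sided differences across all interior facets, as a function of the physical point. -/
def facetJump (M : ParamMesh n) (F : Param n → Phys n)
    (D : (Fin m → Fin (n + 1)) → Phys n → Phys n) (z : Phys n) : Phys n :=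
  open Classical in
  ∑ i, if ∃ j ∈ Finset.Ioo 0 (M.N i), Function.invFunOn F M.closedBox z i = M.ζ i j then
    limUnder (𝓝[>] (0 : ℝ)) fun t => M.facetDiff F D i (Function.invFunOn F M.closedBox z i) t
      fun k => Function.invFunOn F M.closedBox z (i.succAbove k)
  else 0

/-- A point in the relative interior of a facet has a knot coordinate only in direction `i`, so a
single term of the sum survives. Injectivity of `F` makes the jump a function of the physical point.
-/
theorem IsGeometryMap.facetJump_eq (hF : M.IsGeometryMap F r)
    {D : (Fin m → Fin (n + 1)) → Phys n → Phys n} {i : Fin (n + 1)} {j : ℕ}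
    (hj : j ∈ Finset.Ioo 0 (M.N i)) {c : Fin n → ℕ} (hc : c ∈ M.facetIdx i) {y : Fin n → ℝ}
    (hy : y ∈ M.facetDom i c) {L : Phys n}
    (hL : Tendsto (fun t => M.facetDiff F D i (M.ζ i j) t y) (𝓝[>] 0) (𝓝 L)) :
    M.facetJump F D (F (ins i (M.ζ i j) y)) = L := by
  have ha := Set.Ioo_subset_Icc_self (mem_Ioo_of_mem_Ioo_knots hj)
  have hx : Function.invFunOn F M.closedBox (F (ins i (M.ζ i j) y)) = ins i (M.ζ i j) y :=
    hF.injOn.leftInvOn_invFunOn (M.ins_mem_closedBox ha (M.facetDom_subset_faceDom hc hy))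
  rw [facetJump, Finset.sum_eq_single i, hx, if_pos]
  · simp only [ins, Fin.insertNth_apply_same, Fin.insertNth_apply_succAbove]
    exact hL.limUnder_eq
  · exact ⟨j, hj, by simp [ins]⟩
  · intro i' _ hi'
    obtain ⟨k, rfl⟩ := Fin.exists_succAbove_eq hi'
    rw [hx, if_neg]
    rintro ⟨j', hj', h⟩
    rw [ins, Fin.insertNth_apply_succAbove] at h
    exact ne_knot_of_mem_facetDom hc hy k (Finset.mem_Ioo.1 hj').2.le h
  · simp

/-- Fields that are `C^m` up to the boundary of each cell, in parametric coordinates, have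
jumps `⟦∂_n^m v⟧`. -/
theorem IsGeometryMap.exists_isNormalJump (hF : M.IsGeometryMap F r) (hm : m ≤ r)
    {v : Phys n → Phys n} (hV : ∀ c, M.IsCell c → ∃ V : Param n → Phys n,
      ContDiffOn ℝ m V (M.closedCell c) ∧ ∀ x ∈ M.cell c, v (F x) = V x) :
    ∃ w, M.IsNormalJump F m v w := by
  set D : (Fin m → Fin (n + 1)) → Phys n → Phys n := fun I => iteratedPartial m I v with hD
  have hbr : M.IsBrokenDeriv F v D := fun c hc I => by
    obtain ⟨V, hV1, hV2⟩ := hV c hc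
    exact (hF.isWeakDeriv_iteratedPartial hc hm I hV1 hV2).1
  -- The extension is requested for all multi-indices, with zero as default off the mesh, so that
  -- one choice function serves both neighbours of a facet.
  have hex : ∀ c, ∀ I : Fin m → Fin (n + 1), ∃ g : Param n → Phys n, M.IsCell c →
      ContinuousOn g (M.closedCell c) ∧ ∀ x ∈ M.cell c, D I (F x) = g x := fun c I => by
    by_cases hc : M.IsCell c
    · obtain ⟨V, hV1, hV2⟩ := hV c hc
      obtain ⟨g, hg⟩ := (hF.isWeakDeriv_iteratedPartial hc hm I hV1 hV2).2
      exact ⟨g, fun _ => hg⟩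
    · exact ⟨0, fun h => absurd h hc⟩
  choose G hG using hex
  refine ⟨M.facetJump F D, D, hbr, fun i j hj c hc => ?_⟩
  obtain ⟨A₀, -, hA⟩ := hF.exists_areaFactor_le
  obtain ⟨δ, hδ0, hδ⟩ := M.exists_mesh_width
  have hj' := Finset.mem_Ioo.1 hj
  have ha := Set.Ioo_subset_Icc_self (mem_Ioo_of_mem_Ioo_knots hj)
  have hSf := M.facetDom_subset_faceDom hc
  have hSm := M.measurableSet_facetDom i c
  have hSv := facetDom_volume_lt_top M i c
  have hδ1 := hδ i j hj'.2
  have hδ2 := hδ i (j - 1) (by omega)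
  rw [Nat.sub_add_cancel hj'.1] at hδ2
  set cm : Fin (n + 1) → ℕ := i.insertNth (α := fun _ => ℕ) (j - 1) c
  set cp : Fin (n + 1) → ℕ := i.insertNth (α := fun _ => ℕ) j c
  have hcm : M.IsCell cm := M.isCell_insertNth hc (by omega)
  have hcp : M.IsCell cp := M.isCell_insertNth hc hj'.2
  have memm : ∀ t ∈ Set.Icc 0 δ, ∀ y ∈ M.facetDom i c, ins i (M.ζ i j - t) y ∈ M.closedCell cm :=
    fun t ht y hy => M.ins_mem_closedCell (by
      rw [Nat.sub_add_cancel hj'.1]; constructor <;> linarith [ht.1, ht.2]) hy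
  have memm' : ∀ t ∈ Set.Ioo 0 δ, ∀ y ∈ M.facetDom i c, ins i (M.ζ i j - t) y ∈ M.cell cm :=
    fun t ht y hy => M.ins_mem_cell (by
      rw [Nat.sub_add_cancel hj'.1]; constructor <;> linarith [ht.1, ht.2]) hy
  have memp : ∀ t ∈ Set.Icc 0 δ, ∀ y ∈ M.facetDom i c, ins i (M.ζ i j + t) y ∈ M.closedCell cp :=
    fun t ht y hy => M.ins_mem_closedCell (by constructor <;> linarith [ht.1, ht.2]) hy
  have memp' : ∀ t ∈ Set.Ioo 0 δ, ∀ y ∈ M.facetDom i c, ins i (M.ζ i j + t) y ∈ M.cell cp :=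
    fun t ht y hy => M.ins_mem_cell (by constructor <;> linarith [ht.1, ht.2]) hy
  set ν : (Fin n → ℝ) → Phys n := fun y => M.unitNormal F i (ins i (M.ζ i j) y) with hν
  set P : ℝ → (Fin n → ℝ) → Phys n := fun t y =>
    ∑ I, (∏ l, ν y (I l)) • G cm I (ins i (M.ζ i j - t) y) with hP
  set Q : ℝ → (Fin n → ℝ) → Phys n := fun t y =>
    ∑ I, (∏ l, ν y (I l)) • G cp I (ins i (M.ζ i j + t) y) with hQ
  -- The jump: difference of the boundary values of the continuous extensions from the lower and the
  -- upper cell.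
  set L : (Fin n → ℝ) → Phys n := fun y => P 0 y - Q 0 y with hLdef
  have hdiff : ∀ t ∈ Set.Ioo 0 δ, ∀ y ∈ M.facetDom i c,
      M.facetDiff F D i (M.ζ i j) t y = P t y - Q t y := fun t ht y hy => by
    simp only [facetDiff, dirDeriv, hP, hQ]
    congr 1
    · exact Finset.sum_congr rfl fun I _ => by rw [(hG cm I hcm).2 _ (memm' t ht y hy)]
    · exact Finset.sum_congr rfl fun I _ => by rw [(hG cp I hcp).2 _ (memp' t ht y hy)]
  have hunif : ∀ η > 0, ∃ δ' > 0, ∀ t ∈ Set.Ioo 0 δ', ∀ y ∈ M.facetDom i c,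
      ‖M.facetDiff F D i (M.ζ i j) t y - L y‖ ≤ η := by
    intro η hη
    set K : ℝ := ((Finset.univ : Finset (Fin m → Fin (n + 1))).card : ℝ) with hK
    have hK0 : 0 ≤ K := Nat.cast_nonneg _
    -- Each side contributes at most `K * e`; the added one avoids division by zero and keeps `2 * K
    -- * e ≤ η`.
    set e := η / (2 * K + 1) with he
    have he0 : 0 < e := by positivity
    have hu : ∀ c', M.IsCell c' → ∀ I, ∃ δ' > 0, ∀ x ∈ M.closedCell c', ∀ x' ∈ M.closedCell c',
        dist x x' < δ' → ‖G c' I x - G c' I x'‖ < e := fun c' hc' I => by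
      have := (M.isCompact_closedCell c').uniformContinuousOn_of_continuous (hG c' I hc').1
      obtain ⟨δ', h1, h2⟩ := Metric.uniformContinuousOn_iff.1 this e he0
      exact ⟨δ', h1, fun x hx x' hx' hd => by rw [← dist_eq_norm]; exact h2 x hx x' hx' hd⟩
    choose δm hδm hm' using hu cm hcm
    choose δp hδp hp' using hu cp hcp
    obtain ⟨d, hd0, hdm, hdp, hdδ⟩ : ∃ d > 0, (∀ I, d ≤ δm I) ∧ (∀ I, d ≤ δp I) ∧ d ≤ δ := by
      have hne : (Finset.univ : Finset (Option (Fin m → Fin (n + 1)))).Nonempty := ⟨none, by simp⟩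
      -- One minimum over a nonempty finite type: `none` carries the mesh width, the other values
      -- the moduli of continuity on both sides.
      set f : Option (Fin m → Fin (n + 1)) → ℝ := fun o =>
        o.elim δ fun I => min (δm I) (δp I) with hf
      have hf0 : ∀ o, 0 < f o := fun o => by
        cases o with
        | none => exact hδ0
        | some I => exact lt_min (hδm I) (hδp I)
      obtain ⟨o, -, ho⟩ := Finset.exists_min_image _ f hne
      exact ⟨f o, hf0 o, fun I => (ho (some I) (by simp)).trans (min_le_left _ _),
        fun I => (ho (some I) (by simp)).trans (min_le_right _ _), ho none (by simp)⟩
    refine ⟨d, hd0, fun t ht y hy => ?_⟩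
    have ht' : t ∈ Set.Ioo 0 δ := ⟨ht.1, ht.2.trans_le hdδ⟩
    have ht'' : t ∈ Set.Icc 0 δ := Set.Ioo_subset_Icc_self ht'
    have h0 : (0 : ℝ) ∈ Set.Icc 0 δ := ⟨le_rfl, hδ0.le⟩
    have hnν : ‖ν y‖ ≤ 1 := norm_unitNormal_le i _
    have b1 : ‖P t y - P 0 y‖ ≤ K * e := by
      refine (norm_dirDeriv_sub_le hnν _ _).trans ((Finset.sum_le_card_nsmul _ _ e
        fun I _ => ?_).trans_eq (nsmul_eq_mul _ _))
      refine (hm' I _ (memm t ht'' y hy) _ (memm 0 h0 y hy) ?_).le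
      rw [dist_ins_ins, Real.dist_eq, sub_zero, sub_sub_cancel_left, abs_neg, abs_of_pos ht.1]
      exact ht.2.trans_le (hdm I)
    have b2 : ‖Q t y - Q 0 y‖ ≤ K * e := by
      refine (norm_dirDeriv_sub_le hnν _ _).trans ((Finset.sum_le_card_nsmul _ _ e
        fun I _ => ?_).trans_eq (nsmul_eq_mul _ _))
      refine (hp' I _ (memp t ht'' y hy) _ (memp 0 h0 y hy) ?_).le
      rw [dist_ins_ins, Real.dist_eq, add_zero, add_sub_cancel_left, abs_of_pos ht.1]
      exact ht.2.trans_le (hdp I)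
    rw [hdiff t ht' y hy]
    have e1 : P t y - Q t y - L y = (P t y - P 0 y) - (Q t y - Q 0 y) := by
      simp only [hLdef]; abel
    rw [e1]
    have h2 : 2 * K * e ≤ η := by
      rw [he, mul_div_assoc', div_le_iff₀ (by positivity)]; nlinarith
    exact (norm_sub_le _ _).trans (by linarith)
  have hval : ∀ y ∈ M.facetDom i c, M.facetJump F D (F (ins i (M.ζ i j) y)) = L y := by
    intro y hy
    refine hF.facetJump_eq hj hc hy (Metric.tendsto_nhds.2 fun η hη => ?_)
    obtain ⟨d, hd0, hd⟩ := hunif (η / 2) (half_pos hη)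
    filter_upwards [Ioo_mem_nhdsGT hd0] with t ht
    rw [dist_eq_norm]
    exact (hd t ht y hy).trans_lt (half_lt_self hη)
  have hLc : ContinuousOn L (M.facetDom i c) := by
    have hνc : ∀ I : Fin m → Fin (n + 1), ContinuousOn (fun y => ∏ l, ν y (I l))
        (M.facetDom i c) := fun I => continuousOn_finsetProd _ fun l _ =>
      (EuclideanSpace.proj (𝕜 := ℝ) (I l)).continuous.comp_continuousOn
        ((continuousOn_comp_ins_const (hF.continuousOn_unitNormal i) ha).mono hSf)
    have hins : ∀ b : ℝ, Continuous fun y : Fin n → ℝ => ins i b y := fun b =>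
      (continuous_ins i).comp (continuous_const.prodMk continuous_id)
    have h0 : (0 : ℝ) ∈ Set.Icc 0 δ := ⟨le_rfl, hδ0.le⟩
    refine ContinuousOn.sub (continuousOn_finsetSum _ fun I _ => (hνc I).smul ?_)
      (continuousOn_finsetSum _ fun I _ => (hνc I).smul ?_)
    · exact (hG cm I hcm).1.comp (hins _).continuousOn fun y hy => memm 0 h0 y hy
    · exact (hG cp I hcp).1.comp (hins _).continuousOn fun y hy => memp 0 h0 y hy
  refine ⟨?_, ?_⟩
  · have hLb : ∃ C, ∀ y ∈ M.facetDom i c, ‖L y‖ ≤ C := by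
      choose Cm hCm using fun I =>
        (M.isCompact_closedCell cm).exists_bound_of_continuousOn (hG cm I hcm).1
      choose Cp hCp using fun I =>
        (M.isCompact_closedCell cp).exists_bound_of_continuousOn (hG cp I hcp).1
      refine ⟨∑ I, Cm I + ∑ I, Cp I, fun y hy => ?_⟩
      have h0 : (0 : ℝ) ∈ Set.Icc 0 δ := ⟨le_rfl, hδ0.le⟩
      have hnν : ‖ν y‖ ≤ 1 := norm_unitNormal_le i _
      have b1 := norm_dirDeriv_sub_le hnν (fun I => G cm I (ins i (M.ζ i j - 0) y)) 0
      have b2 := norm_dirDeriv_sub_le hnν (fun I => G cp I (ins i (M.ζ i j + 0) y)) 0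
      simp only [Pi.zero_apply, smul_zero, Finset.sum_const_zero, sub_zero] at b1 b2
      refine (norm_sub_le _ _).trans (add_le_add ?_ ?_)
      · simp only [hP, sub_zero]
        exact b1.trans (Finset.sum_le_sum fun I _ => hCm I _ (by simpa using memm 0 h0 y hy))
      · simp only [hQ]
        exact b2.trans (Finset.sum_le_sum fun I _ => hCp I _ (memp 0 h0 y hy))
    obtain ⟨C, hC⟩ := hLb
    have : IsFiniteMeasure (volume.restrict (M.facetDom i c)) :=
      ⟨by rwa [Measure.restrict_apply_univ]⟩
    refine (memLp_congr_ae ?_).1 (MemLp.of_bound (hLc.aestronglyMeasurable hSm) C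
      ((ae_restrict_mem hSm).mono hC))
    filter_upwards [ae_restrict_mem hSm] with y hy using (hval y hy).symm
  · refine tendsto_collarErr_of_uniform hSm hSv (A₀ := A₀)
      (fun y hy => hA i _ (M.ins_mem_closedBox ha (hSf hy))) (a := M.facetDiff F D i (M.ζ i j))
      (g := fun y => M.facetJump F D (F (ins i (M.ζ i j) y))) fun η hη => ?_
    obtain ⟨d, hd0, hd⟩ := hunif η hη
    exact ⟨d, hd0, (ae_restrict_mem hSm).mono fun y hy t ht => by
      rw [hval y hy]; exact hd t ht y hy⟩

end JumpOfSpline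

end ParamMesh

end SkeletonStab

namespace SkeletonStab

namespace ParamMesh

variable {n : ℕ} {M : ParamMesh n} {F : Param n → Phys n} {r : ℕ}

/-! ### Linear rates in boundary collars -/

section CollarBounds

/-- The mesh has finitely many cells, and the sum of the moduli of their constants dominates each of
them. -/
theorem exists_forall_isCell (M : ParamMesh n) {P : (Fin (n + 1) → ℕ) → ℝ → Prop}
    (hmono : ∀ c K K', K ≤ K' → P c K → P c K') (h : ∀ c, M.IsCell c → ∃ K, P c K) :
    ∃ K, 0 ≤ K ∧ ∀ c, M.IsCell c → P c K := by
  choose K hK using h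
  classical
  set K' : (Fin (n + 1) → ℕ) → ℝ := fun c => if hc : M.IsCell c then |K c hc| else 0 with hK'
  have h0 : ∀ c, 0 ≤ K' c := fun c => by simp only [hK']; split_ifs <;> simp
  refine ⟨∑ c ∈ Fintype.piFinset fun i => Finset.range (M.N i), K' c,
    Finset.sum_nonneg fun c _ => h0 c, fun c hc => hmono c (K c hc) _ ?_ (hK c hc)⟩
  have h1 : K c hc ≤ K' c := by simp only [hK', hc, dif_pos]; exact le_abs_self _
  exact h1.trans (Finset.single_le_sum (fun c _ => h0 c)
    (Fintype.mem_piFinset.2 fun i => Finset.mem_range.2 (hc i)))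

theorem exists_lipschitzOnWith_closedCell {E : Type*} [NormedAddCommGroup E] [NormedSpace ℝ E]
    {c : Fin (n + 1) → ℕ} (hc : M.IsCell c) {g : Param n → E}
    (hg : ContDiffOn ℝ 1 g (M.closedCell c)) : ∃ K : NNReal, LipschitzOnWith K g (M.closedCell c) := by
  have h := hg.continuousOn_fderivWithin (M.uniqueDiffOn_closedCell hc) le_rfl
  obtain ⟨C, hC⟩ := (M.isCompact_closedCell c).exists_bound_of_continuousOn h
  refine ⟨C.toNNReal, (M.convex_closedCell c).lipschitzOnWith_of_nnnorm_hasFDerivWithin_le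
    (fun x hx => (hg.differentiableOn one_ne_zero x hx).hasFDerivWithinAt) fun x hx => ?_⟩
  rw [← NNReal.coe_le_coe]
  exact (hC x hx).trans (Real.le_coe_toNNReal C)

/-- The vector surface element `|det DF| (DF)^{-T} e_i` of the image of `x̂_i = const`. -/
def areaVec (M : ParamMesh n) (F : Param n → Phys n) (i : Fin (n + 1)) (x : Param n) : Phys n :=
  |(M.jac F x).det| • M.conormal F i x

theorem IsGeometryMap.continuousOn_areaVec (hF : M.IsGeometryMap F r) (i : Fin (n + 1)) :
    ContinuousOn (M.areaVec F i) M.closedBox :=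
  hF.continuousOn_det.abs.smul (hF.continuousOn_conormal i)

theorem IsGeometryMap.exists_norm_areaVec_le (hF : M.IsGeometryMap F r) :
    ∃ C : ℝ, 0 ≤ C ∧ ∀ i, ∀ x ∈ M.closedBox, ‖M.areaVec F i x‖ ≤ C := by
  choose C hC using fun i => M.isCompact_closedBox.exists_bound_of_continuousOn
    (hF.continuousOn_areaVec i)
  refine ⟨∑ i, |C i|, Finset.sum_nonneg fun _ _ => abs_nonneg _, fun i x hx => ?_⟩
  exact (hC i x hx).trans ((le_abs_self _).trans
    (Finset.single_le_sum (f := fun i => |C i|) (fun _ _ => abs_nonneg _) (Finset.mem_univ i)))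

/-- The modulus is smooth away from zero, and the determinant does not vanish. -/
theorem IsGeometryMap.contDiffOn_areaVec_cell (hF : M.IsGeometryMap F r) {m : ℕ} (hm : m + 1 ≤ r)
    {c : Fin (n + 1) → ℕ} (hc : M.IsCell c) (i : Fin (n + 1)) :
    ContDiffOn ℝ m (M.areaVec F i) (M.closedCell c) := by
  have hJ := hF.contDiffOn_jac_cell hc hm
  have h0 : ∀ x ∈ M.closedCell c, (M.jac F x).det ≠ 0 := fun x hx =>
    hF.det_ne_zero x (M.closedCell_subset_closedBox hc hx)
  have h1 : ContDiffOn ℝ m (fun x => |(M.jac F x).det|) (M.closedCell c) :=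
    (contDiffOn_matrix_det hJ).norm ℝ h0
  refine h1.smul ?_
  rw [contDiffOn_piLp]
  exact fun j => contDiffOn_matrix_inv hJ h0 i j

/-- The normalization of the normal cancels against the surface element, so `n dS` is `areaVec` up
to sign. Unlike the boundary normal, `areaVec` is defined inside the collar and is smooth on closed
cells. -/
theorem outNormal_areaFactor (hF : M.IsGeometryMap F r) (i : Fin (n + 1)) (s : Bool)
    {y : Fin n → ℝ} (hy : y ∈ M.faceDom i) :
    M.areaFactor F i (M.inward i s 0 y) • M.outNormal F i s y
      = sgn s • M.areaVec F i (M.inward i s 0 y) := by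
  have hx : M.inward i s 0 y ∈ M.closedBox := by
    rw [inward_zero]; exact M.ins_mem_closedBox (M.bdryCoord_mem i s) hy
  have h0 : ‖M.conormal F i (M.inward i s 0 y)‖ ≠ 0 := norm_ne_zero_iff.2 (hF.conormal_ne_zero i hx)
  rw [areaFactor, outNormal, unitNormal, areaVec, smul_smul, smul_smul, smul_smul]
  congr 1
  field_simp

/-- Fields that are continuously differentiable up to the boundary of each cell, in parametric
coordinates. -/
def IsCellC1 (M : ParamMesh n) (F : Param n → Phys n) (v : Phys n → Phys n) : Prop :=
  ∀ c, M.IsCell c → ∃ V : Param n → Phys n,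
    ContDiffOn ℝ 1 V (M.closedCell c) ∧ ∀ x ∈ M.cell c, v (F x) = V x

theorem IsCellC1.exists_bound {v : Phys n → Phys n} (hv : M.IsCellC1 F v) :
    ∃ C : ℝ, 0 ≤ C ∧ ∀ c, M.IsCell c → ∀ x ∈ M.cell c, ‖v (F x)‖ ≤ C := by
  refine exists_forall_isCell M (fun c K K' hK h x hx => (h x hx).trans hK) fun c hc => ?_
  obtain ⟨V, hV, hvV⟩ := hv c hc
  obtain ⟨C, hC⟩ := (M.isCompact_closedCell c).exists_bound_of_continuousOn hV.continuousOn
  exact ⟨C, fun x hx => by rw [hvV x hx]; exact hC x (M.cell_subset_closedCell c hx)⟩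

theorem IsCellC1.exists_bound_ae (hF : M.IsGeometryMap F r) {v : Phys n → Phys n}
    (hv : M.IsCellC1 F v) :
    ∃ C : ℝ, 0 ≤ C ∧ ∀ᵐ z ∂(volume.restrict (M.domain F)), ‖v z‖ ≤ C := by
  obtain ⟨C, hC0, hC⟩ := hv.exists_bound
  exact ⟨C, hC0, hF.ae_domain_of_ae (M.ae_exists_mem_cell.mono fun x ⟨c, hc, hx⟩ => hC c hc x hx)⟩

/-- The weak gradient of such a field is bounded. -/
theorem IsCellC1.exists_bound_grad (hF : M.IsGeometryMap F r) (hr : 1 ≤ r) {v : Phys n → Phys n}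
    (hv : M.IsCellC1 F v) {G : Fin (n + 1) → Phys n → Phys n}
    (hG : IsWeakGrad (M.domain F) v G) :
    ∃ C : ℝ, 0 ≤ C ∧ ∀ᵐ z ∂(volume.restrict (M.domain F)), ∀ i, ‖G i z‖ ≤ C := by
  have h1 : ∃ C : ℝ, 0 ≤ C ∧ ∀ c, M.IsCell c → ∀ᵐ z ∂(volume.restrict (F '' M.cell c)),
      ∀ i, ‖G i z‖ ≤ C := by
    refine exists_forall_isCell M (fun c K K' hK h => h.mono fun z hz i => (hz i).trans hK)
      fun c hc => ?_
    obtain ⟨V, hV, hvV⟩ := hv c hc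
    have hU := hF.isOpen_image (M.isOpen_cell c) (M.cell_subset_openBox hc)
    have h2 : ∀ i, ∃ C, ∀ᵐ z ∂(volume.restrict (F '' M.cell c)), ‖G i z‖ ≤ C := fun i => by
      obtain ⟨hD, g, hg, hDg⟩ := hF.isWeakDeriv_iteratedPartial hc hr (fun _ : Fin 1 => i)
        (w := v) (g := V) (by exact_mod_cast hV) hvV
      obtain ⟨C, hC⟩ := (M.isCompact_closedCell c).exists_bound_of_continuousOn hg
      refine ⟨C, ?_⟩
      have hG' := (hG i).mono hU.measurableSet hF.isOpen_domain.measurableSet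
        (Set.image_mono (M.cell_subset_openBox hc))
      filter_upwards [hG'.ae_eq hU hD, ae_restrict_mem hU.measurableSet] with z hz hzU
      obtain ⟨x, hx, rfl⟩ := hzU
      rw [hz, hDg x hx]
      exact hC x (M.cell_subset_closedCell c hx)
    choose C hC using h2
    refine ⟨∑ i, |C i|, (ae_all_iff.2 hC).mono fun z hz i => (hz i).trans ((le_abs_self _).trans
      (Finset.single_le_sum (f := fun i => |C i|) (fun _ _ => abs_nonneg _) (Finset.mem_univ i)))⟩
  obtain ⟨C, hC0, hC⟩ := h1
  exact ⟨C, hC0, hF.ae_domain_of_ae_cells hC⟩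

theorem ae_faceDom_of_ae_facetDom {i : Fin (n + 1)} {P : (Fin n → ℝ) → Prop}
    (h : ∀ c ∈ M.facetIdx i, ∀ᵐ y ∂(volume.restrict (M.facetDom i c)), P y) :
    ∀ᵐ y ∂(volume.restrict (M.faceDom i)), P y := by
  have h2 : ∀ᵐ y : Fin n → ℝ, ∀ c : Fin n → ℕ, c ∈ M.facetIdx i → y ∈ M.facetDom i c → P y :=
    ae_all_iff.2 fun c => by
      by_cases hc : c ∈ M.facetIdx i
      · have := h c hc
        rw [ae_restrict_iff' (M.measurableSet_facetDom i c)] at this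
        exact this.mono fun y hy _ => hy
      · exact Eventually.of_forall fun y h' => absurd h' hc
  filter_upwards [M.ae_exists_mem_facetDom i, ae_restrict_of_ae h2] with y ⟨c, hc, hy⟩ h3
    using h3 c hc hy

theorem inward_mem_closedBox {i : Fin (n + 1)} (s : Bool) {y : Fin n → ℝ} (hy : y ∈ M.faceDom i) :
    M.inward i s 0 y ∈ M.closedBox := by
  rw [inward_zero]; exact M.ins_mem_closedBox (M.bdryCoord_mem i s) hy

theorem dist_inward_inward (i : Fin (n + 1)) (s : Bool) {t : ℝ} (ht : 0 ≤ t) (y : Fin n → ℝ) :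
    dist (M.inward i s t y) (M.inward i s 0 y) = t := by
  rw [inward, inward, dist_ins_ins, Real.dist_eq, mul_zero, sub_zero, sub_sub_cancel_left, abs_neg,
    abs_mul, abs_of_nonneg ht]
  cases s <;> simp [sgn]

theorem aestronglyMeasurable_inward (hF : M.IsGeometryMap F r) {E : Type*} [TopologicalSpace E]
    {g : Phys n → E} (hg : AEStronglyMeasurable g (volume.restrict (M.domain F)))
    {δ : ℝ} (hδ : ∀ i, ∀ j < M.N i, δ ≤ M.ζ i (j + 1) - M.ζ i j) (i : Fin (n + 1)) (s : Bool) {S : Set (Fin n → ℝ)}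
    (hS : S ⊆ M.faceDom i) :
    AEStronglyMeasurable (fun q : ℝ × (Fin n → ℝ) => g (F (M.inward i s q.1 q.2))) (slab δ S) := by
  simp_rw [inward_eq]
  exact aestronglyMeasurable_comp_ins hF hg i _ (neg_sgn_eq s) fun t ht y hy => by
    rw [← inward_eq]; exact M.inward_mem_openBox hδ s ht (hS hy)

/-- Traces of cellwise smooth fields are attained at a linear rate. -/
theorem IsCellC1.exists_trace_bound (hF : M.IsGeometryMap F r) {v : Phys n → Phys n}
    (hv : M.IsCellC1 F v) (hvm : AEStronglyMeasurable v (volume.restrict (M.domain F)))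
    {δ : ℝ} (hδ0 : 0 < δ) (hδ : ∀ i, ∀ j < M.N i, δ ≤ M.ζ i (j + 1) - M.ζ i j) :
    ∃ C : ℝ, 0 ≤ C ∧ ∀ g, M.IsTrace F v g → ∀ i s, ∀ᵐ y ∂(volume.restrict (M.faceDom i)),
      ∀ t ∈ Set.Ioo 0 δ, ‖v (F (M.inward i s t y)) - g (F (M.inward i s 0 y))‖ ≤ C * t := by
  have h1 : ∃ C : ℝ, 0 ≤ C ∧ ∀ c, M.IsCell c → ∃ V : Param n → Phys n,
      ContinuousOn V (M.closedCell c) ∧ (∀ x ∈ M.cell c, v (F x) = V x) ∧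
      ∀ x ∈ M.closedCell c, ∀ x' ∈ M.closedCell c, ‖V x - V x'‖ ≤ C * dist x x' := by
    refine exists_forall_isCell M (fun c K K' hK ⟨V, hVc, hV, hL⟩ => ⟨V, hVc, hV,
      fun x hx x' hx' => (hL x hx x' hx').trans (mul_le_mul_of_nonneg_right hK dist_nonneg)⟩)
      fun c hc => ?_
    obtain ⟨V, hV, hvV⟩ := hv c hc
    obtain ⟨K, hK⟩ := exists_lipschitzOnWith_closedCell hc hV
    exact ⟨K, V, hV.continuousOn, hvV, fun x hx x' hx' => by
      rw [← dist_eq_norm]; exact hK.dist_le_mul x hx x' hx'⟩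
  obtain ⟨C, hC0, hC⟩ := h1
  obtain ⟨A₀, -, hA⟩ := hF.exists_areaFactor_le
  refine ⟨C, hC0, fun g hg i s => ae_faceDom_of_ae_facetDom fun c hc => ?_⟩
  have hSf := M.facetDom_subset_faceDom hc
  have hSm := M.measurableSet_facetDom i c
  obtain ⟨V, hVc, hvV, hVL⟩ := hC _ (M.isCell_insertNth hc (M.bdryLayer_lt i s))
  have hb : ∀ y ∈ M.facetDom i c, ∀ t ∈ Set.Ioo 0 δ,
      ‖v (F (M.inward i s t y)) - V (M.inward i s 0 y)‖ ≤ C * t := fun y hy t ht => by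
    rw [hvV _ (M.inward_mem_cell hδ s ht hy)]
    refine (hVL _ (M.inward_mem_closedCell hδ s (Set.Ioo_subset_Icc_self ht) hy) _
      (M.inward_mem_closedCell hδ s ⟨le_rfl, hδ0.le⟩ hy)).trans_eq ?_
    rw [dist_inward_inward i s ht.1.le]
  set A : (Fin n → ℝ) → ℝ := fun y => M.areaFactor F i (M.inward i s 0 y) with hAdef
  have hV0 : AEStronglyMeasurable (fun y => V (M.inward i s 0 y))
      (volume.restrict (M.facetDom i c)) := by
    refine ContinuousOn.aestronglyMeasurable (hVc.comp ?_ fun y hy =>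
      M.inward_mem_closedCell hδ s ⟨le_rfl, hδ0.le⟩ hy) hSm
    exact ((continuous_ins i).comp (continuous_const.prodMk continuous_id)).continuousOn
  -- The boundary values of the Lipschitz extension `V` are a mean square limit, hence agree with
  -- any trace; the linear rate of `V` passes to `g`.
  have hlim1 : Tendsto (collarErr (M.facetDom i c) A (fun t y => v (F (M.inward i s t y)))
      fun y => V (M.inward i s 0 y)) (𝓝[>] 0) (𝓝 0) := by
    refine tendsto_collarErr_of_uniform hSm (facetDom_volume_lt_top M i c) (A₀ := A₀)
      (fun y hy => hA i _ (inward_mem_closedBox s (hSf hy))) fun η hη =>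
        ⟨min δ (η / (C + 1)), lt_min hδ0 (by positivity),
        (ae_restrict_mem hSm).mono fun y hy t ht => ?_⟩
    refine (hb y hy t ⟨ht.1, ht.2.trans_le (min_le_left _ _)⟩).trans ?_
    have := ht.2.le.trans (min_le_right _ _)
    rw [le_div_iff₀ (by positivity)] at this
    nlinarith [ht.1]
  have hlim2 : Tendsto (collarErr (M.facetDom i c) A (fun t y => v (F (M.inward i s t y)))
      fun y => g (F (M.inward i s 0 y))) (𝓝[>] 0) (𝓝 0) := by
    refine tendsto_of_tendsto_of_tendsto_of_le_of_le tendsto_const_nhds (hg.2 i s)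
      (fun _ => zero_le) fun ε => ?_
    exact mul_le_mul_right (lintegral_mono fun t =>
      lintegral_mono' (Measure.restrict_mono hSf le_rfl) le_rfl) _
  have hAm : AEMeasurable A (volume.restrict (M.facetDom i c)) := by
    simp only [hAdef, inward_zero]
    exact hF.aemeasurable_areaFactor_ins (M.bdryCoord_mem i s) hSm hSf
  have heq := ae_eq_of_collarErr_tendsto hSm hδ0 (aestronglyMeasurable_inward hF hvm hδ i s hSf) hV0
    ((hg.1 i s).1.mono_measure (Measure.restrict_mono hSf le_rfl)) hAm
    (fun y hy => hF.areaFactor_pos i (inward_mem_closedBox s (hSf hy))) hlim1 hlim2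
  filter_upwards [heq, ae_restrict_mem hSm] with y hy hyS t ht
  rw [← hy]
  exact hb y hyS t ht

/-- The area vectors contain first derivatives of `F`, so `r ≥ 2` makes them `C¹`, hence Lipschitz,
on closed cells. -/
theorem IsGeometryMap.exists_areaVec_bound (hF : M.IsGeometryMap F r) (hr : 2 ≤ r)
    {δ : ℝ} (hδ0 : 0 < δ) (hδ : ∀ i, ∀ j < M.N i, δ ≤ M.ζ i (j + 1) - M.ζ i j) :
    ∃ C : ℝ, 0 ≤ C ∧ ∀ i s, ∀ᵐ y ∂(volume.restrict (M.faceDom i)),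
      ∀ t ∈ Set.Ioo 0 δ, ‖M.areaVec F i (M.inward i s t y) - M.areaVec F i (M.inward i s 0 y)‖
        ≤ C * t := by
  have h1 : ∃ C : ℝ, 0 ≤ C ∧ ∀ c, M.IsCell c → ∀ i,
      ∀ x ∈ M.closedCell c, ∀ x' ∈ M.closedCell c,
        ‖M.areaVec F i x - M.areaVec F i x'‖ ≤ C * dist x x' := by
    refine exists_forall_isCell M (fun c K K' hK hL i x hx x' hx' => (hL i x hx x' hx').trans
      (mul_le_mul_of_nonneg_right hK dist_nonneg)) fun c hc => ?_
    choose K hK using fun i => exists_lipschitzOnWith_closedCell hc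
      (by exact_mod_cast hF.contDiffOn_areaVec_cell (m := 1) hr hc i)
    refine ⟨∑ i, (K i : ℝ), fun i x hx x' hx' => ?_⟩
    rw [← dist_eq_norm]
    refine ((hK i).dist_le_mul x hx x' hx').trans (mul_le_mul_of_nonneg_right ?_ dist_nonneg)
    exact Finset.single_le_sum (f := fun i => (K i : ℝ)) (fun _ _ => NNReal.coe_nonneg _)
      (Finset.mem_univ i)
  obtain ⟨C, hC0, hC⟩ := h1
  refine ⟨C, hC0, fun i s => ae_faceDom_of_ae_facetDom fun c hc => ?_⟩
  filter_upwards [ae_restrict_mem (M.measurableSet_facetDom i c)] with y hy t ht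
  refine (hC _ (M.isCell_insertNth hc (M.bdryLayer_lt i s)) i _
    (M.inward_mem_closedCell hδ s (Set.Ioo_subset_Icc_self ht) hy) _
    (M.inward_mem_closedCell hδ s ⟨le_rfl, hδ0.le⟩ hy)).trans_eq ?_
  rw [dist_inward_inward i s ht.1.le]

/-- The traces of a field are unique. -/
theorem IsTrace.ae_eq (hF : M.IsGeometryMap F r) {v g g' : Phys n → Phys n}
    (hvm : AEStronglyMeasurable v (volume.restrict (M.domain F))) (hg : M.IsTrace F v g)
    (hg' : M.IsTrace F v g') (i : Fin (n + 1)) (s : Bool) :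
    ∀ᵐ y ∂(volume.restrict (M.faceDom i)),
      g (F (M.inward i s 0 y)) = g' (F (M.inward i s 0 y)) := by
  obtain ⟨δ, hδ0, hδ⟩ := M.exists_mesh_width
  refine ae_eq_of_collarErr_tendsto (M.measurableSet_faceDom i) hδ0
    (aestronglyMeasurable_inward hF hvm hδ i s subset_rfl)
    (hg.1 i s).1 (hg'.1 i s).1 (A := fun y => M.areaFactor F i (M.inward i s 0 y)) ?_
    (fun y hy => hF.areaFactor_pos i (inward_mem_closedBox s hy)) (hg.2 i s) (hg'.2 i s)
  simp only [inward_zero]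
  exact hF.aemeasurable_areaFactor_ins (M.bdryCoord_mem i s) (M.measurableSet_faceDom i) subset_rfl

/-- Bounds, uniform in the collars of the boundary, for a cellwise smooth field with vanishing
normal trace. -/
theorem IsCellC1.exists_collar_bounds (hF : M.IsGeometryMap F r) (hr : 2 ≤ r)
    {v gv : Phys n → Phys n} (hv : M.IsCellC1 F v) (hvn : M.MemH1n F v) (hgv : M.IsTrace F v gv)
    {δ : ℝ} (hδ0 : 0 < δ) (hδ : ∀ i, ∀ j < M.N i, δ ≤ M.ζ i (j + 1) - M.ζ i j) :
    ∃ C : ℝ, 0 ≤ C ∧ ∀ i s, ∀ᵐ y ∂(volume.restrict (M.faceDom i)), ∀ t ∈ Set.Ioo 0 δ,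
      ‖v (F (M.inward i s t y))‖ ≤ C ∧ ‖gv (F (M.inward i s 0 y))‖ ≤ C ∧
      ‖v (F (M.inward i s t y)) - gv (F (M.inward i s 0 y))‖ ≤ C * t ∧
      ‖M.areaVec F i (M.inward i s t y)‖ ≤ C ∧ ‖M.areaVec F i (M.inward i s 0 y)‖ ≤ C ∧
      ‖M.areaVec F i (M.inward i s t y) - M.areaVec F i (M.inward i s 0 y)‖ ≤ C * t ∧
      |inner ℝ (M.areaVec F i (M.inward i s t y)) (v (F (M.inward i s t y)))| ≤ C * t := by
  have hvm := hvn.1.1.1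
  obtain ⟨g, hg, hgn⟩ := hvn.2
  obtain ⟨C₁, hC1, hb1⟩ := hv.exists_bound
  obtain ⟨C₂, hC2, hb2⟩ := hv.exists_trace_bound hF hvm hδ0 hδ
  obtain ⟨C₃, hC3, hb3⟩ := hF.exists_norm_areaVec_le
  obtain ⟨C₄, hC4, hb4⟩ := hF.exists_areaVec_bound hr hδ0 hδ
  -- A single constant dominating all bounds below; the last two summands control the flux of `v`.
  set C := C₁ + C₂ * δ + C₂ + C₃ + C₄ + C₃ * C₂ + C₄ * (C₁ + C₂ * δ) with hC
  have p1 : 0 ≤ C₂ * δ := by positivity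
  have p2 : 0 ≤ C₃ * C₂ := by positivity
  have p3 : 0 ≤ C₄ * (C₁ + C₂ * δ) := by positivity
  refine ⟨C, by positivity, fun i s => ?_⟩
  filter_upwards [hb2 gv hgv i s, hb4 i s, M.ae_exists_mem_facetDom i,
    ae_restrict_mem (M.measurableSet_faceDom i), hgv.ae_eq hF hvm hg i s, hgn i s]
    with y h2 h4 ⟨c, hc, hyc⟩ hy hgg hn t ht
  have e1 := hb1 _ (M.isCell_insertNth hc (M.bdryLayer_lt i s)) _ (M.inward_mem_cell hδ s ht hyc)
  have e2 := h2 t ht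
  have e3 := hb3 i _ (M.openBox_subset_closedBox (M.inward_mem_openBox hδ s ht hy))
  have e3' := hb3 i _ (inward_mem_closedBox s hy)
  have e4 := h4 t ht
  have ht0 := ht.1
  have et : C₂ * t ≤ C₂ * δ := mul_le_mul_of_nonneg_left ht.2.le hC2
  have eg : ‖gv (F (M.inward i s 0 y))‖ ≤ C₁ + C₂ * δ := by
    have := norm_sub_norm_le (gv (F (M.inward i s 0 y))) (v (F (M.inward i s t y)))
    rw [norm_sub_rev] at this
    linarith
  refine ⟨by linarith, by linarith, e2.trans ?_, by linarith, by linarith, e4.trans ?_, ?_⟩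
  · exact mul_le_mul_of_nonneg_right (by linarith) ht0.le
  · exact mul_le_mul_of_nonneg_right (by linarith) ht0.le
  -- The vanishing normal component is known for some trace of `v`; uniqueness of traces gives it
  -- for `gv`.
  · have h0 : inner ℝ (M.areaVec F i (M.inward i s 0 y)) (gv (F (M.inward i s 0 y))) = 0 := by
      have h5 : sgn s • M.areaVec F i (M.inward i s 0 y)
          = M.areaFactor F i (M.inward i s 0 y) • M.outNormal F i s y :=
        (outNormal_areaFactor hF i s hy).symm
      have h6 : inner ℝ (sgn s • M.areaVec F i (M.inward i s 0 y))
          (gv (F (M.inward i s 0 y))) = 0 := by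
        rw [h5, real_inner_smul_left, hgg, real_inner_comm, hn, mul_zero]
      rw [real_inner_smul_left] at h6
      refine (mul_eq_zero.1 h6).resolve_left ?_
      cases s <;> simp [sgn]
    -- At the boundary the flux is zero; moving inward changes `v` and the area vector by `O(t)`
    -- each.
    have e5 : inner ℝ (M.areaVec F i (M.inward i s t y)) (v (F (M.inward i s t y)))
        = inner ℝ (M.areaVec F i (M.inward i s t y))
            (v (F (M.inward i s t y)) - gv (F (M.inward i s 0 y)))
          + inner ℝ (M.areaVec F i (M.inward i s t y) - M.areaVec F i (M.inward i s 0 y))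
            (gv (F (M.inward i s 0 y))) := by
      rw [inner_sub_right, inner_sub_left, h0]; ring
    rw [e5]
    have b1 := (abs_real_inner_le_norm (M.areaVec F i (M.inward i s t y))
      (v (F (M.inward i s t y)) - gv (F (M.inward i s 0 y)))).trans
        (mul_le_mul e3 e2 (norm_nonneg _) hC3)
    have b2 := (abs_real_inner_le_norm
      (M.areaVec F i (M.inward i s t y) - M.areaVec F i (M.inward i s 0 y))
      (gv (F (M.inward i s 0 y)))).trans (mul_le_mul e4 eg (norm_nonneg _) (by positivity))
    refine (abs_add_le _ _).trans ((add_le_add b1 b2).trans ?_)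
    have : C₃ * (C₂ * t) + C₄ * t * (C₁ + C₂ * δ) = (C₃ * C₂ + C₄ * (C₁ + C₂ * δ)) * t := by ring
    rw [this]
    exact mul_le_mul_of_nonneg_right (by linarith) ht0.le

end CollarBounds

end ParamMesh

end SkeletonStab

namespace SkeletonStab

/-! ### One-dimensional ramps -/

section Ramp

/-- The piecewise linear function on `[a, b]` that vanishes at the ends and equals one at distance
at least `ε` from them. -/
def ramp (a b ε r : ℝ) : ℝ := max 0 (min 1 (min ((r - a) / ε) ((b - r) / ε)))

/-- The derivative of `ramp a b ε` on `(a, b)`, off the breakpoints. -/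
def rampDeriv (a b ε r : ℝ) : ℝ := if r < a + ε then ε⁻¹ else if b - ε < r then -ε⁻¹ else 0

variable {a b ε r : ℝ}

theorem ramp_nonneg : 0 ≤ ramp a b ε r := le_max_left _ _

theorem ramp_le_one : ramp a b ε r ≤ 1 := max_le zero_le_one (min_le_left _ _)

theorem ramp_le_left (hε : 0 < ε) (hr : a ≤ r) : ramp a b ε r ≤ (r - a) / ε :=
  max_le (div_nonneg (sub_nonneg.2 hr) hε.le) ((min_le_right _ _).trans (min_le_left _ _))

theorem ramp_le_right (hε : 0 < ε) (hr : r ≤ b) : ramp a b ε r ≤ (b - r) / ε :=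
  max_le (div_nonneg (sub_nonneg.2 hr) hε.le) ((min_le_right _ _).trans (min_le_right _ _))

theorem ramp_eq_one (hε : 0 < ε) (h1 : a + ε ≤ r) (h2 : r ≤ b - ε) : ramp a b ε r = 1 := by
  have e1 : 1 ≤ (r - a) / ε := by rw [le_div_iff₀ hε]; linarith
  have e2 : 1 ≤ (b - r) / ε := by rw [le_div_iff₀ hε]; linarith
  rw [ramp, min_eq_left (le_min e1 e2), max_eq_right zero_le_one]

theorem continuous_ramp : Continuous (ramp a b ε) := by
  unfold ramp; fun_prop

theorem measurable_rampDeriv : Measurable (rampDeriv a b ε) :=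
  Measurable.ite measurableSet_Iio measurable_const
    (Measurable.ite measurableSet_Ioi measurable_const measurable_const)

theorem abs_rampDeriv_le (hε : 0 < ε) : |rampDeriv a b ε r| ≤ ε⁻¹ := by
  have := inv_pos.2 hε
  unfold rampDeriv
  split_ifs <;> simp [abs_of_pos hε, hε.le]

theorem abs_ramp_sub_le (hε : 0 < ε) (r' : ℝ) :
    |ramp a b ε r - ramp a b ε r'| ≤ ε⁻¹ * |r - r'| := by
  have h1 : |(r - a) / ε - (r' - a) / ε| ≤ ε⁻¹ * |r - r'| := by
    rw [← sub_div, sub_sub_sub_cancel_right, abs_div, abs_of_pos hε, div_eq_inv_mul]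
  have h2 : |(b - r) / ε - (b - r') / ε| ≤ ε⁻¹ * |r - r'| := by
    rw [← sub_div, sub_sub_sub_cancel_left, abs_div, abs_of_pos hε, div_eq_inv_mul, abs_sub_comm]
  refine (abs_max_sub_max_le_max _ _ _ _).trans (max_le (by simp; positivity) ?_)
  refine (abs_min_sub_min_le_max _ _ _ _).trans (max_le (by simp; positivity) ?_)
  exact (abs_min_sub_min_le_max _ _ _ _).trans (max_le h1 h2)

/-- As `2 * ε < b - a`, a plateau separates the rising and the falling part, so near `r` the minimum
is attained by one fixed branch. -/
theorem hasDerivAt_ramp (hε : 0 < ε) (hab : 2 * ε < b - a) (ha : a < r) (hb : r < b)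
    (h1 : r ≠ a + ε) (h2 : r ≠ b - ε) : HasDerivAt (ramp a b ε) (rampDeriv a b ε r) r := by
  unfold rampDeriv
  rcases lt_or_gt_of_ne h1 with h1 | h1
  · rw [if_pos h1]
    have h : HasDerivAt (fun r : ℝ => (r - a) / ε) ε⁻¹ r := by
      simpa using ((hasDerivAt_id r).sub_const a).div_const ε
    refine h.congr_of_eventuallyEq ?_
    filter_upwards [Ioo_mem_nhds ha h1] with x hx
    have e1 : (x - a) / ε ≤ 1 := by rw [div_le_one hε]; linarith [hx.2]
    have e2 : (x - a) / ε ≤ (b - x) / ε := div_le_div_of_nonneg_right (by linarith [hx.2]) hε.le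
    have e3 : 0 ≤ (x - a) / ε := div_nonneg (by linarith [hx.1]) hε.le
    rw [ramp, min_eq_left e2, min_eq_right e1, max_eq_right e3]
  · rw [if_neg h1.not_gt]
    rcases lt_or_gt_of_ne h2 with h2 | h2
    · rw [if_neg h2.not_gt]
      refine (hasDerivAt_const r (1 : ℝ)).congr_of_eventuallyEq ?_
      filter_upwards [Ioo_mem_nhds h1 h2] with x hx
      exact ramp_eq_one hε hx.1.le hx.2.le
    · rw [if_pos h2]
      have h : HasDerivAt (fun r : ℝ => (b - r) / ε) (-ε⁻¹) r := by
        simpa [neg_div] using ((hasDerivAt_id r).const_sub b).div_const ε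
      refine h.congr_of_eventuallyEq ?_
      filter_upwards [Ioo_mem_nhds h2 hb] with x hx
      have e1 : (b - x) / ε ≤ 1 := by rw [div_le_one hε]; linarith [hx.1]
      have e2 : (b - x) / ε ≤ (x - a) / ε := div_le_div_of_nonneg_right (by linarith [hx.1]) hε.le
      have e3 : 0 ≤ (b - x) / ε := div_nonneg (by linarith [hx.2]) hε.le
      rw [ramp, min_eq_right e2, min_eq_right e1, max_eq_right e3]

/-- Factors are exchanged one at a time, the others being bounded by one. -/
theorem abs_prod_sub_prod_le {ι : Type*} (s : Finset ι) {f g : ι → ℝ}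
    (hf : ∀ i, |f i| ≤ 1) (hg : ∀ i, |g i| ≤ 1) :
    |∏ i ∈ s, f i - ∏ i ∈ s, g i| ≤ ∑ i ∈ s, |f i - g i| := by
  classical
  induction s using Finset.induction_on with
  | empty => simp
  | insert i s hi ih =>
    rw [Finset.prod_insert hi, Finset.prod_insert hi, Finset.sum_insert hi]
    have e : f i * ∏ j ∈ s, f j - g i * ∏ j ∈ s, g j
        = (f i - g i) * ∏ j ∈ s, f j + g i * (∏ j ∈ s, f j - ∏ j ∈ s, g j) := by ring
    rw [e]
    refine (abs_add_le _ _).trans ?_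
    rw [abs_mul, abs_mul]
    refine add_le_add (mul_le_of_le_one_right (abs_nonneg _) ?_) ?_
    · rw [Finset.abs_prod]; exact Finset.prod_le_one (fun _ _ => abs_nonneg _) fun j _ => hf j
    · exact (mul_le_of_le_one_left (abs_nonneg _) (hg i)).trans ih

end Ramp

namespace ParamMesh

variable {n : ℕ} {M : ParamMesh n} {F : Param n → Phys n} {r : ℕ}

/-! ### The cutoff function on the physical domain -/

section Cutoff

/-- The tensor-product ramp function on the parametric domain. -/
def profile (M : ParamMesh n) (ε : ℝ) (x : Param n) : ℝ :=
  ∏ i, ramp (M.ζ i 0) (M.ζ i (M.N i)) ε (x i)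

/-- The product of the ramps in all directions but `l`. -/
def sideProfile (M : ParamMesh n) (ε : ℝ) (l : Fin (n + 1)) (x : Param n) : ℝ :=
  ∏ i ∈ Finset.univ.erase l, ramp (M.ζ i 0) (M.ζ i (M.N i)) ε (x i)

theorem profile_nonneg (M : ParamMesh n) (ε : ℝ) (x : Param n) : 0 ≤ M.profile ε x :=
  Finset.prod_nonneg fun _ _ => ramp_nonneg

theorem profile_le_one (M : ParamMesh n) (ε : ℝ) (x : Param n) : M.profile ε x ≤ 1 :=
  Finset.prod_le_one (fun _ _ => ramp_nonneg) fun _ _ => ramp_le_one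

theorem sideProfile_nonneg (M : ParamMesh n) (ε : ℝ) (l : Fin (n + 1)) (x : Param n) :
    0 ≤ M.sideProfile ε l x := Finset.prod_nonneg fun _ _ => ramp_nonneg

theorem sideProfile_le_one (M : ParamMesh n) (ε : ℝ) (l : Fin (n + 1)) (x : Param n) :
    M.sideProfile ε l x ≤ 1 := Finset.prod_le_one (fun _ _ => ramp_nonneg) fun _ _ => ramp_le_one

theorem profile_le_ramp (M : ParamMesh n) (ε : ℝ) (x : Param n) (l : Fin (n + 1)) :
    M.profile ε x ≤ ramp (M.ζ l 0) (M.ζ l (M.N l)) ε (x l) := by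
  rw [profile, ← Finset.mul_prod_erase _ _ (Finset.mem_univ l)]
  exact mul_le_of_le_one_right ramp_nonneg (M.sideProfile_le_one ε l x)

theorem continuous_profile (M : ParamMesh n) (ε : ℝ) : Continuous (M.profile ε) :=
  continuous_finsetProd _ fun i _ => continuous_ramp.comp (continuous_apply i)

theorem continuous_sideProfile (M : ParamMesh n) (ε : ℝ) (l : Fin (n + 1)) :
    Continuous (M.sideProfile ε l) :=
  continuous_finsetProd _ fun i _ => continuous_ramp.comp (continuous_apply i)

theorem exists_lipschitzWith_profile (M : ParamMesh n) {ε : ℝ} (hε : 0 < ε) :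
    ∃ K : NNReal, LipschitzWith K (M.profile ε) := by
  refine ⟨Real.toNNReal ((n + 1) * ε⁻¹), LipschitzWith.of_dist_le_mul fun x y => ?_⟩
  have h01 : ∀ i (x : Param n), |ramp (M.ζ i 0) (M.ζ i (M.N i)) ε (x i)| ≤ 1 := fun i x => by
    rw [abs_of_nonneg ramp_nonneg]; exact ramp_le_one
  rw [Real.dist_eq, Real.coe_toNNReal _ (by positivity)]
  refine (abs_prod_sub_prod_le _ (fun i => h01 i x) fun i => h01 i y).trans ?_
  refine (Finset.sum_le_card_nsmul _ _ (ε⁻¹ * dist x y) fun i _ => ?_).trans_eq ?_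
  · refine (abs_ramp_sub_le hε _).trans (mul_le_mul_of_nonneg_left ?_ (inv_nonneg.2 hε.le))
    rw [← Real.dist_eq]; exact dist_le_pi_dist x y i
  · simp; ring

/-- The cutoff function on the physical domain. -/
def IsGeometryMap.cutoff (hF : M.IsGeometryMap F r) (ε : ℝ) (z : Phys n) : ℝ :=
  M.profile ε (hF.homeo.symm z)

/-- The partial derivatives of the cutoff function, in parametric coordinates. -/
def profileGrad (M : ParamMesh n) (F : Param n → Phys n) (ε : ℝ) (i : Fin (n + 1)) (x : Param n) :
    ℝ :=
  ∑ l, M.sideProfile ε l x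
    * (rampDeriv (M.ζ l 0) (M.ζ l (M.N l)) ε (x l) * (M.jac F x)⁻¹ l i)

/-- The partial derivatives of the cutoff function. -/
def IsGeometryMap.cutoffGrad (hF : M.IsGeometryMap F r) (ε : ℝ) (i : Fin (n + 1)) (z : Phys n) :
    ℝ := M.profileGrad F ε i (hF.homeo.symm z)

theorem IsGeometryMap.homeo_symm_mem (hF : M.IsGeometryMap F r) {z : Phys n}
    (hz : z ∈ M.domain F) : hF.homeo.symm z ∈ M.openBox := hF.homeo.map_target hz

/-- The inverse of `F` is `C¹` on the open domain, which yields a Lipschitz bound near each point;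
the profile is globally Lipschitz. -/
theorem IsGeometryMap.locallyLipschitz_cutoff (hF : M.IsGeometryMap F r) {ε : ℝ} (hε : 0 < ε) :
    ∀ z ∈ M.domain F, ∃ K : NNReal, ∃ s ∈ 𝓝 z, LipschitzOnWith K (hF.cutoff ε) s := by
  rintro z ⟨x, hx, rfl⟩
  obtain ⟨K, s, hs, hK⟩ := (hF.contDiffAt_symm hx).exists_lipschitzOnWith
  obtain ⟨K', hK'⟩ := M.exists_lipschitzWith_profile hε
  exact ⟨K' * K, s, hs, (hK'.lipschitzOnWith (s := Set.univ)).comp hK fun _ _ => Set.mem_univ _⟩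

theorem hasFDerivAt_profile {ε : ℝ} (hε : 0 < ε)
    (hε2 : ∀ i, 2 * ε < M.ζ i (M.N i) - M.ζ i 0) {x : Param n} (hx : x ∈ M.openBox)
    (h1 : ∀ i, x i ≠ M.ζ i 0 + ε) (h2 : ∀ i, x i ≠ M.ζ i (M.N i) - ε) :
    HasFDerivAt (M.profile ε) (∑ l, M.sideProfile ε l x •
      rampDeriv (M.ζ l 0) (M.ζ l (M.N l)) ε (x l) •
        (ContinuousLinearMap.proj l : Param n →L[ℝ] ℝ)) x := by
  refine HasFDerivAt.finsetProd (u := Finset.univ)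
    (g := fun i (x : Param n) => ramp (M.ζ i 0) (M.ζ i (M.N i)) ε (x i)) fun i _ => ?_
  have h := hasDerivAt_ramp hε (hε2 i) (hx i trivial).1 (hx i trivial).2 (h1 i) (h2 i)
  have hp : HasFDerivAt (fun x : Param n => x i)
      (ContinuousLinearMap.proj i : Param n →L[ℝ] ℝ) x := hasFDerivAt_apply i x
  exact HasDerivAt.comp_hasFDerivAt (h₂ := ramp (M.ζ i 0) (M.ζ i (M.N i)) ε) x h hp

/-- The chain rule fails only on the images of the hyperplanes of breakpoints. These hyperplanes are
null, and `F` maps null sets of the box to null sets. -/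
theorem IsGeometryMap.hasLineDerivAt_cutoff (hF : M.IsGeometryMap F r) {ε : ℝ} (hε : 0 < ε)
    (hε2 : ∀ i, 2 * ε < M.ζ i (M.N i) - M.ζ i 0) (i : Fin (n + 1)) :
    ∀ᵐ z ∂(volume.restrict (M.domain F)),
      HasLineDerivAt ℝ (hF.cutoff ε) (hF.cutoffGrad ε i z) z (EuclideanSpace.single i 1) := by
  refine hF.ae_domain_of_ae ?_
  have hne : ∀ (l : Fin (n + 1)) (c : ℝ), ∀ᵐ x : Param n, x l ≠ c := fun l c => by
    simpa [ae_iff, volume_pi] using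
      Measure.pi_hyperplane (fun _ : Fin (n + 1) => (volume : Measure ℝ)) l c
  have h1 : ∀ᵐ x : Param n, ∀ l, x l ≠ M.ζ l 0 + ε := ae_all_iff.2 fun l => hne l _
  have h2 : ∀ᵐ x : Param n, ∀ l, x l ≠ M.ζ l (M.N l) - ε := ae_all_iff.2 fun l => hne l _
  filter_upwards [ae_restrict_mem M.isOpen_openBox.measurableSet, ae_restrict_of_ae h1,
    ae_restrict_of_ae h2] with x hx h1 h2
  have h3 := hasFDerivAt_profile hε hε2 hx h1 h2
  rw [← hF.homeo_symm_apply hx] at h3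
  have h4 := (h3.comp (F x) (hF.hasFDerivAt_symm hx)).hasLineDerivAt (EuclideanSpace.single i 1)
  rw [hF.homeo_symm_apply hx] at h4
  have e : hF.cutoffGrad ε i (F x) = M.profileGrad F ε i x := by
    rw [cutoffGrad, hF.homeo_symm_apply hx]
  rw [e]
  refine h4.congr_deriv ?_
  simp [profileGrad, dinv_apply, Matrix.mulVec_single]

theorem IsGeometryMap.aemeasurable_symm (hF : M.IsGeometryMap F r) :
    AEMeasurable hF.homeo.symm (volume.restrict (M.domain F)) :=
  hF.homeo.continuousOn_symm.aemeasurable hF.isOpen_domain.measurableSet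

theorem IsGeometryMap.continuousOn_cutoff (hF : M.IsGeometryMap F r) (ε : ℝ) :
    ContinuousOn (hF.cutoff ε) (M.domain F) :=
  (M.continuous_profile ε).comp_continuousOn hF.homeo.continuousOn_symm

theorem IsGeometryMap.aestronglyMeasurable_cutoff (hF : M.IsGeometryMap F r) (ε : ℝ) :
    AEStronglyMeasurable (hF.cutoff ε) (volume.restrict (M.domain F)) :=
  (hF.continuousOn_cutoff ε).aestronglyMeasurable hF.isOpen_domain.measurableSet

theorem IsGeometryMap.aestronglyMeasurable_cutoffGrad (hF : M.IsGeometryMap F r) (ε : ℝ)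
    (i : Fin (n + 1)) :
    AEStronglyMeasurable (hF.cutoffGrad ε i) (volume.restrict (M.domain F)) := by
  have hJ : ∀ l, AEMeasurable (fun z => (M.jac F (hF.homeo.symm z))⁻¹ l i)
      (volume.restrict (M.domain F)) := fun l => by
    refine ContinuousOn.aemeasurable ?_ hF.isOpen_domain.measurableSet
    exact (hF.continuousOn_jacInv l i).comp hF.homeo.continuousOn_symm fun z hz =>
      M.openBox_subset_closedBox (hF.homeo_symm_mem hz)
  unfold cutoffGrad profileGrad
  refine (Finset.aemeasurable_fun_sum _ fun l _ => ?_).aestronglyMeasurable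
  refine ((M.continuous_sideProfile ε l).measurable.comp_aemeasurable hF.aemeasurable_symm).mul
    (AEMeasurable.mul ?_ (hJ l))
  exact measurable_rampDeriv.comp_aemeasurable
    ((measurable_pi_apply l).comp_aemeasurable hF.aemeasurable_symm)

/-- The bound grows like `1/ε` and serves only to give integrability at fixed `ε`. -/
theorem IsGeometryMap.exists_cutoffGrad_bound (hF : M.IsGeometryMap F r) {ε : ℝ} (hε : 0 < ε) :
    ∃ C : ℝ, 0 ≤ C ∧ ∀ i, ∀ z ∈ M.domain F, |hF.cutoffGrad ε i z| ≤ C := by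
  have h1 : ∀ l i, ∃ C, ∀ x ∈ M.closedBox, ‖(M.jac F x)⁻¹ l i‖ ≤ C := fun l i =>
    M.isCompact_closedBox.exists_bound_of_continuousOn (hF.continuousOn_jacInv l i)
  choose C hC using h1
  have hC0 : 0 ≤ ∑ i, ∑ l, ε⁻¹ * |C l i| := by positivity
  refine ⟨∑ i, ∑ l, ε⁻¹ * |C l i|, hC0, fun i z hz => ?_⟩
  refine le_trans ?_ (Finset.single_le_sum (f := fun i => ∑ l, ε⁻¹ * |C l i|)
    (fun _ _ => by positivity) (Finset.mem_univ i))
  unfold cutoffGrad profileGrad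
  refine (Finset.abs_sum_le_sum_abs _ _).trans (Finset.sum_le_sum fun l _ => ?_)
  rw [abs_mul, abs_mul, abs_of_nonneg (M.sideProfile_nonneg ε l _)]
  refine (mul_le_of_le_one_left (by positivity) (M.sideProfile_le_one ε l _)).trans ?_
  exact mul_le_mul (abs_rampDeriv_le hε)
    ((hC l i _ (M.openBox_subset_closedBox (hF.homeo_symm_mem hz))).trans (le_abs_self _))
    (abs_nonneg _) (by positivity)

theorem IsGeometryMap.cutoff_nonneg (hF : M.IsGeometryMap F r) (ε : ℝ) (z : Phys n) :
    0 ≤ hF.cutoff ε z := M.profile_nonneg _ _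

theorem IsGeometryMap.cutoff_le_one (hF : M.IsGeometryMap F r) (ε : ℝ) (z : Phys n) :
    hF.cutoff ε z ≤ 1 := M.profile_le_one _ _

theorem IsGeometryMap.cutoff_eventually_eq_one (hF : M.IsGeometryMap F r) {z : Phys n}
    (hz : z ∈ M.domain F) : ∀ᶠ ε in 𝓝[>] 0, hF.cutoff ε z = 1 := by
  have hx := hF.homeo_symm_mem hz
  have h1 : ∀ i, ∀ᶠ ε in 𝓝[>] (0 : ℝ), M.ζ i 0 + ε ≤ hF.homeo.symm z i ∧
      hF.homeo.symm z i ≤ M.ζ i (M.N i) - ε := fun i => by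
    have := hx i trivial
    filter_upwards [mem_nhdsWithin_of_mem_nhds (Iio_mem_nhds (sub_pos.2 this.1)),
      mem_nhdsWithin_of_mem_nhds (Iio_mem_nhds (sub_pos.2 this.2))] with ε h1 h2
    simp only [Set.mem_Iio] at h1 h2
    constructor <;> linarith
  filter_upwards [eventually_all.2 h1, self_mem_nhdsWithin] with ε hε hε0
  unfold cutoff profile
  exact Finset.prod_eq_one fun i _ => ramp_eq_one hε0 (hε i).1 (hε i).2

/-- The cutoff function grows at most linearly away from the boundary. -/
theorem IsGeometryMap.cutoff_inward_le (hF : M.IsGeometryMap F r) {ε : ℝ} (hε : 0 < ε)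
    {i : Fin (n + 1)} {s : Bool} {t : ℝ} {y : Fin n → ℝ}
    (h : M.inward i s t y ∈ M.openBox) : hF.cutoff ε (F (M.inward i s t y)) ≤ t / ε := by
  rw [cutoff, hF.homeo_symm_apply h]
  refine (M.profile_le_ramp ε _ i).trans ?_
  have h1 := h i trivial
  cases s
  · refine (ramp_le_left hε h1.1.le).trans_eq ?_
    simp [inward, ins, bdryCoord, sgn]
  · refine (ramp_le_right hε h1.2.le).trans_eq ?_
    simp [inward, ins, bdryCoord, sgn]

end Cutoff

end ParamMesh

end SkeletonStab

namespace SkeletonStab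

namespace ParamMesh

variable {n : ℕ} {M : ParamMesh n} {F : Param n → Phys n} {r : ℕ}

/-! ### Cut-off fields as test functions -/

section CutoffTest

theorem two_mul_lt_width {δ : ℝ} (hδ : ∀ i, ∀ j < M.N i, δ ≤ M.ζ i (j + 1) - M.ζ i j) {ε : ℝ}
    (hε : 2 * ε < δ) (i : Fin (n + 1)) : 2 * ε < M.ζ i (M.N i) - M.ζ i 0 := by
  have h1 := hδ i 0 (M.N_pos i)
  have h2 : M.ζ i (0 + 1) ≤ M.ζ i (M.N i) := M.ζ_mono (M.N_pos i) le_rfl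
  linarith

theorem IsGeometryMap.memL2_cutoff_smul (hF : M.IsGeometryMap F r) (ε : ℝ) {v : Phys n → Phys n}
    (hv : MemL2 (M.domain F) v) : MemL2 (M.domain F) fun z => hF.cutoff ε z • v z := by
  refine hv.mono ((hF.aestronglyMeasurable_cutoff ε).smul hv.1) (Eventually.of_forall fun z => ?_)
  rw [norm_smul, Real.norm_eq_abs, abs_of_nonneg (hF.cutoff_nonneg ε z)]
  exact mul_le_of_le_one_left (norm_nonneg _) (hF.cutoff_le_one ε z)

theorem IsGeometryMap.memL2_cutoffGrad_smul (hF : M.IsGeometryMap F r) {ε : ℝ} (hε : 0 < ε)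
    (i : Fin (n + 1)) {v : Phys n → Phys n}
    (hv : MemL2 (M.domain F) v) : MemL2 (M.domain F) fun z => hF.cutoffGrad ε i z • v z := by
  obtain ⟨C, hC0, hC⟩ := hF.exists_cutoffGrad_bound hε
  refine hv.of_le_mul (c := C) ((hF.aestronglyMeasurable_cutoffGrad ε i).smul hv.1)
    ((ae_restrict_mem hF.isOpen_domain.measurableSet).mono fun z hz => ?_)
  rw [norm_smul]
  exact mul_le_mul_of_nonneg_right (hC i z hz) (norm_nonneg _)

theorem IsGeometryMap.locallyIntegrableOn_of_memL2 (hF : M.IsGeometryMap F r) {v : Phys n → Phys n}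
    (hv : MemL2 (M.domain F) v) : LocallyIntegrableOn v (M.domain F) := by
  have := hF.isFiniteMeasure_domain
  have h : IntegrableOn v (M.domain F) := hv.integrable one_le_two
  exact h.locallyIntegrableOn

/-- The weak gradient of a cut-off field. -/
theorem IsGeometryMap.isWeakGrad_cutoff_smul (hF : M.IsGeometryMap F r) {ε : ℝ} (hε : 0 < ε)
    (hε2 : ∀ i, 2 * ε < M.ζ i (M.N i) - M.ζ i 0) {v : Phys n → Phys n}
    (hv : MemL2 (M.domain F) v) {G : Fin (n + 1) → Phys n → Phys n}
    (hG : IsWeakGrad (M.domain F) v G) :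
    IsWeakGrad (M.domain F) (fun z => hF.cutoff ε z • v z)
      fun i z => hF.cutoff ε z • G i z + hF.cutoffGrad ε i z • v z := fun i =>
  (hG i).smul_of_locallyLipschitz hF.isOpen_domain (hF.locallyLipschitz_cutoff hε)
    (hF.hasLineDerivAt_cutoff hε hε2 i)
    (hF.locallyIntegrableOn_of_memL2 (hF.memL2_cutoffGrad_smul hε i hv))

/-- Cut-off fields with bounded boundary values belong to `H¹₀`. -/
theorem IsGeometryMap.memH10_cutoff_smul (hF : M.IsGeometryMap F r) {δ : ℝ} (hδ0 : 0 < δ)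
    (hδ : ∀ i, ∀ j < M.N i, δ ≤ M.ζ i (j + 1) - M.ζ i j) {ε : ℝ} (hε : 0 < ε) (hεδ : 2 * ε < δ)
    {v : Phys n → Phys n} (hv : MemL2 (M.domain F) v)
    {G : Fin (n + 1) → Phys n → Phys n} (hG : IsWeakGrad (M.domain F) v G)
    (hG2 : ∀ i, MemL2 (M.domain F) (G i)) {C : ℝ} (hC0 : 0 ≤ C)
    (hC : ∀ i s, ∀ᵐ y ∂(volume.restrict (M.faceDom i)), ∀ t ∈ Set.Ioo 0 δ,
      ‖v (F (M.inward i s t y))‖ ≤ C) :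
    M.MemH10 F fun z => hF.cutoff ε z • v z := by
  refine ⟨⟨hF.memL2_cutoff_smul ε hv, _, hF.isWeakGrad_cutoff_smul hε (two_mul_lt_width hδ hεδ) hv hG,
    fun i => (hF.memL2_cutoff_smul ε (hG2 i)).add (hF.memL2_cutoffGrad_smul hε i hv)⟩,
    fun i s => MemLp.zero, fun i s => ?_⟩
  obtain ⟨A₀, -, hA⟩ := hF.exists_areaFactor_le
  refine tendsto_collarErr_of_uniform (M.measurableSet_faceDom i) (faceDom_volume_lt_top M i)
    (A := fun y => M.areaFactor F i (M.inward i s 0 y))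
    (a := fun t y => hF.cutoff ε (F (M.inward i s t y)) • v (F (M.inward i s t y))) (g := fun _ => 0)
    (fun y hy => hA i _ (inward_mem_closedBox s hy)) fun η hη => ?_
  -- At depth `t` the cut-off field is at most `(t / ε) * C`.
  refine ⟨min δ (ε * η / (C + 1)), lt_min hδ0 (by positivity), ?_⟩
  filter_upwards [hC i s, ae_restrict_mem (M.measurableSet_faceDom i)] with y hy hyS t ht
  have htδ : t ∈ Set.Ioo 0 δ := ⟨ht.1, ht.2.trans_le (min_le_left _ _)⟩
  have ht2 := ht.2.le.trans (min_le_right _ _)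
  rw [le_div_iff₀ (by positivity)] at ht2
  rw [sub_zero, norm_smul, Real.norm_eq_abs, abs_of_nonneg (hF.cutoff_nonneg ε _)]
  refine (mul_le_mul (hF.cutoff_inward_le hε (M.inward_mem_openBox hδ s htδ hyS)) (hy t htδ)
    (norm_nonneg _) (div_nonneg ht.1.le hε.le)).trans ?_
  rw [div_mul_eq_mul_div, div_le_iff₀ hε]
  nlinarith [ht.1]

end CutoffTest

/-! ### The gradient of the cutoff as a collar flux -/

section CutoffFlux

/-- The parametric layer of width `ε` along a face. -/
def layer (M : ParamMesh n) (i : Fin (n + 1)) (s : Bool) (ε : ℝ) : Set (Param n) :=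
  M.openBox ∩ {x | sgn s * (M.bdryCoord i s - x i) < ε}

theorem measurableSet_layer (M : ParamMesh n) (i : Fin (n + 1)) (s : Bool) (ε : ℝ) :
    MeasurableSet (M.layer i s ε) :=
  M.isOpen_openBox.measurableSet.inter (measurableSet_lt
    ((measurable_const.sub (measurable_pi_apply i)).const_mul _) measurable_const)

theorem preimage_layer {δ : ℝ} (hδ : ∀ i, ∀ j < M.N i, δ ≤ M.ζ i (j + 1) - M.ζ i j) {ε : ℝ}
    (hε : ε ≤ δ) (i : Fin (n + 1)) (s : Bool) :
    (fun q : ℝ × (Fin n → ℝ) => ins i (M.bdryCoord i s + (-sgn s) * q.1) q.2) ⁻¹' M.layer i s ε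
      = Set.Ioo 0 ε ×ˢ M.faceDom i := by
  have hw : δ ≤ M.ζ i (M.N i) - M.ζ i 0 := by
    have h1 := hδ i 0 (M.N_pos i)
    have h2 : M.ζ i (0 + 1) ≤ M.ζ i (M.N i) := M.ζ_mono (M.N_pos i) le_rfl
    linarith
  ext ⟨t, y⟩
  have e1 : ins i (M.bdryCoord i s + (-sgn s) * t) y ∈ M.openBox ↔
      M.bdryCoord i s + (-sgn s) * t ∈ Set.Ioo (M.ζ i 0) (M.ζ i (M.N i)) ∧ y ∈ M.faceDom i := by
    rw [openBox, ins_mem_pi_iff, faceDom, Set.mem_univ_pi]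
  have e2 : ins i (M.bdryCoord i s + (-sgn s) * t) y i = M.bdryCoord i s + (-sgn s) * t := by
    simp [ins]
  simp only [layer, Set.mem_preimage, Set.mem_inter_iff, Set.mem_ofPred_eq, Set.mem_prod, e1, e2]
  have h3 : (M.bdryCoord i s + (-sgn s) * t ∈ Set.Ioo (M.ζ i 0) (M.ζ i (M.N i)) ∧
      sgn s * (M.bdryCoord i s - (M.bdryCoord i s + (-sgn s) * t)) < ε) ↔ t ∈ Set.Ioo 0 ε := by
    cases s
    · simp only [sgn, bdryCoord, Set.mem_Ioo, Bool.false_eq_true, if_false]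
      exact ⟨fun h => ⟨by linarith [h.1.1], by linarith [h.2]⟩,
        fun h => ⟨⟨by linarith [h.1], by linarith [h.2]⟩, by linarith [h.2]⟩⟩
    · simp only [sgn, bdryCoord, Set.mem_Ioo, if_true]
      exact ⟨fun h => ⟨by linarith [h.1.2], by linarith [h.2]⟩,
        fun h => ⟨⟨by linarith [h.2], by linarith [h.1]⟩, by linarith [h.2]⟩⟩
  rw [← h3]
  tauto

theorem setIntegral_layer {E : Type*} [NormedAddCommGroup E] [NormedSpace ℝ E]
    {δ : ℝ} (hδ : ∀ i, ∀ j < M.N i, δ ≤ M.ζ i (j + 1) - M.ζ i j)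
    {ε : ℝ} (hε : ε ≤ δ) (i : Fin (n + 1)) (s : Bool) (T : Param n → E) :
    ∫ x in M.layer i s ε, T x = ∫ q, T (M.inward i s q.1 q.2) ∂(slab ε (M.faceDom i)) := by
  have h := (measurePreserving_ins (n := n) i (M.bdryCoord i s)
    (neg_sgn_eq s)).setIntegral_preimage_emb
    (measurableEmbedding_ins i (M.bdryCoord i s) (neg_sgn_eq s)) T (M.layer i s ε)
  rw [preimage_layer hδ hε] at h
  simp_rw [inward_eq, slab_eq]
  exact h.symm

theorem integrable_slab {E : Type*} [NormedAddCommGroup E]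
    {δ : ℝ} (hδ : ∀ i, ∀ j < M.N i, δ ≤ M.ζ i (j + 1) - M.ζ i j)
    {ε : ℝ} (hε : ε ≤ δ) (i : Fin (n + 1)) (s : Bool) {T : Param n → E}
    (hT : IntegrableOn T M.openBox) :
    Integrable (fun q : ℝ × (Fin n → ℝ) => T (M.inward i s q.1 q.2)) (slab ε (M.faceDom i)) := by
  have h := (measurePreserving_ins (n := n) i (M.bdryCoord i s)
    (neg_sgn_eq s)).integrableOn_comp_preimage (s := M.layer i s ε) (f := T)
    (measurableEmbedding_ins i (M.bdryCoord i s) (neg_sgn_eq s))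
  rw [preimage_layer hδ hε] at h
  simp_rw [inward_eq, slab_eq]
  exact h.2 (hT.mono_set Set.inter_subset_left)

theorem IsGeometryMap.integrableOn_comp (hF : M.IsGeometryMap F r) {E : Type*}
    [NormedAddCommGroup E] {H : Phys n → E} (hH : IntegrableOn H (M.domain F)) :
    IntegrableOn (fun x => H (F x)) M.openBox := by
  obtain ⟨C, hC⟩ := hF.map_volume_le
  exact ((Integrable.smul_measure hH (c := C) ENNReal.coe_ne_top).mono_measure hC).comp_aemeasurable
    hF.aemeasurable

/-- The flux density of a field through the parametric hyperplanes, weighted by the cutoff in the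
other directions. -/
def sideFlux (M : ParamMesh n) (F : Param n → Phys n) (ε : ℝ) (H : Phys n → Phys n)
    (l : Fin (n + 1)) (x : Param n) : ℝ :=
  M.sideProfile ε l x * inner ℝ (M.areaVec F l x) (H (F x))

theorem IsGeometryMap.integrableOn_flux (hF : M.IsGeometryMap F r)
    {H : Phys n → Phys n} (hH : IntegrableOn H (M.domain F)) (l : Fin (n + 1)) :
    IntegrableOn (fun x => (inner ℝ (M.areaVec F l x) (H (F x)) : ℝ)) M.openBox := by
  obtain ⟨C, -, hC⟩ := hF.exists_norm_areaVec_le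
  have hHF := hF.integrableOn_comp hH
  refine Integrable.mono' (hHF.norm.const_mul C) ?_ ?_
  · exact (((hF.continuousOn_areaVec l).mono M.openBox_subset_closedBox).aestronglyMeasurable
      M.isOpen_openBox.measurableSet).inner hHF.aestronglyMeasurable
  · filter_upwards [ae_restrict_mem M.isOpen_openBox.measurableSet] with x hx
    exact (norm_inner_le_norm _ _).trans (mul_le_mul_of_nonneg_right
      (hC l x (M.openBox_subset_closedBox hx)) (norm_nonneg _))

theorem IsGeometryMap.integrableOn_sideFlux (hF : M.IsGeometryMap F r) (ε : ℝ)
    {H : Phys n → Phys n} (hH : IntegrableOn H (M.domain F)) (l : Fin (n + 1)) :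
    IntegrableOn (M.sideFlux F ε H l) M.openBox := by
  have h := hF.integrableOn_flux hH l
  refine Integrable.mono h ((M.continuous_sideProfile ε l).aestronglyMeasurable.mul
    h.aestronglyMeasurable) (Eventually.of_forall fun x => ?_)
  rw [sideFlux, norm_mul, Real.norm_eq_abs, abs_of_nonneg (M.sideProfile_nonneg ε l x)]
  exact mul_le_of_le_one_left (norm_nonneg _) (M.sideProfile_le_one ε l x)

/-- By the chain rule the gradient of the cutoff is a combination of the rows `(DF)^{-T} e_l`. The
Jacobian determinant from the change of variables turns them into the area vectors of the coordinate
hyperplanes. -/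
theorem det_mul_profileGrad (M : ParamMesh n) (F : Param n → Phys n) (ε : ℝ) (H : Phys n)
    (x : Param n) : |(M.jac F x).det| * ∑ i, M.profileGrad F ε i x * H i
      = ∑ l, rampDeriv (M.ζ l 0) (M.ζ l (M.N l)) ε (x l)
          * (M.sideProfile ε l x * inner ℝ (M.areaVec F l x) H) := by
  have e1 : ∀ l, (inner ℝ (M.areaVec F l x) H : ℝ)
      = |(M.jac F x).det| * ∑ i, (M.jac F x)⁻¹ l i * H i := fun l => by
    rw [areaVec, real_inner_smul_left, PiLp.inner_apply]
    simp [conormal, mul_comm]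
  simp_rw [e1, profileGrad, Finset.sum_mul, Finset.mul_sum]
  rw [Finset.sum_comm]
  exact Finset.sum_congr rfl fun l _ => Finset.sum_congr rfl fun i _ => by ring

/-- Testing a field with the gradient of the cutoff gives its mean flux through the collars of the
boundary. -/
theorem IsGeometryMap.integral_cutoffGrad (hF : M.IsGeometryMap F r) {δ : ℝ}
    (hδ : ∀ i, ∀ j < M.N i, δ ≤ M.ζ i (j + 1) - M.ζ i j) {ε : ℝ} (hε : 0 < ε) (hεδ : 2 * ε < δ)
    {H : Phys n → Phys n} (hH : IntegrableOn H (M.domain F)) :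
    ∫ z in M.domain F, ∑ i, hF.cutoffGrad ε i z * H z i
      = -(ε⁻¹ * ∑ l, ∑ s : Bool, sgn s *
          ∫ q, M.sideFlux F ε H l (M.inward l s q.1 q.2) ∂(slab ε (M.faceDom l))) := by
  have hBm := M.isOpen_openBox.measurableSet
  rw [domain, hF.setIntegral_image hBm subset_rfl]
  have h1 : ∀ x ∈ M.openBox, |(M.jac F x).det| • ∑ i, hF.cutoffGrad ε i (F x) * H (F x) i
      = ∑ l, rampDeriv (M.ζ l 0) (M.ζ l (M.N l)) ε (x l) * M.sideFlux F ε H l x := fun x hx => by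
    have := M.det_mul_profileGrad F ε (H (F x)) x
    simp only [cutoffGrad, hF.homeo_symm_apply hx, smul_eq_mul]
    exact this
  rw [setIntegral_congr_fun hBm h1]
  have hTi := hF.integrableOn_sideFlux ε hH
  have hL : ∀ l s, ∫ q, M.sideFlux F ε H l (M.inward l s q.1 q.2) ∂(slab ε (M.faceDom l))
      = ∫ x in M.openBox, (M.layer l s ε).indicator (M.sideFlux F ε H l) x := fun l s => by
    rw [← setIntegral_layer hδ (by linarith), setIntegral_indicator (M.measurableSet_layer l s ε)]
    congr 2
    exact (Set.inter_eq_right.2 Set.inter_subset_left).symm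
  -- The ramp derivative is `1/ε` on the lower layer and `-1/ε` on the upper one; `2 * ε < δ` keeps
  -- the two layers disjoint.
  have h2 : ∀ l, ∀ x ∈ M.openBox,
      rampDeriv (M.ζ l 0) (M.ζ l (M.N l)) ε (x l) * M.sideFlux F ε H l x
        = ε⁻¹ * (M.layer l false ε).indicator (M.sideFlux F ε H l) x
          - ε⁻¹ * (M.layer l true ε).indicator (M.sideFlux F ε H l) x := fun l x hx => by
    have hw := two_mul_lt_width hδ hεδ l
    have m1 : x ∈ M.layer l false ε ↔ x l < M.ζ l 0 + ε := by
      simp only [layer, Set.mem_inter_iff, hx, true_and, Set.mem_ofPred_eq, sgn, bdryCoord]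
      simp only [Bool.false_eq_true, if_false]
      constructor <;> intro h <;> linarith
    have m2 : x ∈ M.layer l true ε ↔ M.ζ l (M.N l) - ε < x l := by
      simp only [layer, Set.mem_inter_iff, hx, true_and, Set.mem_ofPred_eq, sgn, bdryCoord, if_true]
      constructor <;> intro h <;> linarith
    by_cases a : x l < M.ζ l 0 + ε
    · have b : ¬ M.ζ l (M.N l) - ε < x l := by linarith
      rw [Set.indicator_of_mem (m1.2 a), Set.indicator_of_notMem (mt m2.1 b), rampDeriv, if_pos a]
      ring
    · rw [Set.indicator_of_notMem (mt m1.1 a), rampDeriv, if_neg a]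
      by_cases b : M.ζ l (M.N l) - ε < x l
      · rw [Set.indicator_of_mem (m2.2 b), if_pos b]; ring
      · rw [Set.indicator_of_notMem (mt m2.1 b), if_neg b]; ring
  rw [integral_finsetSum]
  · rw [Finset.mul_sum, ← Finset.sum_neg_distrib]
    refine Finset.sum_congr rfl fun l _ => ?_
    rw [setIntegral_congr_fun hBm (h2 l), integral_sub, integral_const_mul, integral_const_mul,
      ← hL, ← hL]
    · simp only [Fintype.sum_bool, sgn]
      simp only [if_true, Bool.false_eq_true, if_false]
      ring
    · exact ((hTi l).indicator (M.measurableSet_layer l false ε)).const_mul _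
    · exact ((hTi l).indicator (M.measurableSet_layer l true ε)).const_mul _
  · intro l _
    refine Integrable.mono' ((hTi l).norm.const_mul ε⁻¹) ?_ (Eventually.of_forall fun x => ?_)
    · exact (measurable_rampDeriv.comp (measurable_pi_apply l)).aestronglyMeasurable.mul
        (hTi l).aestronglyMeasurable
    · rw [norm_mul]
      exact mul_le_mul_of_nonneg_right (abs_rampDeriv_le hε) (norm_nonneg _)

end CutoffFlux

end ParamMesh

end SkeletonStab

namespace SkeletonStab

namespace ParamMesh

/-! ### Integrals over shrinking collars -/

section SlabLimits

variable {n : ℕ} {S : Set (Fin n → ℝ)}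

/-- Absolute continuity of the integral: the measure of the slab is at most `ε` times that of the
face. -/
theorem tendsto_lintegral_slab (hS : volume S < ⊤) {δ : ℝ} (hδ : 0 < δ)
    {f : ℝ × (Fin n → ℝ) → ENNReal} (hf : ∫⁻ q, f q ∂(slab δ S) ≠ ⊤) :
    Tendsto (fun ε : ℝ => ∫⁻ q, f q ∂(slab ε S)) (𝓝[>] 0) (𝓝 0) := by
  have h1 : Tendsto (slab δ S ∘ fun ε : ℝ => Set.Ioo 0 ε ×ˢ Set.univ) (𝓝[>] 0) (𝓝 0) := by
    have h2 : Tendsto (fun ε : ℝ => ENNReal.ofReal ε * volume S) (𝓝[>] 0) (𝓝 0) := by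
      have := ENNReal.Tendsto.mul_const (b := volume S)
        ((ENNReal.continuous_ofReal.tendsto (0 : ℝ)).mono_left (nhdsWithin_le_nhds (s := Set.Ioi 0)))
        (Or.inr hS.ne)
      simpa using this
    refine tendsto_of_tendsto_of_tendsto_of_le_of_le tendsto_const_nhds h2 (fun _ => zero_le)
      fun ε => ?_
    simp only [Function.comp, slab, Measure.prod_prod, Measure.restrict_apply_univ]
    refine mul_le_mul_left ?_ _
    refine (Measure.restrict_apply_le _ _).trans ?_
    rw [Real.volume_Ioo, sub_zero]
  refine (tendsto_setLIntegral_zero hf h1).congr' ?_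
  filter_upwards [Ioo_mem_nhdsGT hδ] with ε hε
  rw [slab_eq, slab_eq, Measure.restrict_restrict (measurableSet_Ioo.prod MeasurableSet.univ),
    Set.prod_inter_prod, Set.univ_inter, Set.inter_eq_left.2 (Set.Ioo_subset_Ioo le_rfl hε.2.le)]

theorem ae_slab_mem (hS : MeasurableSet S) (ε : ℝ) :
    ∀ᵐ q ∂(slab ε S), q.1 ∈ Set.Ioo 0 ε ∧ q.2 ∈ S := by
  rw [slab_eq]
  exact (ae_restrict_mem (measurableSet_Ioo.prod hS)).mono fun q hq => hq

theorem ae_slab_snd {P : (Fin n → ℝ) → Prop} (h : ∀ᵐ y ∂(volume.restrict S), P y) (ε : ℝ) :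
    ∀ᵐ q ∂(slab ε S), P q.2 := Measure.quasiMeasurePreserving_snd.ae h

end SlabLimits

variable {n : ℕ} {M : ParamMesh n} {F : Param n → Phys n} {r : ℕ}

/-! ### Vanishing of the convective and pressure fluxes -/

section FluxLimits

theorem ae_inward (hF : M.IsGeometryMap F r) {P : Phys n → Prop}
    (hP : ∀ᵐ z ∂(volume.restrict (M.domain F)), P z)
    {δ : ℝ} (hδ : ∀ i, ∀ j < M.N i, δ ≤ M.ζ i (j + 1) - M.ζ i j) (i : Fin (n + 1)) (s : Bool) :
    ∀ᵐ q ∂(slab δ (M.faceDom i)), P (F (M.inward i s q.1 q.2)) := by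
  simp_rw [inward_eq]
  exact ae_comp_ins hF hP i _ (neg_sgn_eq s) fun t ht y hy => by
    rw [← inward_eq]; exact M.inward_mem_openBox hδ s ht hy

theorem memLp_inward (hF : M.IsGeometryMap F r) {E : Type*} [NormedAddCommGroup E] {p : ENNReal}
    {g : Phys n → E} (hg : MemLp g p (volume.restrict (M.domain F)))
    {δ : ℝ} (hδ : ∀ i, ∀ j < M.N i, δ ≤ M.ζ i (j + 1) - M.ζ i j) (i : Fin (n + 1)) (s : Bool) :
    MemLp (fun q : ℝ × (Fin n → ℝ) => g (F (M.inward i s q.1 q.2))) p (slab δ (M.faceDom i)) := by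
  simp_rw [inward_eq]
  exact memLp_comp_ins hF hg i _ (neg_sgn_eq s) fun t ht y hy => by
    rw [← inward_eq]; exact M.inward_mem_openBox hδ s ht hy

theorem enorm_sum_collar_le {ε : ℝ} (hε : 0 < ε) (f : Fin (n + 1) → Bool → ℝ × (Fin n → ℝ) → ℝ) :
    ‖ε⁻¹ * ∑ l, ∑ s : Bool, sgn s * ∫ q, f l s q ∂(slab ε (M.faceDom l))‖ₑ
      ≤ ∑ l, ∑ s : Bool, ENNReal.ofReal ε⁻¹ * ∫⁻ q, ‖f l s q‖ₑ ∂(slab ε (M.faceDom l)) := by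
  rw [enorm_mul, Real.enorm_of_nonneg (inv_nonneg.2 hε.le)]
  simp_rw [← Finset.mul_sum]
  refine mul_le_mul_right ((enorm_sum_le _ _).trans (Finset.sum_le_sum fun l _ =>
    (enorm_sum_le _ _).trans (Finset.sum_le_sum fun s _ => ?_))) _
  have : ‖sgn s‖ₑ = 1 := by cases s <;> simp [sgn]
  rw [enorm_mul, this, one_mul]
  exact enorm_integral_le_lintegral_enorm _

/-- A sum of mean integrals over collars tends to zero with the mean integrals of the modulus. -/
theorem tendsto_sum_collar {f : ℝ → Fin (n + 1) → Bool → ℝ × (Fin n → ℝ) → ℝ}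
    (h : ∀ l s, Tendsto (fun ε : ℝ => ENNReal.ofReal ε⁻¹ *
      ∫⁻ q, ‖f ε l s q‖ₑ ∂(slab ε (M.faceDom l))) (𝓝[>] 0) (𝓝 0)) :
    Tendsto (fun ε : ℝ => ε⁻¹ * ∑ l, ∑ s : Bool, sgn s * ∫ q, f ε l s q ∂(slab ε (M.faceDom l)))
      (𝓝[>] 0) (𝓝 0) := by
  rw [tendsto_zero_iff_enorm_tendsto_zero]
  have h2 : Tendsto (fun ε : ℝ => ∑ l, ∑ s : Bool, ENNReal.ofReal ε⁻¹ *
      ∫⁻ q, ‖f ε l s q‖ₑ ∂(slab ε (M.faceDom l))) (𝓝[>] 0) (𝓝 0) := by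
    have := tendsto_finsetSum Finset.univ fun l _ =>
      tendsto_finsetSum (Finset.univ : Finset Bool) fun s _ => h l s
    simpa using this
  refine tendsto_of_tendsto_of_tendsto_of_le_of_le' tendsto_const_nhds h2
    (Eventually.of_forall fun _ => zero_le) ?_
  filter_upwards [self_mem_nhdsWithin] with ε hε
  exact enorm_sum_collar_le hε _

theorem enorm_sideFlux_le (ε : ℝ) (H : Phys n → Phys n) (l : Fin (n + 1)) (x : Param n) :
    ‖M.sideFlux F ε H l x‖ₑ ≤ ‖(inner ℝ (M.areaVec F l x) (H (F x)) : ℝ)‖ₑ := by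
  rw [sideFlux, enorm_mul]
  refine mul_le_of_le_one_left zero_le ?_
  rw [Real.enorm_of_nonneg (M.sideProfile_nonneg ε l x)]
  exact ENNReal.ofReal_le_one.2 (M.sideProfile_le_one ε l x)

/-- If the mean flux through the collars tends to zero, then so does the integral against the
gradient of the cutoff. -/
theorem IsGeometryMap.tendsto_integral_cutoffGrad (hF : M.IsGeometryMap F r) {δ : ℝ} (hδ0 : 0 < δ)
    (hδ : ∀ i, ∀ j < M.N i, δ ≤ M.ζ i (j + 1) - M.ζ i j)
    {H : Phys n → Phys n} (hH : IntegrableOn H (M.domain F))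
    (h : ∀ l s, Tendsto (fun ε : ℝ => ENNReal.ofReal ε⁻¹ *
      ∫⁻ q, ‖(inner ℝ (M.areaVec F l (M.inward l s q.1 q.2)) (H (F (M.inward l s q.1 q.2))) : ℝ)‖ₑ
        ∂(slab ε (M.faceDom l))) (𝓝[>] 0) (𝓝 0)) :
    Tendsto (fun ε => ∫ z in M.domain F, ∑ i, hF.cutoffGrad ε i z * H z i) (𝓝[>] 0) (𝓝 0) := by
  have h1 := (tendsto_sum_collar (M := M)
    (f := fun ε l s q => M.sideFlux F ε H l (M.inward l s q.1 q.2)) fun l s =>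
    tendsto_of_tendsto_of_tendsto_of_le_of_le tendsto_const_nhds (h l s) (fun _ => zero_le) fun ε =>
      mul_le_mul_right (lintegral_mono fun q => enorm_sideFlux_le ε H l _) _).neg
  rw [neg_zero] at h1
  refine h1.congr' ?_
  filter_upwards [Ioo_mem_nhdsGT (show (0 : ℝ) < δ / 2 by positivity)] with ε hε
  exact (hF.integral_cutoffGrad hδ hε.1 (by linarith [hε.2]) hH).symm

/-- A field dominated by the square of a field of zero trace has no mean flux in the limit. -/
theorem IsGeometryMap.tendsto_cutoffGrad_of_sq (hF : M.IsGeometryMap F r)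
    {u H : Phys n → Phys n} (hH : IntegrableOn H (M.domain F)) (hu : MemL2 (M.domain F) u)
    (hu0 : M.IsTrace F u 0) {C : ℝ}
    (hC : ∀ᵐ z ∂(volume.restrict (M.domain F)), ‖H z‖ ≤ C * ‖u z‖ ^ 2) :
    Tendsto (fun ε => ∫ z in M.domain F, ∑ i, hF.cutoffGrad ε i z * H z i) (𝓝[>] 0) (𝓝 0) := by
  obtain ⟨δ, hδ0, hδ⟩ := M.exists_mesh_width
  refine hF.tendsto_integral_cutoffGrad hδ0 hδ hH fun l s => ?_
  obtain ⟨C₁, hC10, hC1⟩ := hF.exists_norm_areaVec_le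
  -- A lower bound for the area factor, needed to insert the surface weight with which the trace of
  -- `u` is measured.
  obtain ⟨C₂, hC2⟩ := M.isCompact_closedBox.exists_bound_of_continuousOn
    ((hF.continuousOn_areaFactor l).inv₀ fun x hx => (hF.areaFactor_pos l hx).ne')
  have hC2' : ∀ x ∈ M.closedBox, 1 ≤ |C₂| * M.areaFactor F l x := fun x hx => by
    have h0 := hF.areaFactor_pos l hx
    have h1 := (le_abs_self _).trans ((hC2 x hx).trans (le_abs_self _))
    simp only [Pi.inv_apply] at h1
    rwa [inv_le_iff_one_le_mul₀ h0] at h1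
  set K := C₁ * |C| * |C₂| with hK
  have ht := hu0.2 l s
  have h2 : Tendsto (fun ε => ENNReal.ofReal K * collarErr (M.faceDom l)
      (fun y => M.areaFactor F l (M.inward l s 0 y)) (fun t y => u (F (M.inward l s t y)))
      (fun y => 0) ε) (𝓝[>] 0) (𝓝 0) := by
    have := ENNReal.Tendsto.const_mul (a := ENNReal.ofReal K) ht (Or.inr ENNReal.ofReal_ne_top)
    rwa [mul_zero] at this
  refine tendsto_of_tendsto_of_tendsto_of_le_of_le' tendsto_const_nhds h2
    (Eventually.of_forall fun _ => zero_le) ?_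
  filter_upwards [Ioo_mem_nhdsGT hδ0] with ε hε
  have hsl := (Measure.absolutelyContinuous_of_le (slab_mono (S := M.faceDom l) hε.2.le)).ae_le
  rw [collarErr_eq]
  · rw [mul_left_comm (ENNReal.ofReal K),
      ← lintegral_const_mul' (ENNReal.ofReal K) _ ENNReal.ofReal_ne_top]
    refine mul_le_mul_right (lintegral_mono_ae ?_) _
    filter_upwards [hsl (ae_inward hF hC hδ l s), ae_slab_mem (M.measurableSet_faceDom l) ε]
      with q hq hqm
    have hm := M.inward_mem_openBox hδ s ⟨hqm.1.1, hqm.1.2.trans hε.2⟩ hqm.2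
    have hA := hF.areaFactor_pos l (inward_mem_closedBox s hqm.2)
    rw [sub_zero, enorm_sq_eq_ofReal, ← ENNReal.ofReal_mul (by positivity),
      ← ENNReal.ofReal_mul (by positivity), ← ofReal_norm]
    refine ENNReal.ofReal_le_ofReal ((norm_inner_le_norm _ _).trans ?_)
    have e1 := hC1 l _ (M.openBox_subset_closedBox hm)
    have e2 : ‖H (F (M.inward l s q.1 q.2))‖ ≤ |C| * ‖u (F (M.inward l s q.1 q.2))‖ ^ 2 :=
      hq.trans (mul_le_mul_of_nonneg_right (le_abs_self C) (by positivity))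
    have e3 := hC2' _ (inward_mem_closedBox s hqm.2)
    calc _ ≤ C₁ * (|C| * ‖u (F (M.inward l s q.1 q.2))‖ ^ 2) :=
          mul_le_mul e1 e2 (norm_nonneg _) hC10
      _ ≤ C₁ * (|C| * ‖u (F (M.inward l s q.1 q.2))‖ ^ 2)
            * (|C₂| * M.areaFactor F l (M.inward l s 0 q.2)) :=
          le_mul_of_one_le_right (by positivity) e3
      _ = _ := by rw [hK]; ring
  · exact (aestronglyMeasurable_inward hF hu.1 hδ l s subset_rfl).mono_measure (slab_mono hε.2.le)
  · exact aestronglyMeasurable_const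
  · simp only [inward_zero]
    exact hF.aemeasurable_areaFactor_ins (M.bdryCoord_mem l s) (M.measurableSet_faceDom l) subset_rfl

/-- An integrable multiple of a cellwise smooth field with vanishing normal trace has no mean flux
in the limit. -/
theorem IsGeometryMap.tendsto_cutoffGrad_of_normal (hF : M.IsGeometryMap F r)
    {p : Phys n → ℝ} {v : Phys n → Phys n} (hp : IntegrableOn p (M.domain F))
    (hpv : IntegrableOn (fun z => p z • v z) (M.domain F))
    {δ : ℝ} (hδ0 : 0 < δ) (hδ : ∀ i, ∀ j < M.N i, δ ≤ M.ζ i (j + 1) - M.ζ i j) {C : ℝ}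
    (hC0 : 0 ≤ C)
    (hC : ∀ i s, ∀ᵐ y ∂(volume.restrict (M.faceDom i)), ∀ t ∈ Set.Ioo 0 δ,
      |(inner ℝ (M.areaVec F i (M.inward i s t y)) (v (F (M.inward i s t y))) : ℝ)| ≤ C * t) :
    Tendsto (fun ε => ∫ z in M.domain F, ∑ i, hF.cutoffGrad ε i z * (p z • v z) i)
      (𝓝[>] 0) (𝓝 0) := by
  refine hF.tendsto_integral_cutoffGrad hδ0 hδ hpv fun l s => ?_
  have h1 : ∫⁻ q, ‖p (F (M.inward l s q.1 q.2))‖ₑ ∂(slab δ (M.faceDom l)) ≠ ⊤ :=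
    ((memLp_one_iff_integrable.1 (memLp_inward hF (memLp_one_iff_integrable.2 hp) hδ l s)).2).ne
  -- The flux is at most `C * t * |p|` with `t < ε`, so the factor `1/ε` is absorbed and only `|p|`
  -- over a shrinking collar remains.
  have h2 := ENNReal.Tendsto.const_mul (a := ENNReal.ofReal C)
    (tendsto_lintegral_slab (faceDom_volume_lt_top M l) hδ0 h1) (Or.inr ENNReal.ofReal_ne_top)
  rw [mul_zero] at h2
  refine tendsto_of_tendsto_of_tendsto_of_le_of_le' tendsto_const_nhds h2
    (Eventually.of_forall fun _ => zero_le) ?_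
  filter_upwards [Ioo_mem_nhdsGT hδ0] with ε hε
  rw [← lintegral_const_mul' _ _ ENNReal.ofReal_ne_top,
    ← lintegral_const_mul' _ _ ENNReal.ofReal_ne_top]
  refine lintegral_mono_ae ?_
  filter_upwards [ae_slab_snd (hC l s) ε, ae_slab_mem (M.measurableSet_faceDom l) ε] with q hq hqm
  have e1 := hq q.1 ⟨hqm.1.1, hqm.1.2.trans hε.2⟩
  rw [← ofReal_norm, ← ofReal_norm, ← ENNReal.ofReal_mul (inv_nonneg.2 hε.1.le),
    ← ENNReal.ofReal_mul hC0]
  refine ENNReal.ofReal_le_ofReal ?_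
  rw [real_inner_smul_right, norm_mul, Real.norm_eq_abs (inner ℝ _ _), ← mul_assoc, mul_comm ε⁻¹,
    mul_assoc, mul_comm C]
  refine mul_le_mul_of_nonneg_left ?_ (norm_nonneg _)
  rw [inv_mul_le_iff₀ hε.1]
  refine e1.trans ?_
  rw [mul_comm ε]
  exact mul_le_mul_of_nonneg_left hqm.1.2.le hC0

end FluxLimits

end ParamMesh

end SkeletonStab

namespace SkeletonStab

/-! ### Tensor–vector products -/

section MatVec

variable {n : ℕ}

/-- The product `σ v` of a tensor and a vector. -/
def matVec (σ : Matrix (Fin (n + 1)) (Fin (n + 1)) ℝ) (v : Phys n) : Phys n :=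
  WithLp.toLp 2 (σ.mulVec (WithLp.ofLp v))

/-- The sum of the moduli of the entries of a tensor. -/
def entrySum (σ : Matrix (Fin (n + 1)) (Fin (n + 1)) ℝ) : ℝ := ∑ i, ∑ j, |σ i j|

theorem entrySum_nonneg (σ : Matrix (Fin (n + 1)) (Fin (n + 1)) ℝ) : 0 ≤ entrySum σ :=
  Finset.sum_nonneg fun _ _ => Finset.sum_nonneg fun _ _ => abs_nonneg _

theorem matVec_apply (σ : Matrix (Fin (n + 1)) (Fin (n + 1)) ℝ) (v : Phys n) (i : Fin (n + 1)) :
    matVec σ v i = ∑ j, σ i j * v j := rfl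

theorem inner_matVec (w : Phys n) (σ : Matrix (Fin (n + 1)) (Fin (n + 1)) ℝ) (v : Phys n) :
    (inner ℝ w (matVec σ v) : ℝ) = ∑ i, ∑ j, w i * σ i j * v j := by
  rw [PiLp.inner_apply]
  refine Finset.sum_congr rfl fun i _ => ?_
  rw [matVec_apply, RCLike.inner_apply, conj_trivial, Finset.sum_mul]
  exact Finset.sum_congr rfl fun j _ => by ring

theorem inner_contract (w : Phys n) (σ : Matrix (Fin (n + 1)) (Fin (n + 1)) ℝ) (v : Phys n) :
    (inner ℝ (ParamMesh.contract w σ) v : ℝ) = inner ℝ w (matVec σ v) := by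
  rw [inner_matVec, PiLp.inner_apply, Finset.sum_comm]
  refine Finset.sum_congr rfl fun i _ => ?_
  simp [ParamMesh.contract, Finset.mul_sum, mul_comm]

theorem matVec_sub (σ : Matrix (Fin (n + 1)) (Fin (n + 1)) ℝ) (v w : Phys n) :
    matVec σ (v - w) = matVec σ v - matVec σ w := by
  ext i
  simp [matVec_apply, mul_sub]

theorem abs_inner_matVec_le (w : Phys n) (σ : Matrix (Fin (n + 1)) (Fin (n + 1)) ℝ) (v : Phys n) :
    |(inner ℝ w (matVec σ v) : ℝ)| ≤ entrySum σ * (‖w‖ * ‖v‖) := by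
  rw [inner_matVec, entrySum, Finset.sum_mul]
  refine (Finset.abs_sum_le_sum_abs _ _).trans (Finset.sum_le_sum fun i _ => ?_)
  rw [Finset.sum_mul]
  refine (Finset.abs_sum_le_sum_abs _ _).trans (Finset.sum_le_sum fun j _ => ?_)
  rw [abs_mul, abs_mul, mul_comm |w i|, mul_assoc]
  exact mul_le_mul_of_nonneg_left (mul_le_mul (PiLp.norm_apply_le w i) (PiLp.norm_apply_le v j)
    (abs_nonneg _) (norm_nonneg _)) (abs_nonneg _)

theorem memL2_entrySum {Ω : Set (Phys n)} {σ : Phys n → Matrix (Fin (n + 1)) (Fin (n + 1)) ℝ}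
    (hσ : ∀ i j, MemL2 Ω fun z => σ z i j) : MemL2 Ω fun z => entrySum (σ z) :=
  memLp_finsetSum _ fun i _ => memLp_finsetSum _ fun j _ => (hσ i j).abs

theorem aestronglyMeasurable_inner_matVec {α : Type*} [MeasurableSpace α] {μ : Measure α}
    {w v : α → Phys n} {σ : α → Matrix (Fin (n + 1)) (Fin (n + 1)) ℝ}
    (hw : AEStronglyMeasurable w μ) (hσ : ∀ i j, AEStronglyMeasurable (fun a => σ a i j) μ)
    (hv : AEStronglyMeasurable v μ) :
    AEStronglyMeasurable (fun a => (inner ℝ (w a) (matVec (σ a) (v a)) : ℝ)) μ := by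
  simp_rw [inner_matVec]
  have hc : ∀ (i : Fin (n + 1)) {f : α → Phys n}, AEStronglyMeasurable f μ →
      AEStronglyMeasurable (fun a => f a i) μ := fun i f hf =>
    (EuclideanSpace.proj (𝕜 := ℝ) i).continuous.comp_aestronglyMeasurable hf
  exact Finset.aestronglyMeasurable_fun_sum _ fun i _ =>
    Finset.aestronglyMeasurable_fun_sum _ fun j _ => ((hc i hw).mul (hσ i j)).mul (hc j hv)

end MatVec

namespace ParamMesh

variable {n : ℕ} {M : ParamMesh n} {F : Param n → Phys n} {r : ℕ}

/-! ### The tangential cutoff defect -/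

section Pairing

/-- Near the edges of a face the cutoff in the tangential directions differs from one only on a set
of small measure. -/
theorem exists_volume_sideProfile_le (M : ParamMesh n) (l : Fin (n + 1)) :
    ∃ K : ENNReal, K ≠ ⊤ ∧ ∀ ε : ℝ, 0 < ε → ∃ B : Set (Fin n → ℝ),
      volume.restrict (M.faceDom l) B ≤ K * ENNReal.ofReal ε ∧
      ∀ y ∉ B, ∀ a, M.sideProfile ε l (ins l a y) = 1 := by
  set μ : Fin n → Measure ℝ := fun k => volume.restrict
    (Set.Ioo (M.ζ (l.succAbove k) 0) (M.ζ (l.succAbove k) (M.N (l.succAbove k)))) with hμ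
  have hface : volume.restrict (M.faceDom l) = Measure.pi μ := by
    rw [faceDom, volume_pi, Measure.restrict_pi_pi]
  set c : Fin n → ENNReal := fun k => ∏ j ∈ Finset.univ.erase k, μ j Set.univ with hc
  have hc0 : ∀ k, c k ≠ ⊤ := fun k => ENNReal.prod_ne_top fun j _ => by simp [hμ]
  refine ⟨∑ k, c k * 2, ENNReal.sum_ne_top.2 fun k _ =>
    ENNReal.mul_ne_top (hc0 k) ENNReal.ofNat_ne_top, fun ε hε => ?_⟩
  -- The two end strips in which the ramp in one tangential direction may differ from one; their
  -- length `2ε` gives the factor `2` in the constant.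
  set T : Fin n → Set ℝ := fun k => Set.Iio (M.ζ (l.succAbove k) 0 + ε) ∪
    Set.Ioi (M.ζ (l.succAbove k) (M.N (l.succAbove k)) - ε) with hT
  have hTm : ∀ k, MeasurableSet (T k) := fun k => measurableSet_Iio.union measurableSet_Ioi
  refine ⟨⋃ k, Function.eval k ⁻¹' T k, ?_, fun y hy a => ?_⟩
  · rw [hface]
    refine (measure_iUnion_fintype_le _ _).trans ?_
    rw [Finset.sum_mul]
    refine Finset.sum_le_sum fun k _ => ?_
    rw [← Measure.map_apply (measurable_pi_apply k) (hTm k), Measure.pi_map_eval,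
      Measure.smul_apply, smul_eq_mul, mul_assoc]
    refine mul_le_mul_right ?_ _
    rw [hμ, Measure.restrict_apply (hTm k)]
    have hsub : T k ∩ Set.Ioo (M.ζ (l.succAbove k) 0) (M.ζ (l.succAbove k) (M.N (l.succAbove k)))
        ⊆ Set.Ioo (M.ζ (l.succAbove k) 0) (M.ζ (l.succAbove k) 0 + ε) ∪
          Set.Ioo (M.ζ (l.succAbove k) (M.N (l.succAbove k)) - ε)
            (M.ζ (l.succAbove k) (M.N (l.succAbove k))) := by
      rintro x ⟨h1 | h1, h2⟩
      · exact Or.inl ⟨h2.1, h1⟩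
      · exact Or.inr ⟨h1, h2.2⟩
    refine (measure_mono hsub).trans ((measure_union_le _ _).trans_eq ?_)
    rw [Real.volume_Ioo, Real.volume_Ioo, add_sub_cancel_left, sub_sub_cancel, two_mul]
  · refine Finset.prod_eq_one fun i hi => ?_
    obtain ⟨k, rfl⟩ := Fin.exists_succAbove_eq (Finset.ne_of_mem_erase hi)
    have : y k ∉ T k := fun h => hy (Set.mem_iUnion.2 ⟨k, h⟩)
    simp only [hT, Set.mem_union, Set.mem_Iio, Set.mem_Ioi, not_or, not_lt] at this
    refine ramp_eq_one hε ?_ ?_ <;> simp only [ins, Fin.insertNth_apply_succAbove]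
    · exact this.1
    · exact this.2

/-- The mean integral over a collar of a square integrable function against the tangential cutoff
defect tends to zero. -/
theorem tendsto_lintegral_sideProfile_defect (l : Fin (n + 1)) (s : Bool) {δ : ℝ} (hδ0 : 0 < δ)
    {f : ℝ × (Fin n → ℝ) → ENNReal} (hf : AEMeasurable f (slab δ (M.faceDom l)))
    (hf2 : ∫⁻ q, f q ^ 2 ∂(slab δ (M.faceDom l)) ≠ ⊤) :
    Tendsto (fun ε : ℝ => ENNReal.ofReal ε⁻¹ *
      ∫⁻ q, f q * ENNReal.ofReal (1 - M.sideProfile ε l (M.inward l s q.1 q.2))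
        ∂(slab ε (M.faceDom l))) (𝓝[>] 0) (𝓝 0) := by
  obtain ⟨K, hK, hB⟩ := M.exists_volume_sideProfile_le l
  have h1 := tendsto_lintegral_slab (faceDom_volume_lt_top M l) hδ0 hf2
  have h2 : Tendsto (fun ε : ℝ => (∫⁻ q, f q ^ 2 ∂(slab ε (M.faceDom l))) ^ (1 / 2 : ℝ)
      * K ^ (1 / 2 : ℝ)) (𝓝[>] 0) (𝓝 0) := by
    have h3 := ENNReal.Tendsto.mul_const (b := K ^ (1 / 2 : ℝ)) (h1.ennrpow_const (1 / 2))
      (Or.inr (ENNReal.rpow_ne_top_of_nonneg (by norm_num) hK))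
    rwa [ENNReal.zero_rpow_of_pos (by norm_num), zero_mul] at h3
  refine tendsto_of_tendsto_of_tendsto_of_le_of_le' tendsto_const_nhds h2
    (Eventually.of_forall fun _ => zero_le) ?_
  filter_upwards [Ioo_mem_nhdsGT hδ0] with ε hε
  set g : ℝ × (Fin n → ℝ) → ENNReal := fun q =>
    ENNReal.ofReal (1 - M.sideProfile ε l (M.inward l s q.1 q.2)) with hg
  have hgm : Measurable g := by
    refine (measurable_const.sub ((M.continuous_sideProfile ε l).measurable.comp ?_)).ennreal_ofReal
    simp_rw [inward_eq]
    exact (measurePreserving_ins l _ (neg_sgn_eq s)).measurable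
  have hCS := ENNReal.lintegral_mul_le_Lp_mul_Lq (slab ε (M.faceDom l)) Real.HolderConjugate.two_two
    (hf.mono_measure (slab_mono hε.2.le)) hgm.aemeasurable
  simp only [ENNReal.rpow_two] at hCS
  obtain ⟨B, hBv, hB1⟩ := hB ε hε.1
  set B' := toMeasurable (volume.restrict (M.faceDom l)) B with hB'
  -- The defect is at most one and lives over a set of measure `Kε` in the face, so its square
  -- integrates to at most `Kε²` over the collar. After Cauchy–Schwarz its root cancels `1/ε`, and
  -- the `L²` norm of `f` on the shrinking collar tends to zero.
  have hg2 : ∫⁻ q, g q ^ 2 ∂(slab ε (M.faceDom l)) ≤ K * ENNReal.ofReal ε ^ 2 := by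
    calc ∫⁻ q, g q ^ 2 ∂(slab ε (M.faceDom l))
        ≤ ∫⁻ q, (Set.univ ×ˢ B').indicator 1 q ∂(slab ε (M.faceDom l)) := by
          refine lintegral_mono fun q => ?_
          by_cases hq : q.2 ∈ B'
          · rw [Set.indicator_of_mem (Set.mk_mem_prod (Set.mem_univ _) hq)]
            refine pow_le_one₀ zero_le (ENNReal.ofReal_le_one.2 ?_)
            linarith [M.sideProfile_nonneg ε l (M.inward l s q.1 q.2)]
          · have : q.2 ∉ B := fun h => hq (subset_toMeasurable _ _ h)
            simp only [hg, inward_eq, hB1 _ this]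
            simp
      _ = slab ε (M.faceDom l) (Set.univ ×ˢ B') :=
          lintegral_indicator_one (MeasurableSet.univ.prod (measurableSet_toMeasurable _ _))
      _ = ENNReal.ofReal ε * volume.restrict (M.faceDom l) B := by
          rw [slab, Measure.prod_prod, Measure.restrict_apply_univ, Real.volume_Ioo, sub_zero, hB',
            measure_toMeasurable]
      _ ≤ ENNReal.ofReal ε * (K * ENNReal.ofReal ε) := mul_le_mul_right hBv _
      _ = K * ENNReal.ofReal ε ^ 2 := by ring
  have hε' : ENNReal.ofReal ε⁻¹ * ENNReal.ofReal ε = 1 := by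
    rw [← ENNReal.ofReal_mul (inv_nonneg.2 hε.1.le), inv_mul_cancel₀ hε.1.ne', ENNReal.ofReal_one]
  calc _ ≤ ENNReal.ofReal ε⁻¹ * ((∫⁻ q, f q ^ 2 ∂(slab ε (M.faceDom l))) ^ (1 / 2 : ℝ)
        * (K * ENNReal.ofReal ε ^ 2) ^ (1 / 2 : ℝ)) :=
        mul_le_mul_right (hCS.trans (mul_le_mul_right
          (ENNReal.rpow_le_rpow hg2 (by norm_num)) _)) _
    _ = (ENNReal.ofReal ε⁻¹ * ENNReal.ofReal ε) *
        ((∫⁻ q, f q ^ 2 ∂(slab ε (M.faceDom l))) ^ (1 / 2 : ℝ) * K ^ (1 / 2 : ℝ)) := by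
        rw [ENNReal.mul_rpow_of_nonneg _ _ (by norm_num : (0 : ℝ) ≤ 1 / 2),
          ← ENNReal.rpow_natCast, ← ENNReal.rpow_mul]
        norm_num
        ring
    _ = _ := by rw [hε', one_mul]

end Pairing

end ParamMesh

end SkeletonStab

namespace SkeletonStab

namespace ParamMesh

variable {n : ℕ} {M : ParamMesh n} {F : Param n → Phys n} {r : ℕ}

/-! ### The stress flux and the boundary pairing -/

section PairingLimit

variable {σ : Phys n → Matrix (Fin (n + 1)) (Fin (n + 1)) ℝ} {v gv : Phys n → Phys n}

/-- The integrand of the flux pairing of a tensor and a boundary field over a collar. -/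
def pairingFlux (M : ParamMesh n) (F : Param n → Phys n)
    (σ : Phys n → Matrix (Fin (n + 1)) (Fin (n + 1)) ℝ) (gv : Phys n → Phys n)
    (l : Fin (n + 1)) (s : Bool) (q : ℝ × (Fin n → ℝ)) : ℝ :=
  inner ℝ (M.areaVec F l (M.inward l s 0 q.2))
    (matVec (σ (F (M.inward l s q.1 q.2))) (gv (F (M.inward l s 0 q.2))))

theorem IsGeometryMap.integrable_pairingFlux (hF : M.IsGeometryMap F r)
    (hσ : ∀ i j, MemL2 (M.domain F) fun z => σ z i j) (hgv : M.MemL2Bdry F gv)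
    {δ : ℝ} (hδ : ∀ i, ∀ j < M.N i, δ ≤ M.ζ i (j + 1) - M.ζ i j) (l : Fin (n + 1)) (s : Bool)
    {C : ℝ} (hC : ∀ᵐ y ∂(volume.restrict (M.faceDom l)), ‖gv (F (M.inward l s 0 y))‖ ≤ C) :
    Integrable (M.pairingFlux F σ gv l s) (slab δ (M.faceDom l)) := by
  have := hF.isFiniteMeasure_domain
  obtain ⟨C₁, hC10, hC1⟩ := hF.exists_norm_areaVec_le
  have hN : Integrable (fun q : ℝ × (Fin n → ℝ) => entrySum (σ (F (M.inward l s q.1 q.2))))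
      (slab δ (M.faceDom l)) :=
    memLp_one_iff_integrable.1 (memLp_inward hF
      (memLp_one_iff_integrable.2 ((memL2_entrySum hσ).integrable one_le_two)) hδ l s)
  refine Integrable.mono' (hN.const_mul (C₁ * C)) ?_ ?_
  · have hW : AEStronglyMeasurable (fun y => M.areaVec F l (M.inward l s 0 y))
        (volume.restrict (M.faceDom l)) := by
      simp_rw [inward_zero]
      exact (continuousOn_comp_ins_const (hF.continuousOn_areaVec l)
        (M.bdryCoord_mem l s)).aestronglyMeasurable (M.measurableSet_faceDom l)
    exact aestronglyMeasurable_inner_matVec (aestronglyMeasurable_comp_snd_slab hW)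
      (fun i j => aestronglyMeasurable_inward hF (hσ i j).1 hδ l s subset_rfl)
      (aestronglyMeasurable_comp_snd_slab (hgv l s).1)
  · filter_upwards [ae_slab_snd hC δ, ae_slab_mem (M.measurableSet_faceDom l) δ] with q hq hqm
    refine (abs_inner_matVec_le _ _ _).trans ?_
    rw [mul_comm]
    exact mul_le_mul_of_nonneg_right (mul_le_mul (hC1 l _ (inward_mem_closedBox s hqm.2)) hq
      (norm_nonneg _) hC10) (entrySum_nonneg _)

/-- The collar means defining the boundary pairing, in parametric form. -/
theorem IsGeometryMap.collar_pairing_eq (hF : M.IsGeometryMap F r) {ε : ℝ}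
    (hi : ∀ l s, Integrable (M.pairingFlux F σ gv l s) (slab ε (M.faceDom l))) :
    ε⁻¹ * ∑ i, ∑ s : Bool, ∫ t in Set.Ioo 0 ε, ∫ y in M.faceDom i,
        inner ℝ (contract (M.outNormal F i s y) (σ (F (M.inward i s t y))))
          (gv (F (M.inward i s 0 y))) * M.areaFactor F i (M.inward i s 0 y)
      = ε⁻¹ * ∑ l, ∑ s : Bool, sgn s * ∫ q, M.pairingFlux F σ gv l s q ∂(slab ε (M.faceDom l)) := by
  congr 1
  refine Finset.sum_congr rfl fun l _ => Finset.sum_congr rfl fun s _ => ?_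
  rw [slab, integral_prod _ (hi l s), ← integral_const_mul]
  refine integral_congr_ae (Eventually.of_forall fun t => ?_)
  simp only
  rw [← integral_const_mul]
  refine setIntegral_congr_fun (M.measurableSet_faceDom l) fun y hy => ?_
  simp only [pairingFlux]
  rw [inner_contract, mul_comm, ← real_inner_smul_left, outNormal_areaFactor hF l s hy,
    real_inner_smul_left]

/-- The gradient of the cutoff recovers the boundary pairing of a square integrable tensor with
the trace of a cellwise smooth field. -/
theorem IsGeometryMap.tendsto_cutoffGrad_add_pairing (hF : M.IsGeometryMap F r)
    (hσ : ∀ i j, MemL2 (M.domain F) fun z => σ z i j) (hgv : M.MemL2Bdry F gv)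
    (hσv : IntegrableOn (fun z => matVec (σ z) (v z)) (M.domain F))
    {δ : ℝ} (hδ0 : 0 < δ) (hδ : ∀ i, ∀ j < M.N i, δ ≤ M.ζ i (j + 1) - M.ζ i j)
    {C : ℝ} (hC0 : 0 ≤ C)
    (hC : ∀ i s, ∀ᵐ y ∂(volume.restrict (M.faceDom i)), ∀ t ∈ Set.Ioo 0 δ,
      ‖v (F (M.inward i s t y))‖ ≤ C ∧ ‖gv (F (M.inward i s 0 y))‖ ≤ C ∧
      ‖v (F (M.inward i s t y)) - gv (F (M.inward i s 0 y))‖ ≤ C * t ∧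
      ‖M.areaVec F i (M.inward i s t y)‖ ≤ C ∧ ‖M.areaVec F i (M.inward i s 0 y)‖ ≤ C ∧
      ‖M.areaVec F i (M.inward i s t y) - M.areaVec F i (M.inward i s 0 y)‖ ≤ C * t) :
    Tendsto (fun ε : ℝ => (∫ z in M.domain F, ∑ i, hF.cutoffGrad ε i z * matVec (σ z) (v z) i)
      + ε⁻¹ * ∑ i, ∑ s : Bool, ∫ t in Set.Ioo 0 ε, ∫ y in M.faceDom i,
        inner ℝ (contract (M.outNormal F i s y) (σ (F (M.inward i s t y))))
          (gv (F (M.inward i s 0 y))) * M.areaFactor F i (M.inward i s 0 y)) (𝓝[>] 0) (𝓝 0) := by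
  have hgvC : ∀ l s, ∀ᵐ y ∂(volume.restrict (M.faceDom l)), ‖gv (F (M.inward l s 0 y))‖ ≤ C :=
    fun l s => (hC l s).mono fun y hy => (hy (δ / 2) ⟨by positivity, by linarith⟩).2.1
  have hpi : ∀ ε < δ, ∀ l s, Integrable (M.pairingFlux F σ gv l s) (slab ε (M.faceDom l)) :=
    fun ε hε l s => (hF.integrable_pairingFlux hσ hgv hδ l s (hgvC l s)).mono_measure
      (slab_mono hε.le)
  set H : Phys n → Phys n := fun z => matVec (σ z) (v z) with hH
  have hsum := tendsto_sum_collar (M := M) (f := fun ε l s q =>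
    M.pairingFlux F σ gv l s q - M.sideFlux F ε H l (M.inward l s q.1 q.2)) fun l s => ?_
  · refine hsum.congr' ?_
    filter_upwards [Ioo_mem_nhdsGT (show (0 : ℝ) < δ / 2 by positivity)] with ε hε
    have hεδ : ε < δ := by linarith [hε.1, hε.2]
    rw [hF.integral_cutoffGrad hδ hε.1 (by linarith [hε.2]) hσv,
      hF.collar_pairing_eq (hpi ε hεδ), neg_add_eq_sub, ← mul_sub, ← Finset.sum_sub_distrib]
    congr 1
    refine Finset.sum_congr rfl fun l _ => ?_
    rw [← Finset.sum_sub_distrib]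
    refine Finset.sum_congr rfl fun s _ => ?_
    rw [← mul_sub, ← integral_sub (hpi ε hεδ l s)]
    exact integrable_slab hδ hεδ.le l s (hF.integrableOn_sideFlux ε hσv l)
  · have := hF.isFiniteMeasure_domain
    have hN2 := memL2_entrySum hσ
    set N : ℝ × (Fin n → ℝ) → ENNReal := fun q =>
      ENNReal.ofReal (entrySum (σ (F (M.inward l s q.1 q.2)))) with hN
    have hNe : ∀ q, N q = ‖entrySum (σ (F (M.inward l s q.1 q.2)))‖ₑ := fun q =>
      (Real.enorm_of_nonneg (entrySum_nonneg _)).symm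
    have m2 := memLp_inward hF hN2 hδ l s
    have m1 := memLp_inward hF (memLp_one_iff_integrable.2 (hN2.integrable one_le_two)) hδ l s
    have hNm : AEMeasurable N (slab δ (M.faceDom l)) := m2.1.aemeasurable.ennreal_ofReal
    have hNi : ∫⁻ q, N q ∂(slab δ (M.faceDom l)) ≠ ⊤ := by
      simp_rw [hNe]
      exact (memLp_one_iff_integrable.1 m1).2.ne
    have hNi2 : ∫⁻ q, N q ^ 2 ∂(slab δ (M.faceDom l)) ≠ ⊤ := by
      simp_rw [hNe]
      have := lintegral_rpow_enorm_lt_top_of_eLpNorm_lt_top two_ne_zero ENNReal.ofNat_ne_top m2.2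
      simpa using this.ne
    -- The two errors of size `ε` each cost `C ^ 2`; divided by `ε` they leave the integral of the
    -- stress over a shrinking collar. The tangential defect is treated separately in `t2`.
    have t1 := ENNReal.Tendsto.const_mul (a := ENNReal.ofReal (2 * C ^ 2))
      (tendsto_lintegral_slab (faceDom_volume_lt_top M l) hδ0 hNi) (Or.inr ENNReal.ofReal_ne_top)
    have t2 := ENNReal.Tendsto.const_mul (a := ENNReal.ofReal (C ^ 2))
      (tendsto_lintegral_sideProfile_defect l s hδ0 hNm hNi2) (Or.inr ENNReal.ofReal_ne_top)
    rw [mul_zero] at t1 t2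
    have t3 := t1.add t2
    rw [add_zero] at t3
    refine tendsto_of_tendsto_of_tendsto_of_le_of_le' tendsto_const_nhds t3
      (Eventually.of_forall fun _ => zero_le) ?_
    filter_upwards [Ioo_mem_nhdsGT hδ0] with ε hε
    have hε' : ENNReal.ofReal ε⁻¹ * ENNReal.ofReal ε = 1 := by
      rw [← ENNReal.ofReal_mul (inv_nonneg.2 hε.1.le), inv_mul_cancel₀ hε.1.ne', ENNReal.ofReal_one]
    have hpt : ∀ᵐ q ∂(slab ε (M.faceDom l)),
        ‖M.pairingFlux F σ gv l s q - M.sideFlux F ε H l (M.inward l s q.1 q.2)‖ₑ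
          ≤ ENNReal.ofReal (2 * C ^ 2) * ENNReal.ofReal ε * N q + ENNReal.ofReal (C ^ 2) *
            (N q * ENNReal.ofReal (1 - M.sideProfile ε l (M.inward l s q.1 q.2))) := by
      filter_upwards [ae_slab_snd (hC l s) ε, ae_slab_mem (M.measurableSet_faceDom l) ε] with q hq hqm
      obtain ⟨b1, b2, b3, b4, b5, b6⟩ := hq q.1 ⟨hqm.1.1, hqm.1.2.trans hε.2⟩
      have hs1 : 0 ≤ 1 - M.sideProfile ε l (M.inward l s q.1 q.2) :=
        sub_nonneg.2 (M.sideProfile_le_one _ _ _)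
      rw [hN, ← ENNReal.ofReal_mul (by positivity), ← ENNReal.ofReal_mul (by
          have := hε.1; positivity),
        ← ENNReal.ofReal_mul (entrySum_nonneg _), ← ENNReal.ofReal_mul (by positivity),
        ← ENNReal.ofReal_add (mul_nonneg (by have := hε.1; positivity) (entrySum_nonneg _))
          (mul_nonneg (by positivity) (mul_nonneg (entrySum_nonneg _) hs1)), ← ofReal_norm]
      refine ENNReal.ofReal_le_ofReal ?_
      set W := M.areaVec F l (M.inward l s q.1 q.2)
      set W₀ := M.areaVec F l (M.inward l s 0 q.2)
      set V := v (F (M.inward l s q.1 q.2))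
      set g := gv (F (M.inward l s 0 q.2))
      set S := σ (F (M.inward l s q.1 q.2))
      set θ := M.sideProfile ε l (M.inward l s q.1 q.2)
      -- Three errors: the tangential cutoff, the variation of the area vector with depth, and the
      -- deviation of `v` from its trace.
      have e : M.pairingFlux F σ gv l s q - M.sideFlux F ε H l (M.inward l s q.1 q.2)
          = (1 - θ) * inner ℝ W (matVec S V) - inner ℝ (W - W₀) (matVec S g)
            - inner ℝ W (matVec S (V - g)) := by
        change inner ℝ W₀ (matVec S g) - θ * inner ℝ W (matVec S V) = _
        rw [matVec_sub, inner_sub_left, inner_sub_right]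
        ring
      have c1 := abs_inner_matVec_le W S V
      have c2 := abs_inner_matVec_le (W - W₀) S g
      have c3 := abs_inner_matVec_le W S (V - g)
      have hS := entrySum_nonneg S
      have htε := hqm.1.2.le
      have d1 : ‖W‖ * ‖V‖ ≤ C * C := mul_le_mul b4 b1 (norm_nonneg _) hC0
      have d2 : ‖W - W₀‖ * ‖g‖ ≤ C * ε * C := mul_le_mul
        (b6.trans (mul_le_mul_of_nonneg_left htε hC0)) b2 (norm_nonneg _)
        (mul_nonneg hC0 hε.1.le)
      have d3 : ‖W‖ * ‖V - g‖ ≤ C * (C * ε) := mul_le_mul b4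
        (b3.trans (mul_le_mul_of_nonneg_left htε hC0)) (norm_nonneg _) hC0
      have c1' : |(1 - θ) * inner ℝ W (matVec S V)| ≤ (1 - θ) * (entrySum S * (C * C)) := by
        rw [abs_mul, abs_of_nonneg hs1]
        exact mul_le_mul_of_nonneg_left (c1.trans (mul_le_mul_of_nonneg_left d1 hS)) hs1
      have c2' := c2.trans (mul_le_mul_of_nonneg_left d2 hS)
      have c3' := c3.trans (mul_le_mul_of_nonneg_left d3 hS)
      rw [e, Real.norm_eq_abs]
      refine (abs_sub _ _).trans ((add_le_add (abs_sub _ _) le_rfl).trans ?_)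
      refine (add_le_add (add_le_add c1' c2') c3').trans_eq ?_
      ring
    calc _ ≤ ENNReal.ofReal ε⁻¹ * ∫⁻ q, (ENNReal.ofReal (2 * C ^ 2) * ENNReal.ofReal ε * N q
          + ENNReal.ofReal (C ^ 2) * (N q *
            ENNReal.ofReal (1 - M.sideProfile ε l (M.inward l s q.1 q.2))))
              ∂(slab ε (M.faceDom l)) := mul_le_mul_right (lintegral_mono_ae hpt) _
      _ = (ENNReal.ofReal ε⁻¹ * ENNReal.ofReal ε) * (ENNReal.ofReal (2 * C ^ 2) *
            ∫⁻ q, N q ∂(slab ε (M.faceDom l))) + ENNReal.ofReal (C ^ 2) * (ENNReal.ofReal ε⁻¹ *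
            ∫⁻ q, N q * ENNReal.ofReal (1 - M.sideProfile ε l (M.inward l s q.1 q.2))
              ∂(slab ε (M.faceDom l))) := by
          rw [lintegral_add_left' ((hNm.mono_measure (slab_mono hε.2.le)).const_mul _),
            lintegral_const_mul' _ _ (ENNReal.mul_ne_top ENNReal.ofReal_ne_top
              ENNReal.ofReal_ne_top), lintegral_const_mul' _ _ ENNReal.ofReal_ne_top]
          ring
      _ = _ := by rw [hε', one_mul]

end PairingLimit

end ParamMesh

end SkeletonStab

namespace SkeletonStab

namespace ParamMesh

variable {n : ℕ} {M : ParamMesh n} {F : Param n → Phys n} {r : ℕ}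

/-! ### The weak equation tested with the cut-off field -/

section WeakEquation

theorem IsGeometryMap.integrableOn_cutoff_mul (hF : M.IsGeometryMap F r) (ε : ℝ) {g : Phys n → ℝ}
    (hg : IntegrableOn g (M.domain F)) :
    IntegrableOn (fun z => hF.cutoff ε z * g z) (M.domain F) :=
  hg.bdd_mul (c := 1) (hF.aestronglyMeasurable_cutoff ε) (Eventually.of_forall fun z => by
    rw [Real.norm_eq_abs, abs_of_nonneg (hF.cutoff_nonneg ε z)]; exact hF.cutoff_le_one ε z)

theorem IsGeometryMap.integrableOn_cutoffGrad_sum (hF : M.IsGeometryMap F r) {ε : ℝ} (hε : 0 < ε)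
    {H : Phys n → Phys n} (hH : IntegrableOn H (M.domain F)) :
    IntegrableOn (fun z => ∑ i, hF.cutoffGrad ε i z * H z i) (M.domain F) := by
  obtain ⟨C, -, hC⟩ := hF.exists_cutoffGrad_bound hε
  refine integrable_finsetSum _ fun i _ => ?_
  exact (hH.eval_piLp i).bdd_mul (c := C) (hF.aestronglyMeasurable_cutoffGrad ε i)
    ((ae_restrict_mem hF.isOpen_domain.measurableSet).mono fun z hz => hC i z hz)

theorem IsGeometryMap.tendsto_integral_cutoff_mul (hF : M.IsGeometryMap F r) {g : Phys n → ℝ}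
    (hg : IntegrableOn g (M.domain F)) :
    Tendsto (fun ε => ∫ z in M.domain F, hF.cutoff ε z * g z) (𝓝[>] 0)
      (𝓝 (∫ z in M.domain F, g z)) := by
  refine tendsto_integral_filter_of_dominated_convergence (fun z => ‖g z‖)
    (Eventually.of_forall fun ε => (hF.integrableOn_cutoff_mul ε hg).1)
    (Eventually.of_forall fun ε => Eventually.of_forall fun z => ?_) hg.norm ?_
  · rw [norm_mul, Real.norm_eq_abs, abs_of_nonneg (hF.cutoff_nonneg ε z)]
    exact mul_le_of_le_one_left (norm_nonneg _) (hF.cutoff_le_one ε z)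
  · filter_upwards [ae_restrict_mem hF.isOpen_domain.measurableSet] with z hz
    refine tendsto_const_nhds.congr' ?_
    filter_upwards [hF.cutoff_eventually_eq_one hz] with ε hε
    rw [hε, one_mul]

theorem memL2_apply {Ω : Set (Phys n)} {u : Phys n → Phys n} (hu : MemL2 Ω u) (i : Fin (n + 1)) :
    MemL2 Ω fun z => u z i := MemLp.eval_piLp hu i

theorem integrableOn_mul_of_memL2 {Ω : Set (Phys n)} {f g : Phys n → ℝ} (hf : MemL2 Ω f)
    (hg : MemL2 Ω g) : IntegrableOn (fun z => f z * g z) Ω :=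
  MemLp.integrable_mul hf hg

theorem integrableOn_inner_of_memL2 {Ω : Set (Phys n)} {u v : Phys n → Phys n} (hu : MemL2 Ω u)
    (hv : MemL2 Ω v) : IntegrableOn (fun z => (inner ℝ (u z) (v z) : ℝ)) Ω := by
  simp_rw [PiLp.inner_apply]
  refine integrable_finsetSum _ fun i _ => ?_
  exact integrableOn_mul_of_memL2 (memL2_apply hv i) (memL2_apply hu i)

theorem memL2_symGrad {Ω : Set (Phys n)} {G : Fin (n + 1) → Phys n → Phys n}
    (hG : ∀ i, MemL2 Ω (G i)) (i j : Fin (n + 1)) : MemL2 Ω fun z => symGrad G z i j :=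
  (((memL2_apply (hG i) j).add (memL2_apply (hG j) i)).const_mul (1 / 2)).congr_norm
    ((((memL2_apply (hG i) j).1.add (memL2_apply (hG j) i).1).const_mul (1 / 2)).congr
      (Eventually.of_forall fun z => by simp [symGrad]; ring))
    (Eventually.of_forall fun z => by simp [symGrad, div_eq_inv_mul])

/-- Symmetry of the strain of `u` makes both halves of the symmetrized product of `P` and `v`
contribute equally, so the extra term is `P` against the stress applied to `v`. -/
theorem sum_symGrad_mul_symGrad_smul_add (Gu Gv Gw : Fin (n + 1) → Phys n → Phys n)
    (v : Phys n → Phys n) (ν φ : ℝ) (P : Fin (n + 1) → ℝ) (z : Phys n)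
    (hGw : ∀ i, Gw i z = φ • Gv i z + P i • v z) :
    2 * ν * ∑ i, ∑ j, symGrad Gu z i j * symGrad Gw z i j
      = φ * (2 * ν * ∑ i, ∑ j, symGrad Gu z i j * symGrad Gv z i j)
        + ∑ i, P i * matVec ((2 * ν) • symGrad Gu z) (v z) i := by
  have hsymm : ∀ i j, symGrad Gu z i j = symGrad Gu z j i := fun i j => by
    simp [symGrad, add_comm]
  have e1 : ∀ i j, symGrad Gw z i j
      = φ * symGrad Gv z i j + (P i * v z j + P j * v z i) / 2 := fun i j => by
    simp only [symGrad, Matrix.of_apply, hGw, PiLp.add_apply, PiLp.smul_apply, smul_eq_mul]; ring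
  have e2 : ∑ i, ∑ j, symGrad Gu z i j * (P j * v z i)
      = ∑ i, ∑ j, symGrad Gu z i j * (P i * v z j) := by
    rw [Finset.sum_comm]
    exact Finset.sum_congr rfl fun i _ => Finset.sum_congr rfl fun j _ => by rw [hsymm]
  have e3 : ∑ i, ∑ j, symGrad Gu z i j * symGrad Gw z i j
      = φ * ∑ i, ∑ j, symGrad Gu z i j * symGrad Gv z i j
        + (∑ i, ∑ j, symGrad Gu z i j * (P i * v z j)
          + ∑ i, ∑ j, symGrad Gu z i j * (P j * v z i)) / 2 := by
    simp only [Finset.mul_sum, Finset.sum_div, ← Finset.sum_add_distrib, e1]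
    exact Finset.sum_congr rfl fun i _ => Finset.sum_congr rfl fun j _ => by ring
  rw [e3, e2]
  have e4 : ∑ i, P i * matVec ((2 * ν) • symGrad Gu z) (v z) i
      = 2 * ν * ∑ i, ∑ j, symGrad Gu z i j * (P i * v z j) := by
    simp only [matVec_apply, Matrix.smul_apply, smul_eq_mul, Finset.mul_sum]
    exact Finset.sum_congr rfl fun i _ => Finset.sum_congr rfl fun j _ => by ring
  rw [e4]
  ring

theorem sum_convection_smul_add (Gv Gw : Fin (n + 1) → Phys n → Phys n)
    (u v : Phys n → Phys n) (φ : ℝ) (P : Fin (n + 1) → ℝ) (z : Phys n)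
    (hGw : ∀ i, Gw i z = φ • Gv i z + P i • v z) :
    ∑ i, ∑ j, u z i * u z j * Gw i z j
      = φ * (∑ i, ∑ j, u z i * u z j * Gv i z j)
        + ∑ i, P i * ((inner ℝ (u z) (v z) : ℝ) • u z) i := by
  simp only [hGw, PiLp.add_apply, PiLp.smul_apply, smul_eq_mul, PiLp.inner_apply,
    RCLike.inner_apply, conj_trivial, Finset.mul_sum, Finset.sum_mul, ← Finset.sum_add_distrib]
  exact Finset.sum_congr rfl fun i _ => Finset.sum_congr rfl fun j _ => by ring

/-- Since the divergence of `v` vanishes, the pressure sees only the gradient of the cutoff. -/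
theorem sum_div_smul_add (Gv Gw : Fin (n + 1) → Phys n → Phys n)
    (v : Phys n → Phys n) (φ p : ℝ) (P : Fin (n + 1) → ℝ) (z : Phys n)
    (hGw : ∀ i, Gw i z = φ • Gv i z + P i • v z) (hdiv : ∑ i, Gv i z i = 0) :
    (∑ i, Gw i z i) * p = ∑ i, P i * (p • v z) i := by
  simp only [hGw, PiLp.add_apply, PiLp.smul_apply, smul_eq_mul, Finset.sum_add_distrib,
    ← Finset.mul_sum, hdiv, mul_zero, zero_add, Finset.sum_mul]
  exact Finset.sum_congr rfl fun i _ => by ring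

theorem formA_smul_add {Ω : Set (Phys n)} {ν : ℝ} {Gu Gv : Fin (n + 1) → Phys n → Phys n}
    {v : Phys n → Phys n} {φ : Phys n → ℝ} {P : Fin (n + 1) → Phys n → ℝ}
    (h1 : IntegrableOn (fun z => φ z *
      (2 * ν * ∑ i, ∑ j, symGrad Gu z i j * symGrad Gv z i j)) Ω)
    (h2 : IntegrableOn (fun z => ∑ i, P i z * matVec ((2 * ν) • symGrad Gu z) (v z) i) Ω) :
    formA Ω ν Gu (fun i z => φ z • Gv i z + P i z • v z)
      = (∫ z in Ω, φ z * (2 * ν * ∑ i, ∑ j, symGrad Gu z i j * symGrad Gv z i j))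
        + ∫ z in Ω, ∑ i, P i z * matVec ((2 * ν) • symGrad Gu z) (v z) i := by
  rw [← integral_add h1 h2, formA]
  exact integral_congr_ae (Eventually.of_forall fun z =>
    sum_symGrad_mul_symGrad_smul_add Gu Gv (fun i z => φ z • Gv i z + P i z • v z) v ν (φ z) (fun i => P i z) z fun i => rfl)

theorem formC_smul_add {Ω : Set (Phys n)} {Gv : Fin (n + 1) → Phys n → Phys n}
    {u v : Phys n → Phys n} {φ : Phys n → ℝ} {P : Fin (n + 1) → Phys n → ℝ}
    (h1 : IntegrableOn (fun z => φ z * ∑ i, ∑ j, u z i * u z j * Gv i z j) Ω)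
    (h2 : IntegrableOn (fun z => ∑ i, P i z * ((inner ℝ (u z) (v z) : ℝ) • u z) i) Ω) :
    formC Ω u u (fun i z => φ z • Gv i z + P i z • v z)
      = -((∫ z in Ω, φ z * ∑ i, ∑ j, u z i * u z j * Gv i z j)
        + ∫ z in Ω, ∑ i, P i z * ((inner ℝ (u z) (v z) : ℝ) • u z) i) := by
  rw [← integral_add h1 h2, formC]
  exact congrArg _ (integral_congr_ae (Eventually.of_forall fun z =>
    sum_convection_smul_add Gv (fun i z => φ z • Gv i z + P i z • v z) u v (φ z) (fun i => P i z) z fun i => rfl))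

theorem formB_smul_add {Ω : Set (Phys n)} {Gv : Fin (n + 1) → Phys n → Phys n}
    {v : Phys n → Phys n} {φ p : Phys n → ℝ} {P : Fin (n + 1) → Phys n → ℝ}
    (hdiv : ∀ᵐ z ∂(volume.restrict Ω), ∑ i, Gv i z i = 0) :
    formB Ω (fun i z => φ z • Gv i z + P i z • v z) p
      = ∫ z in Ω, ∑ i, P i z * (p z • v z) i := by
  rw [formB]
  exact integral_congr_ae (hdiv.mono fun z hz =>
    sum_div_smul_add Gv (fun i z => φ z • Gv i z + P i z • v z) v (φ z) (p z) (fun i => P i z) z (fun i => rfl) hz)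

/-- The consistency term: for a weak solution, the boundary pairing of the viscous stress with the
trace of a solenoidal cellwise smooth field exists and equals the residual. -/
theorem IsGeometryMap.hasBdryPairing_of_equation (hF : M.IsGeometryMap F r) (hr : 2 ≤ r) {ν : ℝ}
    {u v gv f ut : Phys n → Phys n} {p : Phys n → ℝ} (hu : M.MemH10 F u)
    (hp : MemL2 (M.domain F) p) (hf : MemL2 (M.domain F) f) (hut : MemL2 (M.domain F) ut)
    (heq : ∀ Gu, IsWeakGrad (M.domain F) u Gu → ∀ w, M.MemH10 F w → ∀ Gw,
      IsWeakGrad (M.domain F) w Gw →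
      ip (M.domain F) ut w + formA (M.domain F) ν Gu Gw + formC (M.domain F) u u Gw
        - formB (M.domain F) Gw p = ip (M.domain F) f w)
    (hv : M.IsCellC1 F v) (hvn : M.MemH1n F v) (hgv : M.IsTrace F v gv)
    {Gu Gv : Fin (n + 1) → Phys n → Phys n} (hGu : IsWeakGrad (M.domain F) u Gu)
    (hGu2 : ∀ i, MemL2 (M.domain F) (Gu i)) (hGv : IsWeakGrad (M.domain F) v Gv)
    (hGv2 : ∀ i, MemL2 (M.domain F) (Gv i))
    (hdiv : ∀ᵐ z ∂(volume.restrict (M.domain F)), ∑ i, Gv i z i = 0) :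
    M.HasBdryPairing F (fun x => (2 * ν) • symGrad Gu x) gv
      (ip (M.domain F) ut v + formA (M.domain F) ν Gu Gv + formC (M.domain F) u u Gv
        - ip (M.domain F) f v) := by
  have hfin := hF.isFiniteMeasure_domain
  obtain ⟨δ, hδ0, hδ⟩ := M.exists_mesh_width
  obtain ⟨C, hC0, hC⟩ := hv.exists_collar_bounds hF hr hvn hgv hδ0 hδ
  obtain ⟨Cv, hCv0, hCv⟩ := hv.exists_bound_ae hF
  obtain ⟨Cg, hCg0, hCg⟩ := hv.exists_bound_grad hF (by omega) hGv
  have hu2 := hu.1.1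
  have hv2 := hvn.1.1
  have hσ : ∀ i j, MemL2 (M.domain F) fun z => ((2 * ν) • symGrad Gu z) i j := fun i j =>
    (memL2_symGrad hGu2 i j).const_mul (2 * ν)
  -- The three fields met by the gradient of the cutoff: viscous stress, convection and pressure.
  set H₁ : Phys n → Phys n := fun z => matVec ((2 * ν) • symGrad Gu z) (v z) with hH1
  set H₂ : Phys n → Phys n := fun z => (inner ℝ (u z) (v z) : ℝ) • u z with hH2
  set H₃ : Phys n → Phys n := fun z => p z • v z with hH3
  have i1 : IntegrableOn H₁ (M.domain F) := Integrable.of_eval_piLp fun i => by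
    simp only [hH1, matVec_apply]
    exact integrable_finsetSum _ fun j _ => integrableOn_mul_of_memL2 (hσ i j) (memL2_apply hv2 j)
  have hH2le : ∀ᵐ z ∂(volume.restrict (M.domain F)), ‖H₂ z‖ ≤ Cv * ‖u z‖ ^ 2 := by
    filter_upwards [hCv] with z hz
    rw [hH2, norm_smul]
    have h1 := norm_inner_le_norm (𝕜 := ℝ) (u z) (v z)
    have h2 := norm_nonneg (u z)
    have h3 := mul_le_mul_of_nonneg_left hz h2
    nlinarith
  have i2 : IntegrableOn H₂ (M.domain F) := by
    refine Integrable.mono' ((hu2.integrable_norm_pow two_ne_zero).const_mul Cv) ?_ hH2le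
    exact (AEStronglyMeasurable.inner (𝕜 := ℝ) hu2.1 hv2.1).smul hu2.1
  have i3 : IntegrableOn H₃ (M.domain F) := Integrable.of_eval_piLp fun i =>
    integrableOn_mul_of_memL2 hp (memL2_apply hv2 i)
  have j1 := integrableOn_inner_of_memL2 hut hv2
  have j2 : IntegrableOn (fun z => 2 * ν * ∑ i, ∑ j, symGrad Gu z i j * symGrad Gv z i j)
      (M.domain F) := by
    refine Integrable.const_mul (integrable_finsetSum _ fun i _ => integrable_finsetSum _ fun j _ =>
      ?_) _
    exact integrableOn_mul_of_memL2 (memL2_symGrad hGu2 i j) (memL2_symGrad hGv2 i j)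
  have j3 : IntegrableOn (fun z => ∑ i, ∑ j, u z i * u z j * Gv i z j) (M.domain F) := by
    refine integrable_finsetSum _ fun i _ => integrable_finsetSum _ fun j _ => ?_
    refine (integrableOn_mul_of_memL2 (memL2_apply hu2 i) (memL2_apply hu2 j)).mul_bdd (c := Cg)
      (memL2_apply (hGv2 i) j).1 ?_
    exact hCg.mono fun z hz => (PiLp.norm_apply_le _ _).trans (hz i)
  have j4 := integrableOn_inner_of_memL2 hf hv2
  have L1 := hF.tendsto_integral_cutoff_mul j1
  have L2 := hF.tendsto_integral_cutoff_mul j2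
  have L3 := hF.tendsto_integral_cutoff_mul j3
  have L4 := hF.tendsto_integral_cutoff_mul j4
  have T1 := hF.tendsto_cutoffGrad_add_pairing hσ hgv.1 i1 hδ0 hδ hC0 fun i s =>
    (hC i s).mono fun y hy t ht => by
      obtain ⟨b1, b2, b3, b4, b5, b6, -⟩ := hy t ht
      exact ⟨b1, b2, b3, b4, b5, b6⟩
  have T2 := hF.tendsto_cutoffGrad_of_sq i2 hu2 hu.2 hH2le
  have T3 := hF.tendsto_cutoffGrad_of_normal (v := v) (hp.integrable one_le_two) i3 hδ0 hδ hC0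
    fun i s => (hC i s).mono fun y hy t ht => (hy t ht).2.2.2.2.2.2
  -- The weak equation for the cut-off field, solved for the stress flux, the only term whose limit
  -- is not yet known.
  have key : ∀ᶠ ε in 𝓝[>] (0 : ℝ),
      (∫ z in M.domain F, ∑ i, hF.cutoffGrad ε i z * H₁ z i)
        = -(∫ z in M.domain F, hF.cutoff ε z * inner ℝ (ut z) (v z))
          - (∫ z in M.domain F, hF.cutoff ε z *
              (2 * ν * ∑ i, ∑ j, symGrad Gu z i j * symGrad Gv z i j))
          + (∫ z in M.domain F, hF.cutoff ε z * ∑ i, ∑ j, u z i * u z j * Gv i z j)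
          + (∫ z in M.domain F, hF.cutoff ε z * inner ℝ (f z) (v z))
          + (∫ z in M.domain F, ∑ i, hF.cutoffGrad ε i z * H₂ z i)
          + ∫ z in M.domain F, ∑ i, hF.cutoffGrad ε i z * H₃ z i := by
    filter_upwards [Ioo_mem_nhdsGT (show (0 : ℝ) < δ / 2 by positivity)] with ε hε
    have hεδ : 2 * ε < δ := by linarith [hε.2]
    have hw := hF.memH10_cutoff_smul hδ0 hδ hε.1 hεδ hv2 hGv hGv2 hC0 fun i s =>
      (hC i s).mono fun y hy t ht => (hy t ht).1
    have hGw := hF.isWeakGrad_cutoff_smul hε.1 (two_mul_lt_width hδ hεδ) hv2 hGv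
    have h := heq Gu hGu _ hw _ hGw
    have eA := formA_smul_add (hF.integrableOn_cutoff_mul ε j2)
      (hF.integrableOn_cutoffGrad_sum hε.1 i1)
    have eC := formC_smul_add (hF.integrableOn_cutoff_mul ε j3)
      (hF.integrableOn_cutoffGrad_sum hε.1 i2)
    have eB := formB_smul_add (v := v) (φ := hF.cutoff ε) (p := p) (P := hF.cutoffGrad ε) hdiv
    have eI : ∀ g : Phys n → Phys n, ip (M.domain F) g (fun z => hF.cutoff ε z • v z)
        = ∫ z in M.domain F, hF.cutoff ε z * inner ℝ (g z) (v z) := fun g => by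
      simp only [ip, real_inner_smul_right]
    rw [eA, eC, eB, eI, eI] at h
    linarith
  -- The limit of the stress flux is minus the residual. As the flux and the collar means of the
  -- pairing add up to zero in the limit, subtraction gives both the existence and the value of the
  -- pairing.
  have T4 := ((((L1.neg.sub L2).add L3).add L4).add T2).add T3
  have T5 := T1.sub (T4.congr' (key.mono fun ε h => h.symm))
  simp only [hH1, add_sub_cancel_left] at T5
  unfold HasBdryPairing
  convert T5 using 2
  simp only [ip, formA, formC]
  ring

end WeakEquation

end ParamMesh

end SkeletonStab

namespace SkeletonStab

namespace ParamMesh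

variable {n : ℕ} {M : ParamMesh n} {F : Param n → Phys n} {r : ℕ}

/-! ### Terms vanishing with the trace, and the divergence constraint -/

section ZeroTrace

theorem bdryInner_eq_zero {g g' : Phys n → Phys n}
    (hg : ∀ i s, ∀ᵐ y ∂(volume.restrict (M.faceDom i)), g (F (M.inward i s 0 y)) = 0) :
    M.bdryInner F g g' = 0 :=
  Finset.sum_eq_zero fun i _ => Finset.sum_eq_zero fun s _ =>
    integral_eq_zero_of_ae ((hg i s).mono fun y hy => by simp [hy])

theorem hasBdryPairing_zero {σ : Phys n → Matrix (Fin (n + 1)) (Fin (n + 1)) ℝ}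
    {g : Phys n → Phys n}
    (hg : ∀ i s, ∀ᵐ y ∂(volume.restrict (M.faceDom i)), g (F (M.inward i s 0 y)) = 0) :
    M.HasBdryPairing F σ g 0 := by
  refine tendsto_const_nhds.congr fun ε => ?_
  rw [Finset.sum_eq_zero fun i _ => Finset.sum_eq_zero fun s _ => ?_, mul_zero]
  refine integral_eq_zero_of_ae (Eventually.of_forall fun t => ?_)
  exact integral_eq_zero_of_ae ((hg i s).mono fun y hy => by simp [hy])

theorem HasBdryPairing.unique {σ : Phys n → Matrix (Fin (n + 1)) (Fin (n + 1)) ℝ}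
    {g : Phys n → Phys n} {b b' : ℝ} (h : M.HasBdryPairing F σ g b)
    (h' : M.HasBdryPairing F σ g b') : b = b' := tendsto_nhds_unique h h'

/-- The constraint is imposed on one weak gradient; uniqueness extends it to all. -/
theorem MemVhSol.div_eq_zero (hF : M.IsGeometryMap F r) {k' α' : ℕ} {v : Phys n → Phys n}
    (hv : M.MemVhSol F k' α' v) {Gv : Fin (n + 1) → Phys n → Phys n}
    (hGv : IsWeakGrad (M.domain F) v Gv) :
    ∀ᵐ z ∂(volume.restrict (M.domain F)), ∑ i, Gv i z i = 0 := by
  obtain ⟨-, G, hG, hdiv⟩ := hv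
  have h : ∀ᵐ z ∂(volume.restrict (M.domain F)), ∀ i, Gv i z = G i z :=
    ae_all_iff.2 fun i => (hGv i).ae_eq hF.isOpen_domain (hG i)
  filter_upwards [h, hdiv] with z hz hd
  simp_rw [hz]
  exact hd

end ZeroTrace

end ParamMesh

end SkeletonStab

end

theorem mainTheorem2 {n : ℕ} (hn : n + 1 = 2 ∨ n + 1 = 3)
    (M : SkeletonStab.ParamMesh n)
    (F : SkeletonStab.Param n → SkeletonStab.Phys n)
    (k' α' : ℕ) (hα : α' + 1 ≤ k')
    (hF : M.IsGeometryMap F (α' + 2))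
    (ν h CNit T : ℝ) (hν : 0 < ν) (hh : 0 < h)
    (f u ut : ℝ → SkeletonStab.Phys n → SkeletonStab.Phys n)
    (p : ℝ → SkeletonStab.Phys n → ℝ)
    (hf : ∀ t ∈ Set.Ioc 0 T, SkeletonStab.MemL2 (M.domain F) (f t))
    (hu : M.IsWeakSolution F ν T f u ut p)
    (t : ℝ) (ht : t ∈ Set.Ioc 0 T)
    (hreg : SkeletonStab.MemHFrac (M.domain F) (α' + 1) (1 / 2) (u t))
    (η : SkeletonStab.Phys n → ℝ)
    (v : SkeletonStab.Phys n → SkeletonStab.Phys n) (hv : M.MemVhSol F k' α' v) :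
    (∃ a, M.HasAstb F ν CNit h η α' (u t) v a) ∧
    (∃ l, M.HasLh F ν CNit h (f t) 0 v l) ∧
    ∀ a l, M.HasAstb F ν CNit h η α' (u t) v a → M.HasLh F ν CNit h (f t) 0 v l →
      SkeletonStab.ip (M.domain F) (ut t) v + a = l := by
  open SkeletonStab SkeletonStab.ParamMesh in
  have hut := hu.velocity t ht
  have hvn := hv.1.1
  have hC1 : M.IsCellC1 F v := fun c hc => by
    exact_mod_cast hv.1.exists_contDiffOn_cell hF (m := 1) (by omega) hc
  have hpair : ∀ {Gu Gv : Fin (n + 1) → Phys n → Phys n} {gv : Phys n → Phys n},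
      IsWeakGrad (M.domain F) (u t) Gu → (∀ i, MemL2 (M.domain F) (Gu i)) →
      IsWeakGrad (M.domain F) v Gv → (∀ i, MemL2 (M.domain F) (Gv i)) → M.IsTrace F v gv →
      M.HasBdryPairing F (fun x => (2 * ν) • symGrad Gu x) gv
        (ip (M.domain F) (ut t) v + formA (M.domain F) ν Gu Gv + formC (M.domain F) (u t) (u t) Gv
          - ip (M.domain F) (f t) v) := fun hGu hGu2 hGv hGv2 hgv => by
    refine hF.hasBdryPairing_of_equation (by omega) hut (hu.pressure t ht).1 (hf t ht)
      (hu.time_deriv t ht).1 (fun Gu hGu w hw Gw hGw => ?_) hC1 hvn hgv hGu hGu2 hGv hGv2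
      (hv.div_eq_zero hF hGv)
    -- The pressure test function is zero, which removes the continuity equation.
    have := hu.equation t ht Gu hGu w hw Gw hGw 0 ⟨MemLp.zero, by simp⟩
    simpa [formB] using this
  obtain ⟨Gu, hGu, hGu2⟩ := hut.1.2
  obtain ⟨Gv, hGv, hGv2⟩ := hvn.1.2
  obtain ⟨gv, hgv, -⟩ := hvn.2
  obtain ⟨wv, hwv⟩ := hF.exists_isNormalJump (m := α' + 1) (v := v) (by omega)
    fun c hc => hv.1.exists_contDiffOn_cell hF (by omega) hc
  -- The zero field serves both as trace of `u` and as its jump, and the symmetric Nitsche pairing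
  -- has value zero; the value of the consistency pairing is the residual.
  refine ⟨⟨_, Gu, Gv, 0, gv, 0, wv, _, 0, ⟨hGu, hGu2⟩, ⟨hGv, hGv2⟩, hut.2, hgv,
    hpair hGu hGu2 hGv hGv2 hgv, hasBdryPairing_zero fun _ _ => Eventually.of_forall fun _ => rfl,
    hF.isNormalJump_zero hreg, hwv, rfl⟩,
    ⟨_, Gv, gv, 0, ⟨hGv, hGv2⟩, hgv,
      hasBdryPairing_zero fun _ _ => Eventually.of_forall fun _ => rfl, rfl⟩, ?_⟩
  rintro a l ⟨Gu, Gv, gu, gv, wu, wv, b₁, b₂, hGu, hGv, hgu, hgv, hb₁, hb₂, hwu, -, rfl⟩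
    ⟨Gv', gv', b, -, -, hb, rfl⟩
  -- The trace chosen in the form need not be literally zero, but uniqueness makes it vanish almost
  -- everywhere, which removes both Nitsche terms containing it.
  have hgu0 := hgu.ae_eq hF hut.1.1.1 hut.2
  rw [hb₁.unique (hpair hGu.1 hGu.2 hGv.1 hGv.2 hgv), hb₂.unique (hasBdryPairing_zero hgu0),
    hb.unique (hasBdryPairing_zero fun _ _ => Eventually.of_forall fun _ => rfl),
    bdryInner_eq_zero hgu0, bdryInner_eq_zero fun _ _ => Eventually.of_forall fun _ => rfl,
    skeletonInner_eq_zero hF hreg hwu]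
  ring
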